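/- Let $T>0$. For every $N\ge 1$ consider $N$ particles $x_i(t)\in\mathbb R$ with $$\dot x_i=f_i(X)+u_i,\qquad x_i(0)=\bar x_i,\qquad u_i(t)=-\frac1{\alpha_i(t)}\,\partial_{x_i}h_i(X(t)),\qquad t\in[0,T],\ i=1,\dots,N .$$ Write $X_{-i}=(x_j)_{j\ne i}$, $m^k_Y=\frac1k\sum_{j=1}^k\delta_{y_j}$ for $Y\in\mathbb R^k$, and $\mathbf d_1$ for the Kantorovich--Rubinstein distance $\mathbf d_1(\mu,\nu)=\sup\{\int\phi\,d(\mu-\nu):\phi\ 1\text{-Lipschitz}\}$. Assume: (A) $f_i(X)=f(x_i,X_{-i})$ and $h_i(X)=h(x_i,X_{-i})$ with smooth functions $f,h$ on $\mathbb R\times\mathbb R^{N-1}$ (depending on $N$, not on $i$) that are invariant under permutations of the last $N-1$ variables. (B) $\alpha_i=\alpha$ for all $i$ and $N$, with $\alpha:[0,T]\to(0,\infty)$ continuous. (Growth and equicontinuity) For $g=f$ and for $g=\partial_\xi h$: there is $C$, independent of $N$, with $|g(\xi,Y)|\le C(1+|\xi|+\max_j|y_j|)$; and for every $R>0$ there is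 a modulus of continuity $\omega_R$, independent of $N$, with $|g(\xi,Y)-g(\xi',Y')|\le\omega_R\big(|\xi-\xi'|+\mathbf d_1(m^{N-1}_{Y},m^{N-1}_{Y'})\big)$ whenever all of $|\xi|,|\xi'|,|y_j|,|y'_j|$ are at most $R$. (Mean-field limits) $\mathbf f,\mathbf h:\mathbb R\times\mathcal P(\mathbb R)\to\mathbb R$ are the mean-field limits of $f$ and $h$: for every $R>0$ they are continuous (weak topology on measures) on $\mathbb R\times\mathcal P([-R,R])$, and for $g=f$ and $g=h$ $$\lim_{N\to\infty}\ \sup_{|\xi|\le R,\ Y\in[-R,R]^{N-1}}\big|g(\xi,Y)-\mathbf g(\xi,m^N_{(\xi,Y)})\big|=0 .$$ (Initial data) All initial positions, for all $N$, lie in one compact set, and $m^N_{\bar X}\to\bar m\in\mathcal P(\mathbb R)$ weakly as $N\to\infty$. Call $m:[0,T]\to\mathcal P(\mathbb R)$ a weak solution of $$\partial_t m+\partial_x\Big(m\big(\mathbf f(x,m)-\tfrac1\alpha\,\partial_x\mathbf h(x,m)\big)\Big)=0,\qquad m(0)=\bar m,\qquad(*)$$ if $m$ is weakly continuous, the $m(t)$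 are carried by a common compact set, $m(0)=\bar m$, $\mathbf h(\cdot,m(t))$ is differentiable for every $t$, and for all $\psi\in C_c^\infty(\mathbb R)$ and $t\in[0,T]$ one has $\frac{d}{dt}\int\psi\,dm(t)=\int\psi'(x)\big(\mathbf f(x,m(t))-\frac1{\alpha(t)}\partial_x\mathbf h(x,m(t))\big)\,dm(t)(x)$, the integrand being $m(t)$-integrable. Then: 1. Every subsequence of $N\to\infty$ has a further subsequence along which $\sup_{t\in[0,T]}\mathbf d_1(m^N_{X(t)},m(t))\to0$ for some weak solution $m$ of $(*)$. 2. If, for $g=f$ and $g=\partial_\xi h$, the moduli can be taken linear, $\omega_R(s)=L_R\,s$, then $(*)$ has exactly one weak solution $m$, and $\sup_{t\in[0,T]}\mathbf d_1(m^N_{X(t)},m(t))\to0$ as $N\to\infty$. 3. Fix $N$ and $M\ge0$. There are $C$ and $\Delta_0>0$ such that the following holds whenever $0<\Delta t\le\Delta_0$ and $N_T\Delta t=T$ with $N_T\in\mathbb N$. Put $t_\ell=(\ell-1)\Delta t$ for $\ell=1,\dots,N_T$, let $X_0=\bar X$, and let $$x_{\ell,i}=x_{\ell-1,i}+\Delta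 t\,\big(f_i(X_{\ell-1})+\tilde u_{\ell,i}\big),\qquad \tilde u_{\ell,i}=-\frac1{\alpha_i(t_\ell)}\,\partial_{x_i}h_i(X_{\ell-1}),$$ be the explicit Euler scheme ($X_{\ell-1}$ is the state at time $t_\ell$), with the piecewise constant control $u_i(t)=\tilde u_{\ell,i}$ on $[(\ell-1)\Delta t,\ell\Delta t)$. Then for all $\ell$ and $i$, given $X_{\ell-1}$, the function of $u\in\mathbb R$ $$h_i(X_\ell)+\Delta t\,\frac{\alpha_i(t_\ell)}2\,u^2,$$ where $X_\ell$ is the state after the Euler step in which particle $i$ uses $u$ and the other particles $j$ use $\tilde u_{\ell,j}$ (or any constants $w_j$ with $|w_j-\tilde u_{\ell,j}|\le M$), has exactly one minimizer, and it differs from $u_i(t)$, $t\in[(\ell-1)\Delta t,\ell\Delta t)$, by at most $C\,\Delta t$. -/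

import Mathlib

open MeasureTheory Set Filter Topology
open scoped ENNReal ContDiff

noncomputable section

/-- The partial derivative `∂_{x_i} H (X)` of a function of `N` real variables. -/
def partialDeriv {N : ℕ} (H : (Fin N → ℝ) → ℝ) (i : Fin N) (X : Fin N → ℝ) : ℝ :=
  deriv (fun s => H (Function.update X i s)) (X i)

/-- A family `F n i` (`n + 1` particles, particle `i`) of functions of the state `X ∈ ℝ ^ (n + 1)`
is symmetric, with profile `f`: one has `F n i X = f n (x_i, X_{-i})`, where each `f n` is smooth
on `ℝ × ℝ ^ n` and invariant under permutations of the last `n` variables. -/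
structure IsSymmetricFamily (F : ∀ n : ℕ, Fin (n + 1) → (Fin (n + 1) → ℝ) → ℝ)
    (f : ∀ n : ℕ, ℝ → (Fin n → ℝ) → ℝ) : Prop where
  smooth : ∀ n, ContDiff ℝ ∞ (fun q : ℝ × (Fin n → ℝ) => f n q.1 q.2)
  symm : ∀ n ξ (X : Fin n → ℝ) (σ : Equiv.Perm (Fin n)), f n ξ (X ∘ σ) = f n ξ X
  eq : ∀ n i X, F n i X = f n (X i) (i.removeNth X)

/-- The empirical measure `(1 / N) ∑ i, δ_{x_i}` (the zero measure for `N = 0`). -/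
def empMeasure {N : ℕ} (X : Fin N → ℝ) : Measure ℝ :=
  (N : ℝ≥0∞)⁻¹ • ∑ i, Measure.dirac (X i)

theorem isProbabilityMeasure_empMeasure {n : ℕ} (X : Fin (n + 1) → ℝ) :
    IsProbabilityMeasure (empMeasure X) := by
  constructor
  have h0 : ((n + 1 : ℕ) : ℝ≥0∞) ≠ 0 := by exact_mod_cast Nat.succ_ne_zero n
  simp only [empMeasure, Measure.smul_apply, Measure.finsetSum_apply, measure_univ, smul_eq_mul,
    Finset.sum_const, Finset.card_univ, Fintype.card_fin, nsmul_eq_mul, mul_one]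
  exact ENNReal.inv_mul_cancel h0 (ENNReal.natCast_ne_top _)

/-- The empirical measure of a nonempty configuration as a probability measure. -/
def emp {n : ℕ} (X : Fin (n + 1) → ℝ) : ProbabilityMeasure ℝ :=
  ⟨empMeasure X, isProbabilityMeasure_empMeasure X⟩

/-- The Kantorovich-Rubinstein distance `sup {∫ φ d(μ - ν) : φ 1-Lipschitz}` (used for measures
with bounded support only). -/
def d1 (μ ν : Measure ℝ) : ℝ≥0∞ :=
  ⨆ (φ : ℝ → ℝ) (_ : LipschitzWith 1 φ), ENNReal.ofReal (∫ x, φ x ∂μ - ∫ x, φ x ∂ν)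

/-- `m` is carried by `[-R, R]`. -/
def SupportedIn (R : ℝ) (m : ProbabilityMeasure ℝ) : Prop :=
  (m : Measure ℝ) (Icc (-R) R)ᶜ = 0

/-- Linear growth, uniformly in the number of particles (`‖X‖ = max_j |x_j|`). -/
def LinearGrowth (g : ∀ n : ℕ, ℝ → (Fin n → ℝ) → ℝ) : Prop :=
  ∃ C : ℝ, ∀ n ξ X, |g n ξ X| ≤ C * (1 + |ξ| + ‖X‖)

/-- On every compact set, the functions `g n` have a common modulus of continuity with respect to
the first variable and the `d1`-distance of the empirical measures. -/
def LocallyEquicontinuous (g : ∀ n : ℕ, ℝ → (Fin n → ℝ) → ℝ) : Prop :=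
  ∀ R > 0, ∀ ε > 0, ∃ δ > 0, ∀ (n : ℕ) (ξ ξ' : ℝ) (X Y : Fin n → ℝ),
    |ξ| ≤ R → |ξ'| ≤ R → (∀ j, |X j| ≤ R) → (∀ j, |Y j| ≤ R) →
    |ξ - ξ'| ≤ δ → d1 (empMeasure X) (empMeasure Y) ≤ ENNReal.ofReal δ →
    |g n ξ X - g n ξ' Y| ≤ ε

/-- The same with a linear modulus of continuity on every compact set. -/
def LocallyEquiLipschitz (g : ∀ n : ℕ, ℝ → (Fin n → ℝ) → ℝ) : Prop :=
  ∀ R > 0, ∃ L : ℝ, ∀ (n : ℕ) (ξ ξ' : ℝ) (X Y : Fin n → ℝ),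
    |ξ| ≤ R → |ξ'| ≤ R → (∀ j, |X j| ≤ R) → (∀ j, |Y j| ≤ R) →
    |g n ξ X - g n ξ' Y| ≤ L * (|ξ - ξ'| + (d1 (empMeasure X) (empMeasure Y)).toReal)

/-- `gbar : ℝ × 𝒫(ℝ) → ℝ` is the mean-field limit of the family `g`: it is continuous (for the weak
topology) on the measures carried by a common compact set, and
`sup |g n (ξ, X_{-i}) - gbar (ξ, m^N_X)| → 0`, the supremum being over `ξ` and `X_{-i}` in a compact
set, where `X` consists of `ξ` and `X_{-i}`. -/
structure IsMeanFieldLimit (g : ∀ n : ℕ, ℝ → (Fin n → ℝ) → ℝ)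
    (gbar : ℝ → ProbabilityMeasure ℝ → ℝ) : Prop where
  continuousOn : ∀ R > 0, ContinuousOn (fun q : ℝ × ProbabilityMeasure ℝ => gbar q.1 q.2)
    {q | SupportedIn R q.2}
  tendsto : ∀ R > 0, ∀ ε > 0, ∀ᶠ n in atTop, ∀ (ξ : ℝ) (X : Fin n → ℝ),
    |ξ| ≤ R → (∀ j, |X j| ≤ R) →
    |g n ξ X - gbar ξ (emp (Fin.cons ξ X : Fin (n + 1) → ℝ))| ≤ ε

/-- The velocity field `fbar (x, m) - (1 / a) ∂_x hbar (x, m)`. -/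
def velocity (a : ℝ) (fbar hbar : ℝ → ProbabilityMeasure ℝ → ℝ) (m : ProbabilityMeasure ℝ)
    (x : ℝ) : ℝ :=
  fbar x m - 1 / a * deriv (fun y => hbar y m) x

/-- `m` is a weak (measure-valued, compactly supported) solution on `[0, T]` of
`∂_t m + ∂_x (m (fbar (x, m) - (1 / a) ∂_x hbar (x, m))) = 0` with `m 0 = m0`: for all test
functions `ψ`, one has `d/dt ∫ ψ dm_t = ∫ ψ' (fbar (·, m_t) - (1 / a t) ∂_x hbar (·, m_t)) dm_t`. -/
structure IsWeakSolution (T : ℝ) (a : ℝ → ℝ) (fbar hbar : ℝ → ProbabilityMeasure ℝ → ℝ)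
    (m0 : ProbabilityMeasure ℝ) (m : ℝ → ProbabilityMeasure ℝ) : Prop where
  init : m 0 = m0
  continuousOn : ContinuousOn m (Icc 0 T)
  support : ∃ R : ℝ, ∀ t ∈ Icc 0 T, SupportedIn R (m t)
  differentiable : ∀ t ∈ Icc 0 T, Differentiable ℝ (fun x => hbar x (m t))
  integrable : ∀ ψ : ℝ → ℝ, ContDiff ℝ ∞ ψ → HasCompactSupport ψ → ∀ t ∈ Icc 0 T,
    Integrable (fun x => deriv ψ x * velocity (a t) fbar hbar (m t) x) (m t : Measure ℝ)
  weak : ∀ ψ : ℝ → ℝ, ContDiff ℝ ∞ ψ → HasCompactSupport ψ → ∀ t ∈ Icc 0 T,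
    HasDerivWithinAt (fun s => ∫ x, ψ x ∂(m s : Measure ℝ))
      (∫ x, deriv ψ x * velocity (a t) fbar hbar (m t) x ∂(m t : Measure ℝ)) (Icc 0 T) t

/-- One explicit Euler step of size `Δt` from the state `Y` with the constant controls `w`. -/
def eulerStep {N : ℕ} (F : Fin N → (Fin N → ℝ) → ℝ) (Δt : ℝ) (Y w : Fin N → ℝ) : Fin N → ℝ :=
  fun i => Y i + Δt * (F i Y + w i)

/-- The one-step objective of particle `i` with weight `a` as a function of its own control `u`, the
other particles using the controls `w`: `h_i (X') + Δt (a / 2) u ^ 2`, with `X'` the state after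
one Euler step. -/
def oneStepCost {N : ℕ} (F H : Fin N → (Fin N → ℝ) → ℝ) (a Δt : ℝ) (Y w : Fin N → ℝ) (i : Fin N)
    (u : ℝ) : ℝ :=
  H i (eulerStep F Δt Y (Function.update w i u)) + Δt * (a / 2 * u ^ 2)

/-- The piecewise constant function with value `c ℓ` on `[ℓ Δt, (ℓ + 1) Δt)`, `ℓ < K`. -/
def piecewiseConst (K : ℕ) (Δt : ℝ) (c : ℕ → ℝ) (t : ℝ) : ℝ :=
  ∑ ℓ ∈ Finset.range K, (Ico ((ℓ : ℝ) * Δt) (((ℓ : ℝ) + 1) * Δt)).indicator (fun _ => c ℓ) t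

end

/-! Linear growth confines all particles to one interval `[-R, R]` and bounds their speeds,
uniformly in the number of particles. The empirical measures are then equi-Lipschitz curves for `d1`
in a compact set of measures, and an Arzelà-Ascoli argument (`exists_subseq_tendsto_iSup_d1`)
extracts uniform limits. For a test function `ψ`, the time derivative of `∫ ψ` is the particle
average of `ψ'` times the velocity; its integrated form passes to the limit
(`IsParticleFlow.weak_of_tendsto`) as soon as the velocities have mean-field limits. For `f` this is
assumed, for `∂_ξ h` it must be proved: a common modulus of continuity makes difference quotients
with a fixed step uniformly close to the derivatives, so the limit of `h` determines that of `∂_ξ h`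
(`isMeanFieldLimit_deriv`).

Linear moduli carry over to the limit velocity (`IsMeanFieldLimit.exists_lipschitz`). Uniqueness
uses that space is one-dimensional: the mass on one side of a characteristic is conserved
(`measureReal_Ioi_eq_of_integralCurve`), so nearby velocities give distribution functions that
differ by a small shift of the argument, and quantile functions turn the shift into a bound on `d1`
(`SupportedIn.d1_le_of_Iic_le`). Measured against `exp ((4 L + 1) t)`, each pass through this
comparison halves the distance of two solutions, which is therefore zero. Uniqueness and
subsequential compactness give convergence of the whole sequence.

For the Euler scheme, the derivative of the one-step cost divided by `Δt` is `∂_ξ h` at the new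
state plus `α u`. For small `Δt` the second term dominates, so there is a single zero; it solves the
equation of the instantaneous control with the new state in place of the old one, and these states
are `O(Δt)` apart (`exists_oneStep_bound`). -/

/-! ### The Kantorovich-Rubinstein distance and weak convergence. -/

theorem d1_le_ofReal {μ ν : Measure ℝ} {D : ℝ}
    (h : ∀ φ : ℝ → ℝ, LipschitzWith 1 φ → ∫ x, φ x ∂μ - ∫ x, φ x ∂ν ≤ D) :
    d1 μ ν ≤ ENNReal.ofReal D :=
  iSup₂_le fun φ hφ => ENNReal.ofReal_le_ofReal (h φ hφ)

theorem d1_triangle (μ ν κ : Measure ℝ) : d1 μ κ ≤ d1 μ ν + d1 ν κ := by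
  refine iSup₂_le fun φ hφ => ?_
  have h1 : ENNReal.ofReal (∫ x, φ x ∂μ - ∫ x, φ x ∂ν) ≤ d1 μ ν :=
    le_iSup₂ (f := fun φ (_ : LipschitzWith 1 φ) =>
      ENNReal.ofReal (∫ x, φ x ∂μ - ∫ x, φ x ∂ν)) φ hφ
  have h2 : ENNReal.ofReal (∫ x, φ x ∂ν - ∫ x, φ x ∂κ) ≤ d1 ν κ :=
    le_iSup₂ (f := fun φ (_ : LipschitzWith 1 φ) =>
      ENNReal.ofReal (∫ x, φ x ∂ν - ∫ x, φ x ∂κ)) φ hφ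
  refine le_trans ?_ ((ENNReal.ofReal_add_le).trans (add_le_add h1 h2))
  exact ENNReal.ofReal_le_ofReal (by linarith)

theorem d1_comm (μ ν : Measure ℝ) : d1 μ ν = d1 ν μ := by
  have key : ∀ μ ν : Measure ℝ, d1 μ ν ≤ d1 ν μ := by
    intro μ ν
    refine iSup₂_le fun φ hφ => ?_
    refine le_trans (le_of_eq ?_) (le_iSup₂ (f := fun φ (_ : LipschitzWith 1 φ) =>
      ENNReal.ofReal (∫ x, φ x ∂ν - ∫ x, φ x ∂μ)) (fun x => -φ x) hφ.neg)
    simp only [integral_neg]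
    congr 1
    ring
  exact le_antisymm (key _ _) (key _ _)

theorem d1_self (μ : Measure ℝ) : d1 μ μ = 0 := by
  simp [d1]

theorem integral_sub_le_of_d1_le {μ ν : Measure ℝ} {D : ℝ} (hD : 0 ≤ D)
    (h : d1 μ ν ≤ ENNReal.ofReal D) {φ : ℝ → ℝ} (hφ : LipschitzWith 1 φ) :
    |∫ x, φ x ∂μ - ∫ x, φ x ∂ν| ≤ D := by
  have h1 : ENNReal.ofReal (∫ x, φ x ∂μ - ∫ x, φ x ∂ν) ≤ ENNReal.ofReal D :=
    (le_iSup₂ (f := fun φ (_ : LipschitzWith 1 φ) =>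
      ENNReal.ofReal (∫ x, φ x ∂μ - ∫ x, φ x ∂ν)) φ hφ).trans h
  have h2 : ENNReal.ofReal (∫ x, φ x ∂ν - ∫ x, φ x ∂μ) ≤ ENNReal.ofReal D := by
    rw [d1_comm] at h
    exact (le_iSup₂ (f := fun φ (_ : LipschitzWith 1 φ) =>
      ENNReal.ofReal (∫ x, φ x ∂ν - ∫ x, φ x ∂μ)) φ hφ).trans h
  rw [ENNReal.ofReal_le_ofReal_iff hD] at h1 h2
  rw [abs_le]
  constructor <;> linarith

theorem SupportedIn.ae_mem {R : ℝ} {m : ProbabilityMeasure ℝ} (h : SupportedIn R m) :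
    ∀ᵐ x ∂(m : Measure ℝ), x ∈ Icc (-R) R := h

theorem SupportedIn.mono {R R' : ℝ} {m : ProbabilityMeasure ℝ} (h : SupportedIn R m)
    (hR : R ≤ R') : SupportedIn R' m := by
  refine measure_mono_null (compl_subset_compl.2 (Icc_subset_Icc (by linarith) hR)) h

theorem SupportedIn.nonneg {R : ℝ} {m : ProbabilityMeasure ℝ} (h : SupportedIn R m) : 0 ≤ R := by
  obtain ⟨x, hx⟩ := h.ae_mem.exists
  linarith [hx.1, hx.2]

theorem SupportedIn.integrable {R : ℝ} {m : ProbabilityMeasure ℝ} (h : SupportedIn R m)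
    {φ : ℝ → ℝ} (hφ : Continuous φ) : Integrable φ (m : Measure ℝ) := by
  obtain ⟨C, hC⟩ := isCompact_Icc.exists_bound_of_continuousOn (hφ.continuousOn (s := Icc (-R) R))
  exact Integrable.of_bound hφ.aestronglyMeasurable C (h.ae_mem.mono fun x hx => hC x hx)

theorem isCompact_supportedIn (R : ℝ) : IsCompact {m : ProbabilityMeasure ℝ | SupportedIn R m} := by
  have h := isCompact_setOfPred_probabilityMeasure_mass_eq_compl_isCompact_le (E := ℝ)
    (u := fun _ => 0) (K := fun _ => Icc (-R) R) tendsto_const_nhds (fun _ => isCompact_Icc)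
    (Or.inl inferInstance)
  convert h using 2 with m
  ext m
  simp only [SupportedIn, forall_const, nonpos_iff_eq_zero]
  rw [← ProbabilityMeasure.ennreal_coeFn_eq_coeFn_toMeasure]
  simp

/-- The layer-cake formula expresses `∫ g dμ` by the masses of the sets `{t ≤ g}`. Passing to `ν`
costs `ε ‖g‖ ≤ 2 R ε` and an `ε`-thickening of these sets; for a 1-Lipschitz `g` the thickening lies
in `{t ≤ g + ε}`, which costs another `ε`. -/
theorem d1_le_of_levyProkhorovEDist_lt {R ε : ℝ} (hε : 0 < ε) {μ ν : ProbabilityMeasure ℝ}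
    (hμ : SupportedIn R μ) (hν : SupportedIn R ν)
    (h : levyProkhorovEDist (μ : Measure ℝ) ν < ENNReal.ofReal ε) :
    d1 μ ν ≤ ENNReal.ofReal (ε * (1 + 2 * R)) := by
  have hR := hμ.nonneg
  refine d1_le_ofReal fun φ hφ => ?_
  have hφ' : ∀ x y, |φ x - φ y| ≤ |x - y| := fun x y => by
    simpa [Real.dist_eq] using hφ.dist_le_mul x y
  set g : ℝ → ℝ := fun x => max 0 (min (φ x - φ 0 + R) (2 * R)) with hg
  have hgc : Continuous g := by
    have := hφ.continuous
    fun_prop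
  have hg0 : ∀ x, 0 ≤ g x := fun x => le_max_left _ _
  have hg1 : ∀ x, g x ≤ 2 * R := fun x => max_le (by linarith) (min_le_right _ _)
  have hgL : ∀ x y, g x ≤ g y + |x - y| := by
    intro x y
    have h1 := (abs_le.1 (hφ' x y)).2
    have h2 := abs_nonneg (x - y)
    simp only [hg]
    refine max_le (by positivity) ?_
    rcases le_total (φ y - φ 0 + R) (2 * R) with h3 | h3
    · rw [min_eq_left h3]
      have := le_max_right 0 (φ y - φ 0 + R)
      have := min_le_left (φ x - φ 0 + R) (2 * R)
      linarith
    · rw [min_eq_right h3]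
      have := le_max_right 0 (2 * R)
      have := min_le_right (φ x - φ 0 + R) (2 * R)
      linarith
  have hgeq : ∀ x ∈ Icc (-R) R, g x = φ x - φ 0 + R := by
    intro x hx
    have h1 := abs_le.1 (hφ' x 0)
    have h2 : |x - 0| ≤ R := by rw [sub_zero]; exact abs_le.2 hx
    simp only [hg]
    rw [min_eq_left (by linarith), max_eq_right (by linarith)]
  have hint : ∀ m : ProbabilityMeasure ℝ, SupportedIn R m →
      ∫ x, g x ∂(m : Measure ℝ) = ∫ x, φ x ∂(m : Measure ℝ) - φ 0 + R := by
    intro m hm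
    rw [integral_congr_ae (hm.ae_mem.mono hgeq), integral_add, integral_sub]
    · simp
    · exact hm.integrable hφ.continuous
    · exact integrable_const _
    · exact (hm.integrable hφ.continuous).sub (integrable_const _)
    · exact integrable_const _
  let G : BoundedContinuousFunction ℝ ℝ := BoundedContinuousFunction.ofNormedAddCommGroup g hgc
    (2 * R) (fun x => by rw [Real.norm_of_nonneg (hg0 x)]; exact hg1 x)
  have hGn : ‖G‖ ≤ 2 * R := BoundedContinuousFunction.norm_ofNormedAddCommGroup_le _ (by linarith) _
  have key := BoundedContinuousFunction.integral_le_of_levyProkhorovEDist_lt (μ : Measure ℝ)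
    (ν : Measure ℝ) hε h G (Eventually.of_forall hg0)
  have h2 : ∫ t in Ioc 0 ‖G‖, (ν : Measure ℝ).real (Metric.thickening ε {a | t ≤ G a})
      ≤ ∫ x, (g x + ε) ∂(ν : Measure ℝ) := by
    have hanti : Antitone fun t => (ν : Measure ℝ).real {a | t ≤ g a + ε} :=
      fun s t hst => measureReal_mono fun x (hx : t ≤ g x + ε) => hst.trans hx
    have hanti' : Antitone fun t => (ν : Measure ℝ).real (Metric.thickening ε {a | t ≤ G a}) :=
      fun s t hst => measureReal_mono
        (Metric.thickening_subset_of_subset ε fun x (hx : t ≤ G x) => hst.trans hx)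
    have hi : ∀ {B : ℝ → ℝ}, Antitone B → ∀ M : ℝ, IntegrableOn B (Ioc 0 M) := fun hB M =>
      (hB.locallyIntegrable.integrableOn_isCompact isCompact_Icc).mono_set Ioc_subset_Icc_self
    rw [Integrable.integral_eq_integral_Ioc_meas_le (f := fun x => g x + ε) (M := 2 * R + ε)
      ((hν.integrable hgc).add (integrable_const _))
      (Eventually.of_forall fun x => add_nonneg (hg0 x) hε.le)
      (Eventually.of_forall fun x => add_le_add_left (hg1 x) ε)]
    refine (setIntegral_mono (hi hanti' _) (hi hanti _) fun t => ?_).trans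
      (setIntegral_mono_set (hi hanti _) (Eventually.of_forall fun t => measureReal_nonneg)
        (Ioc_subset_Ioc_right (by linarith)).eventuallyLE)
    refine measureReal_mono fun x hx => ?_
    obtain ⟨y, hy, hxy⟩ := Metric.mem_thickening_iff.1 hx
    have h1 : t ≤ g y := hy
    have h2 := hgL y x
    rw [dist_comm, Real.dist_eq] at hxy
    show t ≤ g x + ε
    linarith
  have h3 : ∫ x, (g x + ε) ∂(ν : Measure ℝ) = ∫ x, g x ∂(ν : Measure ℝ) + ε := by
    rw [integral_add (hν.integrable hgc) (integrable_const _)]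
    simp
  have h4 : ∫ x, G x ∂(μ : Measure ℝ) = ∫ x, g x ∂(μ : Measure ℝ) := rfl
  rw [h4, hint μ hμ] at key
  rw [h3, hint ν hν] at h2
  have := mul_le_mul_of_nonneg_left hGn hε.le
  linarith

theorem tendsto_d1_of_tendsto {ι : Type*} {F : Filter ι} {R : ℝ} {μs : ι → ProbabilityMeasure ℝ}
    {μ : ProbabilityMeasure ℝ} (hs : ∀ᶠ i in F, SupportedIn R (μs i)) (hμ : SupportedIn R μ)
    (h : Tendsto μs F (𝓝 μ)) : Tendsto (fun i => d1 (μs i) μ) F (𝓝 0) := by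
  have h1 := (LevyProkhorov.continuous_ofMeasure_probabilityMeasure (Ω := ℝ)).continuousAt.tendsto.comp h
  rw [tendsto_iff_edist_tendsto_0] at h1
  have hR := hμ.nonneg
  rw [ENNReal.tendsto_nhds_zero]
  intro ε hε
  obtain ⟨η, hη, hηε⟩ := ENNReal.lt_iff_exists_real_btwn.1 hε
  have hη0 : 0 < η := by simpa using hηε.1
  have hpos : 0 < η / (1 + 2 * R) := by positivity
  filter_upwards [hs, h1.eventually (gt_mem_nhds (ENNReal.ofReal_pos.2 hpos))] with i hi hlt
  refine (d1_le_of_levyProkhorovEDist_lt hpos hi hμ hlt).trans ?_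
  rw [div_mul_cancel₀ _ (by positivity)]
  exact hηε.2.le

theorem tendsto_of_tendsto_d1 {ι : Type*} {F : Filter ι} [F.IsCountablyGenerated]
    {μs : ι → ProbabilityMeasure ℝ} {μ : ProbabilityMeasure ℝ}
    (h : Tendsto (fun i => d1 (μs i) μ) F (𝓝 0)) : Tendsto μs F (𝓝 μ) := by
  rw [tendsto_iff_forall_lipschitz_integral_tendsto]
  rintro f - ⟨L, hL⟩
  rw [Metric.tendsto_nhds]
  intro ε hε
  have hpos : 0 < ε / (L + 1) / 2 := by positivity
  filter_upwards [(ENNReal.tendsto_nhds_zero.1 h) (ENNReal.ofReal (ε / (L + 1) / 2)) (by simpa using hpos)]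
    with i hi
  -- Scaling by `L + 1` instead of `L` covers the case `L = 0`.
  have hlip : LipschitzWith 1 (fun x => (L + 1 : ℝ)⁻¹ * f x) := by
    refine LipschitzWith.of_dist_le_mul fun x y => ?_
    have := hL.dist_le_mul x y
    rw [Real.dist_eq, ← mul_sub, abs_mul, abs_of_nonneg (by positivity), NNReal.coe_one, one_mul,
      inv_mul_le_iff₀ (by positivity), ← Real.dist_eq]
    nlinarith [dist_nonneg (x := x) (y := y)]
  have := integral_sub_le_of_d1_le hpos.le hi hlip
  rw [integral_const_mul, integral_const_mul, ← mul_sub, abs_mul, abs_of_nonneg (by positivity),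
    inv_mul_le_iff₀ (by positivity)] at this
  rw [Real.dist_eq]
  refine this.trans_lt ?_
  field_simp
  linarith


/-! ### Empirical measures. -/

theorem integral_empMeasure {N : ℕ} (X : Fin N → ℝ) (φ : ℝ → ℝ) :
    ∫ x, φ x ∂(empMeasure X) = (N : ℝ)⁻¹ * ∑ i, φ (X i) := by
  rw [empMeasure, integral_smul_measure,
    integral_finsetSum_measure fun i _ => integrable_dirac (by simp)]
  simp

theorem d1_empMeasure_le {N : ℕ} {X Y : Fin N → ℝ} {δ : ℝ} (hδ : 0 ≤ δ)
    (h : ∀ i, |X i - Y i| ≤ δ) : d1 (empMeasure X) (empMeasure Y) ≤ ENNReal.ofReal δ := by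
  refine d1_le_ofReal fun φ hφ => ?_
  rw [integral_empMeasure, integral_empMeasure, ← mul_sub, ← Finset.sum_sub_distrib]
  rcases Nat.eq_zero_or_pos N with rfl | hN
  · simpa using hδ
  rw [inv_mul_le_iff₀ (by positivity)]
  calc ∑ i, (φ (X i) - φ (Y i)) ≤ ∑ _i : Fin N, δ := by
        refine Finset.sum_le_sum fun i _ => ?_
        have := hφ.dist_le_mul (X i) (Y i)
        rw [Real.dist_eq, Real.dist_eq, NNReal.coe_one, one_mul] at this
        exact (le_abs_self _).trans (this.trans (h i))
    _ = N * δ := by simp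

theorem supportedIn_emp {n : ℕ} {X : Fin (n + 1) → ℝ} {R : ℝ} (h : ∀ i, |X i| ≤ R) :
    SupportedIn R (emp X) := by
  have : ∀ i, X i ∉ (Icc (-R) R)ᶜ := fun i hi => hi (abs_le.1 (h i))
  show empMeasure X _ = 0
  simp only [empMeasure, Measure.smul_apply, Measure.finsetSum_apply, smul_eq_mul]
  rw [Finset.sum_eq_zero, mul_zero]
  intro i _
  rw [Measure.dirac_apply' _ measurableSet_Icc.compl, indicator_of_notMem (this i)]

theorem abs_cons_le {n : ℕ} {ξ R : ℝ} {X : Fin n → ℝ} (hξ : |ξ| ≤ R) (hX : ∀ j, |X j| ≤ R)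
    (i : Fin (n + 1)) : |(Fin.cons ξ X : Fin (n + 1) → ℝ) i| ≤ R := by
  refine Fin.cases ?_ (fun j => ?_) i
  · simpa using hξ
  · simpa using hX j

theorem emp_cons_removeNth {n : ℕ} (X : Fin (n + 1) → ℝ) (i : Fin (n + 1)) :
    emp (Fin.cons (X i) (i.removeNth X) : Fin (n + 1) → ℝ) = emp X := by
  apply Subtype.ext
  show empMeasure _ = empMeasure _
  simp only [empMeasure]
  congr 1
  rw [Fin.sum_univ_succ, Fin.sum_univ_succAbove _ i]
  simp [Fin.removeNth]

/-- The two averages of `φ` differ by `∑ (φ ξ - φ (X i)) / (n (n + 1))`. Mean-field limits are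
evaluated at the measure of all particles, equicontinuity is stated without particle `i`; this
estimate links the two. For `n = 0`, `empMeasure X` is the zero measure. -/
theorem d1_emp_cons_le {n : ℕ} (hn : n ≠ 0) {ξ R : ℝ} {X : Fin n → ℝ} (hξ : |ξ| ≤ R)
    (hX : ∀ j, |X j| ≤ R) :
    d1 (emp (Fin.cons ξ X : Fin (n + 1) → ℝ)) (empMeasure X)
      ≤ ENNReal.ofReal (2 * R / (n + 1)) := by
  have hn' : (0 : ℝ) < n := by exact_mod_cast Nat.pos_of_ne_zero hn
  refine d1_le_ofReal fun φ hφ => ?_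
  show ∫ x, φ x ∂(empMeasure _) - _ ≤ _
  rw [integral_empMeasure, integral_empMeasure, Fin.sum_univ_succ]
  simp only [Fin.cons_zero, Fin.cons_succ]
  push_cast
  have h1 : (n : ℝ) * φ ξ - ∑ i, φ (X i) ≤ n * (2 * R) := by
    calc (n : ℝ) * φ ξ - ∑ i, φ (X i) = ∑ i, (φ ξ - φ (X i)) := by simp
      _ ≤ ∑ _i : Fin n, 2 * R := by
        refine Finset.sum_le_sum fun i _ => ?_
        have := hφ.dist_le_mul ξ (X i)
        rw [Real.dist_eq, Real.dist_eq, NNReal.coe_one, one_mul] at this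
        refine (le_abs_self _).trans (this.trans ?_)
        exact (abs_sub _ _).trans (by linarith [hX i])
      _ = n * (2 * R) := by simp
  have h2 : ((n : ℝ) + 1)⁻¹ * (φ ξ + ∑ i, φ (X i)) - (n : ℝ)⁻¹ * ∑ i, φ (X i)
      = ((n : ℝ) * φ ξ - ∑ i, φ (X i)) / (n * (n + 1)) := by
    field_simp
    ring
  rw [h2, div_le_div_iff₀ (by positivity) (by positivity)]
  nlinarith

/-! ### Quantile functions and approximation by empirical measures. -/

/-- The quantile function of a measure carried by `[-R, R]`. -/
noncomputable def quantile (R : ℝ) (m : Measure ℝ) (u : ℝ) : ℝ :=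
  sInf {x | x ∈ Icc (-R) R ∧ u ≤ m.real (Iic x)}

namespace SupportedIn

variable {R : ℝ} {m : ProbabilityMeasure ℝ}

theorem real_Iic_eq_one (h : SupportedIn R m) {x : ℝ} (hx : R ≤ x) :
    (m : Measure ℝ).real (Iic x) = 1 := by
  rw [measureReal_def, (prob_compl_eq_zero_iff measurableSet_Iic).1, ENNReal.toReal_one]
  exact measure_mono_null (compl_subset_compl.2 fun y hy => hy.2.trans hx) h

theorem real_Iic_eq_zero (h : SupportedIn R m) {x : ℝ} (hx : x < -R) :
    (m : Measure ℝ).real (Iic x) = 0 := by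
  rw [measureReal_def, measure_mono_null (fun y hy hy' => ?_) h, ENNReal.toReal_zero]
  exact absurd (hy'.1.trans hy) (not_le.2 hx)

theorem quantile_set_nonempty (h : SupportedIn R m) {u : ℝ} (hu : u ≤ 1) :
    {x | x ∈ Icc (-R) R ∧ u ≤ (m : Measure ℝ).real (Iic x)}.Nonempty :=
  ⟨R, ⟨by linarith [h.nonneg], le_rfl⟩, by rwa [h.real_Iic_eq_one le_rfl]⟩

theorem quantile_set_bddBelow (R u : ℝ) (m : ProbabilityMeasure ℝ) :
    BddBelow {x | x ∈ Icc (-R) R ∧ u ≤ (m : Measure ℝ).real (Iic x)} :=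
  ⟨-R, fun _ hx => hx.1.1⟩

theorem quantile_mem (h : SupportedIn R m) {u : ℝ} (hu : u ≤ 1) :
    quantile R m u ∈ Icc (-R) R := by
  obtain ⟨x, hx⟩ := h.quantile_set_nonempty hu
  exact ⟨le_csInf ⟨x, hx⟩ fun y hy => hy.1.1,
    (csInf_le (quantile_set_bddBelow R u m) hx).trans hx.1.2⟩

theorem quantile_mono (h : SupportedIn R m) {u v : ℝ} (huv : u ≤ v) (hv : v ≤ 1) :
    quantile R m u ≤ quantile R m v :=
  csInf_le_csInf (quantile_set_bddBelow R u m) (h.quantile_set_nonempty hv)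
    fun _ hx => ⟨hx.1, huv.trans hx.2⟩

/-- Right continuity of the distribution function makes the infimum attained. Positivity of `u`
excludes `x < -R`, where the distribution function vanishes. -/
theorem quantile_le_iff (h : SupportedIn R m) {u x : ℝ} (hu0 : 0 < u) (hu : u ≤ 1) :
    quantile R m u ≤ x ↔ u ≤ (m : Measure ℝ).real (Iic x) := by
  constructor
  · intro hx
    have hrc : Tendsto (fun y => (m : Measure ℝ).real (Iic y)) (𝓝[>] quantile R m u)
        (𝓝 ((m : Measure ℝ).real (Iic (quantile R m u)))) := by
      have h1 := (ProbabilityTheory.cdf (m : Measure ℝ)).right_continuous (quantile R m u)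
      have h2 := (continuousWithinAt_Ioi_iff_Ici.2 h1).tendsto
      rwa [funext (ProbabilityTheory.cdf_eq_real (m : Measure ℝ))] at h2
    refine (ge_of_tendsto hrc ?_).trans (measureReal_mono (Iic_subset_Iic.2 hx))
    filter_upwards [self_mem_nhdsWithin] with y hy
    obtain ⟨z, hz, hzy⟩ := exists_lt_of_csInf_lt (h.quantile_set_nonempty hu) hy
    exact hz.2.trans (measureReal_mono (Iic_subset_Iic.2 hzy.le))
  · intro hx
    rcases le_total R x with h1 | h1
    · exact (h.quantile_mem hu).2.trans h1
    rcases lt_or_ge x (-R) with h2 | h2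
    · rw [h.real_Iic_eq_zero h2] at hx
      linarith
    · exact csInf_le (quantile_set_bddBelow R u m) ⟨⟨h2, h1⟩, hx⟩

theorem aemeasurable_quantile (h : SupportedIn R m) :
    AEMeasurable (quantile R m) (volume.restrict (Ioc 0 1)) :=
  aemeasurable_restrict_of_monotoneOn measurableSet_Ioc
    fun _ _ _ hv huv => h.quantile_mono huv hv.2

theorem map_quantile (h : SupportedIn R m) :
    (volume.restrict (Ioc (0 : ℝ) 1)).map (quantile R m) = m := by
  symm
  refine Measure.ext_of_Iic _ _ fun x => ?_
  rw [Measure.map_apply_of_aemeasurable h.aemeasurable_quantile measurableSet_Iic,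
    Measure.restrict_apply' measurableSet_Ioc]
  have : quantile R m ⁻¹' Iic x ∩ Ioc 0 1 = Ioc 0 ((m : Measure ℝ).real (Iic x)) := by
    ext u
    simp only [mem_inter_iff, mem_preimage, mem_Iic, mem_Ioc]
    constructor
    · rintro ⟨h1, h2, h3⟩
      exact ⟨h2, (h.quantile_le_iff h2 h3).1 h1⟩
    · rintro ⟨h1, h2⟩
      have h3 := h2.trans measureReal_le_one
      exact ⟨(h.quantile_le_iff h1 h3).2 h2, h1, h3⟩
  rw [this, Real.volume_Ioc, sub_zero, ofReal_measureReal]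

theorem integral_eq_quantile (h : SupportedIn R m) {φ : ℝ → ℝ} (hφ : Continuous φ) :
    ∫ x, φ x ∂(m : Measure ℝ) = ∫ u in (0 : ℝ)..1, φ (quantile R m u) := by
  conv_lhs => rw [← h.map_quantile]
  rw [integral_map h.aemeasurable_quantile hφ.aestronglyMeasurable,
    intervalIntegral.integral_of_le zero_le_one]

theorem intervalIntegrable_quantile (h : SupportedIn R m) {φ : ℝ → ℝ} (hφ : Continuous φ)
    {a b : ℝ} (ha : 0 ≤ a) (hab : a ≤ b) (hb : b ≤ 1) :
    IntervalIntegrable (fun u => φ (quantile R m u)) volume a b := by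
  have h1 : Integrable φ ((volume.restrict (Ioc (0 : ℝ) 1)).map (quantile R m)) := by
    rw [h.map_quantile]
    exact h.integrable hφ
  rw [intervalIntegrable_iff_integrableOn_Ioc_of_le hab]
  exact IntegrableOn.mono_set (h1.comp_aemeasurable h.aemeasurable_quantile)
    (Ioc_subset_Ioc ha hb)

/-- If the distribution functions of two measures agree up to a shift of the argument by at most
`D`, then their Kantorovich-Rubinstein distance is at most `D`. -/
theorem d1_le_of_Iic_le (h : SupportedIn R m) {m' : ProbabilityMeasure ℝ} (h' : SupportedIn R m')
    {D : ℝ}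
    (h1 : ∀ z, (m : Measure ℝ).real (Iic z) ≤ (m' : Measure ℝ).real (Iic (z + D)))
    (h2 : ∀ z, (m' : Measure ℝ).real (Iic z) ≤ (m : Measure ℝ).real (Iic (z + D))) :
    d1 m m' ≤ ENNReal.ofReal D := by
  refine d1_le_ofReal fun φ hφ => ?_
  rw [h.integral_eq_quantile hφ.continuous, h'.integral_eq_quantile hφ.continuous,
    ← intervalIntegral.integral_sub
      (h.intervalIntegrable_quantile hφ.continuous le_rfl zero_le_one le_rfl)
      (h'.intervalIntegrable_quantile hφ.continuous le_rfl zero_le_one le_rfl)]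
  have : ‖∫ u in (0 : ℝ)..1, (φ (quantile R m u) - φ (quantile R m' u))‖ ≤ D * |1 - 0| := by
    refine intervalIntegral.norm_integral_le_of_norm_le_const fun u hu => ?_
    rw [uIoc_of_le zero_le_one] at hu
    -- Read through `quantile_le_iff`, the two shift hypotheses say that the quantile functions
    -- differ by at most `D` at every `u`.
    have h3 := (h'.quantile_le_iff hu.1 hu.2).2
      (((h.quantile_le_iff hu.1 hu.2).1 le_rfl).trans (h1 _))
    have h4 := (h.quantile_le_iff hu.1 hu.2).2
      (((h'.quantile_le_iff hu.1 hu.2).1 le_rfl).trans (h2 _))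
    have h5 := hφ.dist_le_mul (quantile R m u) (quantile R m' u)
    rw [Real.dist_eq, Real.dist_eq, NNReal.coe_one, one_mul] at h5
    exact h5.trans (abs_le.2 ⟨by linarith, by linarith⟩)
  rw [sub_zero, abs_one, mul_one] at this
  exact (le_abs_self _).trans this

/-- The `j`-th atom replaces the quantiles on `(j / n, (j + 1) / n]`. By monotonicity the error on
this cell is at most the increment of the quantile function over `n`, and the increments telescope
to at most `2 R`. -/
theorem d1_empMeasure_quantile_le (h : SupportedIn R m) {n : ℕ} (hn : n ≠ 0) :
    d1 (empMeasure fun j : Fin n => quantile R m ((j + 1) / n)) m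
      ≤ ENNReal.ofReal (2 * R / n) := by
  have hn' : (0 : ℝ) < n := by exact_mod_cast Nat.pos_of_ne_zero hn
  refine d1_le_ofReal fun φ hφ => ?_
  have hle : ∀ j < n, ((j : ℝ) + 1) / n ≤ 1 := fun j hj => by
    rw [div_le_one hn']; exact_mod_cast hj
  have hint : ∀ j < n, IntervalIntegrable (fun u => φ (quantile R m u)) volume ((j : ℝ) / n)
      (((j + 1 : ℕ) : ℝ) / n) := fun j hj =>
    h.intervalIntegrable_quantile hφ.continuous (by positivity) (by gcongr; simp)
      (by push_cast; exact hle j hj)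
  have hsum := intervalIntegral.sum_integral_adjacent_intervals (a := fun j : ℕ => (j : ℝ) / n)
    (n := n) hint
  simp only [Nat.cast_zero, zero_div, div_self hn'.ne'] at hsum
  rw [integral_empMeasure, h.integral_eq_quantile hφ.continuous, ← hsum, Finset.mul_sum,
    Fin.sum_univ_eq_sum_range (fun j : ℕ => (n : ℝ)⁻¹ * φ (quantile R m ((j + 1) / n))),
    ← Finset.sum_sub_distrib]
  calc ∑ j ∈ Finset.range n, ((n : ℝ)⁻¹ * φ (quantile R m ((j + 1) / n))
        - ∫ u in ((j : ℝ) / n)..((j + 1 : ℕ) / n), φ (quantile R m u))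
      ≤ ∑ j ∈ Finset.range n, (n : ℝ)⁻¹ *
          (quantile R m (((j + 1 : ℕ) : ℝ) / n) - quantile R m ((j : ℝ) / n)) := by
        refine Finset.sum_le_sum fun j hj => ?_
        have hj' := Finset.mem_range.1 hj
        have hlen : ((j + 1 : ℕ) : ℝ) / n - (j : ℝ) / n = (n : ℝ)⁻¹ := by
          push_cast; field_simp; ring
        have hjj : (j : ℝ) / n ≤ ((j + 1 : ℕ) : ℝ) / n := by gcongr; simp
        have h1 : (n : ℝ)⁻¹ * φ (quantile R m ((j + 1) / n)) =
            ∫ _u in ((j : ℝ) / n)..((j + 1 : ℕ) / n), φ (quantile R m ((j + 1) / n)) := by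
          rw [intervalIntegral.integral_const, hlen, smul_eq_mul]
        rw [h1, ← intervalIntegral.integral_sub (by simp) (hint j hj')]
        have hbd : ‖∫ u in ((j : ℝ) / n)..((j + 1 : ℕ) / n),
            (φ (quantile R m ((j + 1) / n)) - φ (quantile R m u))‖ ≤
            (quantile R m (((j + 1 : ℕ) : ℝ) / n) - quantile R m ((j : ℝ) / n)) *
              |((j + 1 : ℕ) : ℝ) / n - (j : ℝ) / n| := by
          refine intervalIntegral.norm_integral_le_of_norm_le_const fun u hu => ?_
          rw [uIoc_of_le hjj] at hu
          have hl := hle j hj'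
          have hu2 := hu.2
          push_cast at hu2 ⊢
          have h3 := h.quantile_mono hu.1.le (hu2.trans hl)
          have h4 := h.quantile_mono hu2 hl
          have h5 := hφ.dist_le_mul (quantile R m ((j + 1) / n)) (quantile R m u)
          rw [Real.dist_eq, Real.dist_eq, NNReal.coe_one, one_mul] at h5
          exact h5.trans (abs_le.2 ⟨by linarith, by linarith⟩)
        rw [hlen, abs_of_pos (by positivity), mul_comm] at hbd
        exact (le_abs_self _).trans hbd
    _ = (n : ℝ)⁻¹ * (quantile R m ((n : ℝ) / n) - quantile R m ((0 : ℕ) / n)) := by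
        rw [← Finset.mul_sum, Finset.sum_range_sub (fun j : ℕ => quantile R m ((j : ℝ) / n))]
    _ ≤ 2 * R / n := by
        rw [div_self hn'.ne', div_eq_inv_mul (2 * R)]
        have h1 := (h.quantile_mem (le_refl 1)).2
        have h2 := (h.quantile_mem (u := (0 : ℕ) / n) (by simp)).1
        gcongr
        linarith

/-- Every measure carried by `[-R, R]` is a limit of empirical measures of points of `[-R, R]`. -/
theorem exists_tendsto_d1_empMeasure (h : SupportedIn R m) :
    ∃ Y : ∀ n, Fin n → ℝ, (∀ n j, |Y n j| ≤ R) ∧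
      Tendsto (fun n => d1 (empMeasure (Y n)) m) atTop (𝓝 0) := by
  refine ⟨fun n j => quantile R m ((j + 1) / n), fun n j => abs_le.2 (h.quantile_mem ?_), ?_⟩
  · rw [div_le_one (by exact_mod_cast j.pos)]
    exact_mod_cast j.2
  · have h1 : Tendsto (fun n : ℕ => ENNReal.ofReal (2 * R / n)) atTop (𝓝 0) := by
      rw [← ENNReal.ofReal_zero]
      exact ENNReal.tendsto_ofReal (tendsto_const_div_atTop_nhds_zero_nat _)
    refine tendsto_of_tendsto_of_tendsto_of_le_of_le' tendsto_const_nhds h1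
      (Eventually.of_forall fun _ => zero_le) ?_
    filter_upwards [eventually_ne_atTop 0] with n hn
    exact h.d1_empMeasure_quantile_le hn

end SupportedIn

theorem SupportedIn.d1_le {R : ℝ} {m m' : ProbabilityMeasure ℝ} (h : SupportedIn R m)
    (h' : SupportedIn R m') : d1 m m' ≤ ENNReal.ofReal (2 * R) := by
  refine h.d1_le_of_Iic_le h' (fun z => ?_) fun z => ?_
  all_goals
    rcases lt_or_ge z (-R) with hz | hz
    · first
      | rw [h.real_Iic_eq_zero hz]; exact measureReal_nonneg
      | rw [h'.real_Iic_eq_zero hz]; exact measureReal_nonneg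
    · first
      | rw [h'.real_Iic_eq_one (x := z + 2 * R) (by linarith)]; exact measureReal_le_one
      | rw [h.real_Iic_eq_one (x := z + 2 * R) (by linarith)]; exact measureReal_le_one

theorem d1_ne_top {R : ℝ} {m m' : ProbabilityMeasure ℝ} (h : SupportedIn R m)
    (h' : SupportedIn R m') : d1 m m' ≠ ⊤ :=
  ne_top_of_le_ne_top ENNReal.ofReal_ne_top (h.d1_le h')

/-! ### Properties inherited by mean-field limits. -/

theorem tendsto_emp_cons {R : ℝ} {m : ProbabilityMeasure ℝ} {Y : ∀ n, Fin n → ℝ}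
    (hY : ∀ n j, |Y n j| ≤ R) (hYm : Tendsto (fun n => d1 (empMeasure (Y n)) m) atTop (𝓝 0))
    (ξ : ℝ) : Tendsto (fun n => emp (Fin.cons ξ (Y n) : Fin (n + 1) → ℝ)) atTop (𝓝 m) := by
  apply tendsto_of_tendsto_d1
  have h1 : Tendsto (fun n : ℕ => ENNReal.ofReal (2 * (|R| + |ξ|) / (n + 1))
      + d1 (empMeasure (Y n)) m) atTop (𝓝 0) := by
    have : Tendsto (fun n : ℕ => ENNReal.ofReal (2 * (|R| + |ξ|) / (n + 1))) atTop (𝓝 0) := by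
      rw [← ENNReal.ofReal_zero]
      refine ENNReal.tendsto_ofReal ?_
      have := (tendsto_const_div_atTop_nhds_zero_nat (2 * (|R| + |ξ|))).comp (tendsto_add_atTop_nat 1)
      simpa [Function.comp_def] using this
    simpa using this.add hYm
  refine tendsto_of_tendsto_of_tendsto_of_le_of_le' tendsto_const_nhds h1
    (Eventually.of_forall fun _ => zero_le) ?_
  filter_upwards [eventually_ne_atTop 0] with n hn
  refine (d1_triangle _ (empMeasure (Y n)) _).trans (add_le_add_left (d1_emp_cons_le hn ?_ ?_) _)
  · linarith [abs_nonneg R]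
  · intro j
    linarith [hY n j, le_abs_self R, abs_nonneg ξ]

/-- Heine-Cantor: a violating sequence would have a subsequence along which `(x, m)` and `(x, m')`
converge to the same point of the compact set. -/
theorem uniform_continuousOn_d1 {R : ℝ} {g : ℝ → ProbabilityMeasure ℝ → ℝ}
    (hg : ContinuousOn (fun q : ℝ × ProbabilityMeasure ℝ => g q.1 q.2) {q | SupportedIn R q.2})
    {ε : ℝ} (hε : 0 < ε) : ∃ δ > 0, ∀ (x : ℝ) (m m' : ProbabilityMeasure ℝ), |x| ≤ R →
      SupportedIn R m → SupportedIn R m' → d1 m m' ≤ ENNReal.ofReal δ → |g x m - g x m'| ≤ ε := by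
  by_contra! hcon
  choose x m m' hx hm hm' hd hlt using fun k : ℕ => hcon (1 / ((k : ℝ) + 1)) (by positivity)
  obtain ⟨⟨x₀, m₀⟩, hq, φ, hφ, hlim⟩ := (isCompact_Icc.prod (isCompact_supportedIn R)).tendsto_subseq
    (x := fun k => (x k, m k)) (fun k => ⟨abs_le.1 (hx k), hm k⟩)
  have hx₀ : Tendsto (fun k => x (φ k)) atTop (𝓝 x₀) := (continuous_fst.tendsto _).comp hlim
  have hm₀ : Tendsto (fun k => m (φ k)) atTop (𝓝 m₀) := (continuous_snd.tendsto _).comp hlim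
  have hm₀' : Tendsto (fun k => m' (φ k)) atTop (𝓝 m₀) := by
    apply tendsto_of_tendsto_d1
    have h1 := tendsto_d1_of_tendsto (Eventually.of_forall fun k => hm (φ k)) hq.2 hm₀
    have h2 : Tendsto (fun k => d1 (m' (φ k)) (m (φ k))) atTop (𝓝 0) := by
      have h3 : Tendsto (fun k => ENNReal.ofReal (1 / (((φ k : ℕ) : ℝ) + 1))) atTop (𝓝 0) := by
        rw [← ENNReal.ofReal_zero]
        exact (ENNReal.tendsto_ofReal tendsto_one_div_add_atTop_nhds_zero_nat).comp hφ.tendsto_atTop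
      refine tendsto_of_tendsto_of_tendsto_of_le_of_le tendsto_const_nhds h3 (fun _ => zero_le)
        fun k => ?_
      show d1 _ _ ≤ _
      rw [d1_comm]
      exact hd (φ k)
    have h4 := h2.add h1
    rw [add_zero] at h4
    exact tendsto_of_tendsto_of_tendsto_of_le_of_le tendsto_const_nhds h4 (fun _ => zero_le)
      fun k => d1_triangle _ _ _
  have hc := hg (x₀, m₀) hq.2
  have h1 := hc.tendsto.comp (tendsto_nhdsWithin_iff.2 ⟨hx₀.prodMk_nhds hm₀,
    Eventually.of_forall fun k => hm (φ k)⟩)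
  have h2 := hc.tendsto.comp (tendsto_nhdsWithin_iff.2 ⟨hx₀.prodMk_nhds hm₀',
    Eventually.of_forall fun k => hm' (φ k)⟩)
  have h3 := (h1.sub h2).abs
  rw [sub_self, abs_zero] at h3
  obtain ⟨k, hk⟩ := (h3.eventually (gt_mem_nhds hε)).exists
  exact absurd hk (not_lt.2 (hlt (φ k)).le)

namespace IsMeanFieldLimit

variable {g : ∀ n : ℕ, ℝ → (Fin n → ℝ) → ℝ} {gbar : ℝ → ProbabilityMeasure ℝ → ℝ}

theorem tendsto_of_tendsto_d1 (hg : IsMeanFieldLimit g gbar) {R : ℝ} {m : ProbabilityMeasure ℝ}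
    (hm : SupportedIn R m) {Y : ∀ n, Fin n → ℝ} (hY : ∀ n j, |Y n j| ≤ R)
    (hYm : Tendsto (fun n => d1 (empMeasure (Y n)) m) atTop (𝓝 0)) (ξ : ℝ) :
    Tendsto (fun n => g n ξ (Y n)) atTop (𝓝 (gbar ξ m)) := by
  have hR := hm.nonneg
  have hR' : 0 < R + |ξ| + 1 := by positivity
  have hY' : ∀ n j, |Y n j| ≤ R + |ξ| + 1 := fun n j => by linarith [hY n j, abs_nonneg ξ]
  have hξ : |ξ| ≤ R + |ξ| + 1 := by linarith
  have h1 : Tendsto (fun n => gbar ξ (emp (Fin.cons ξ (Y n) : Fin (n + 1) → ℝ))) atTop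
      (𝓝 (gbar ξ m)) :=
    (hg.continuousOn _ hR' (ξ, m) (hm.mono (by linarith [abs_nonneg ξ]))).tendsto.comp
      (tendsto_nhdsWithin_iff.2 ⟨tendsto_const_nhds.prodMk_nhds (tendsto_emp_cons hY hYm ξ),
        Eventually.of_forall fun n => supportedIn_emp (abs_cons_le hξ (hY' n))⟩)
  have h2 : Tendsto (fun n => g n ξ (Y n) - gbar ξ (emp (Fin.cons ξ (Y n) : Fin (n + 1) → ℝ)))
      atTop (𝓝 0) := by
    rw [Metric.tendsto_nhds]
    intro ε hε
    filter_upwards [hg.tendsto _ hR' (ε / 2) (half_pos hε)] with n hn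
    rw [Real.dist_eq, sub_zero]
    linarith [hn ξ (Y n) hξ (hY' n)]
  simpa using h2.add h1

/-- Both measures are limits of empirical measures on `[-R, R]`, along which the bound for `g n`
passes to the limit. -/
theorem exists_lipschitz (hg : IsMeanFieldLimit g gbar) (hL : LocallyEquiLipschitz g) {R : ℝ}
    (hR : 0 < R) : ∃ L ≥ 0, ∀ (x x' : ℝ) (m m' : ProbabilityMeasure ℝ), |x| ≤ R → |x'| ≤ R →
      SupportedIn R m → SupportedIn R m' →
      |gbar x m - gbar x' m'| ≤ L * (|x - x'| + (d1 m m').toReal) := by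
  obtain ⟨L, hL⟩ := hL R hR
  refine ⟨|L|, abs_nonneg L, fun x x' m m' hx hx' hm hm' => ?_⟩
  obtain ⟨Y, hY, hYm⟩ := hm.exists_tendsto_d1_empMeasure
  obtain ⟨Y', hY', hYm'⟩ := hm'.exists_tendsto_d1_empMeasure
  have h1 := ((hg.tendsto_of_tendsto_d1 hm hY hYm x).sub
    (hg.tendsto_of_tendsto_d1 hm' hY' hYm' x')).abs
  have hne := d1_ne_top hm hm'
  have h2 : Tendsto (fun n => |L| * (|x - x'| + (d1 (empMeasure (Y n)) m + d1 m m'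
      + d1 (empMeasure (Y' n)) m').toReal)) atTop
      (𝓝 (|L| * (|x - x'| + (0 + d1 m m' + 0).toReal))) := by
    refine Tendsto.const_mul _ (tendsto_const_nhds.add ?_)
    refine (ENNReal.tendsto_toReal (by simpa using hne)).comp ?_
    exact (hYm.add tendsto_const_nhds).add hYm'
  rw [zero_add, add_zero] at h2
  refine le_of_tendsto_of_tendsto h1 h2 ?_
  -- Finiteness of the distances is needed for monotonicity of `toReal`.
  filter_upwards [hYm.eventually (gt_mem_nhds ENNReal.zero_lt_top),
    hYm'.eventually (gt_mem_nhds ENNReal.zero_lt_top)] with n h3 h4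
  refine (hL n x x' (Y n) (Y' n) hx hx' (hY n) (hY' n)).trans ?_
  have h5 : (d1 (empMeasure (Y n)) (empMeasure (Y' n))).toReal ≤ (d1 (empMeasure (Y n)) m
      + d1 m m' + d1 (empMeasure (Y' n)) m').toReal := by
    refine ENNReal.toReal_mono (by simp [hne, h3.ne, h4.ne]) ?_
    rw [d1_comm (empMeasure (Y' n))]
    exact (d1_triangle _ m' _).trans (add_le_add_left (d1_triangle _ m _) _)
  exact mul_le_mul (le_abs_self L) (by linarith) (by positivity) (abs_nonneg L)

end IsMeanFieldLimit

/-! ### The mean-field limit of `∂_ξ h`. -/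

section Derivative

variable {h : ∀ n : ℕ, ℝ → (Fin n → ℝ) → ℝ} {hbar : ℝ → ProbabilityMeasure ℝ → ℝ}

/-- By the mean value inequality, the linearization error is at most `|s|` times the oscillation of
`∂_ξ h` between `ξ` and `ξ + s`, which the common modulus controls for all `n` at once. -/
theorem LocallyEquicontinuous.exists_abs_slope_sub_deriv_le
    (hd : ∀ n X, Differentiable ℝ fun s => h n s X)
    (heq : LocallyEquicontinuous fun n ξ X => deriv (fun s => h n s X) ξ)
    {R ε : ℝ} (hR : 0 < R) (hε : 0 < ε) :
    ∃ δ > 0, δ ≤ 1 ∧ ∀ (n : ℕ) (ξ s : ℝ) (X : Fin n → ℝ), |ξ| ≤ R → (∀ j, |X j| ≤ R) → |s| ≤ δ →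
      |h n (ξ + s) X - h n ξ X - s * deriv (fun s => h n s X) ξ| ≤ ε * |s| := by
  obtain ⟨δ, hδ, H⟩ := heq (R + 1) (by positivity) ε hε
  refine ⟨min δ 1, by positivity, min_le_right _ _, fun n ξ s X hξ hX hs => ?_⟩
  set c := deriv (fun s => h n s X) ξ with hc
  have hder : ∀ y ∈ uIcc ξ (ξ + s), HasDerivWithinAt (fun y => h n y X - y * c)
      (deriv (fun s => h n s X) y - 1 * c) (uIcc ξ (ξ + s)) y := fun y _ =>
    ((hd n X y).hasDerivAt.sub ((hasDerivAt_id y).mul_const c)).hasDerivWithinAt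
  have hbd : ∀ y ∈ uIcc ξ (ξ + s), ‖deriv (fun s => h n s X) y - 1 * c‖ ≤ ε := by
    intro y hy
    have h1 : |y - ξ| ≤ |s| := by
      have := abs_sub_left_of_mem_uIcc hy
      simpa using this
    have h2 : |y - ξ| ≤ 1 := h1.trans (hs.trans (min_le_right _ _))
    have h3 : |y| ≤ R + 1 := by
      have := abs_add_le (y - ξ) ξ
      rw [sub_add_cancel] at this
      linarith
    rw [one_mul]
    refine H n y ξ X X h3 (by linarith) (fun j => by linarith [hX j])
      (fun j => by linarith [hX j]) (h1.trans (hs.trans (min_le_left _ _))) ?_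
    rw [d1_self]
    exact zero_le
  have := (convex_uIcc ξ (ξ + s)).norm_image_sub_le_of_norm_hasDerivWithin_le hder hbd
    left_mem_uIcc right_mem_uIcc
  rw [add_sub_cancel_left] at this
  refine le_trans (le_of_eq ?_) this
  rw [Real.norm_eq_abs]
  congr 1
  ring

/-- Along empirical measures tending to `m`, the values of `h` converge and its difference quotients
are uniformly close to its derivatives. The derivatives thus form a Cauchy sequence, whose limit is
the derivative of `hbar`. The second claim lets every linearization bound common to all `n` hold for
`hbar` with the same `ε` and `δ`. -/
theorem IsMeanFieldLimit.exists_abs_slope_sub_deriv_le (hh : IsMeanFieldLimit h hbar)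
    (hd : ∀ n X, Differentiable ℝ fun s => h n s X)
    (heq : LocallyEquicontinuous fun n ξ X => deriv (fun s => h n s X) ξ)
    {R : ℝ} {m : ProbabilityMeasure ℝ} (hm : SupportedIn R m) {x : ℝ} (hx : |x| ≤ R) :
    DifferentiableAt ℝ (fun y => hbar y m) x ∧
    ∀ ε δ : ℝ, (∀ (n : ℕ) (s : ℝ) (X : Fin n → ℝ), (∀ j, |X j| ≤ R) → |s| ≤ δ →
      |h n (x + s) X - h n x X - s * deriv (fun s => h n s X) x| ≤ ε * |s|) →
      ∀ s, |s| ≤ δ → |hbar (x + s) m - hbar x m - s * deriv (fun y => hbar y m) x| ≤ ε * |s| := by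
  obtain ⟨Y, hY, hYm⟩ := hm.exists_tendsto_d1_empMeasure
  set D : ℕ → ℝ := fun n => deriv (fun s => h n s (Y n)) x with hD
  have hlim : ∀ ξ, Tendsto (fun n => h n ξ (Y n)) atTop (𝓝 (hbar ξ m)) :=
    hh.tendsto_of_tendsto_d1 hm hY hYm
  have hcauchy : CauchySeq D := by
    rw [Metric.cauchySeq_iff']
    intro ε hε
    obtain ⟨δ, hδ, -, H⟩ := heq.exists_abs_slope_sub_deriv_le hd (R := R + 1)
      (by linarith [hm.nonneg]) (ε := ε / 8) (by positivity)
    have h1 := ((hlim (x + δ)).sub (hlim x))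
    obtain ⟨N, hN⟩ := eventually_atTop.1 (Metric.tendsto_nhds.1 h1 (ε / 8 * δ) (by positivity))
    -- One `ε / 8` comes from linearizing `h n`, the other from replacing `h n` by `hbar`.
    have key : ∀ n ≥ N, |hbar (x + δ) m - hbar x m - δ * D n| ≤ ε / 4 * δ := by
      intro n hn
      have h2 := H n x δ (Y n) (by linarith) (fun j => by linarith [hY n j])
        (abs_of_pos hδ).le
      have h3 := (hN n hn).le
      rw [dist_comm, Real.dist_eq] at h3
      rw [abs_of_pos hδ] at h2
      have h4 := abs_add_le (hbar (x + δ) m - hbar x m - (h n (x + δ) (Y n) - h n x (Y n)))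
        (h n (x + δ) (Y n) - h n x (Y n) - δ * D n)
      rw [sub_add_sub_cancel] at h4
      linarith
    refine ⟨N, fun n hn => ?_⟩
    have h5 := abs_sub (hbar (x + δ) m - hbar x m - δ * D N) (hbar (x + δ) m - hbar x m - δ * D n)
    have h6 : hbar (x + δ) m - hbar x m - δ * D N - (hbar (x + δ) m - hbar x m - δ * D n)
      = δ * (D n - D N) := by ring
    rw [h6, abs_mul, abs_of_pos hδ] at h5
    have h7 : δ * |D n - D N| ≤ δ * (ε / 2) := by linarith [key n hn, key N le_rfl]
    rw [Real.dist_eq]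
    linarith [le_of_mul_le_mul_left h7 hδ]
  obtain ⟨d, hd'⟩ := cauchySeq_tendsto_of_complete hcauchy
  have hbound : ∀ ε δ : ℝ, (∀ (n : ℕ) (s : ℝ) (X : Fin n → ℝ), (∀ j, |X j| ≤ R) → |s| ≤ δ →
      |h n (x + s) X - h n x X - s * deriv (fun s => h n s X) x| ≤ ε * |s|) →
      ∀ s, |s| ≤ δ → |hbar (x + s) m - hbar x m - s * d| ≤ ε * |s| := by
    intro ε δ H s hs
    refine le_of_tendsto (((hlim (x + s)).sub (hlim x)).sub (hd'.const_mul s)).abs ?_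
    exact Eventually.of_forall fun n => H n s (Y n) (hY n) hs
  have hder : HasDerivAt (fun y => hbar y m) d x := by
    rw [hasDerivAt_iff_isLittleO_nhds_zero, Asymptotics.isLittleO_iff]
    intro ε hε
    obtain ⟨δ, hδ, -, H⟩ := heq.exists_abs_slope_sub_deriv_le hd (R := R + 1)
      (by linarith [hm.nonneg]) hε
    filter_upwards [Metric.closedBall_mem_nhds (0 : ℝ) hδ] with s hs
    rw [Metric.mem_closedBall, Real.dist_eq, sub_zero] at hs
    exact hbound ε δ (fun n s X hX hs => H n x s X (by linarith) (fun j => by linarith [hX j]) hs)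
      s hs
  exact ⟨hder.differentiableAt, by rw [hder.deriv]; exact hbound⟩

theorem IsMeanFieldLimit.differentiable (hh : IsMeanFieldLimit h hbar)
    (hd : ∀ n X, Differentiable ℝ fun s => h n s X)
    (heq : LocallyEquicontinuous fun n ξ X => deriv (fun s => h n s X) ξ)
    {R : ℝ} {m : ProbabilityMeasure ℝ} (hm : SupportedIn R m) :
    Differentiable ℝ fun y => hbar y m := fun x =>
  (hh.exists_abs_slope_sub_deriv_le hd heq (hm.mono (le_max_left R |x|)) (le_max_right R |x|)).1

/-- The partial derivatives `∂_ξ h` have the mean-field limit `∂_x hbar`. -/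
theorem isMeanFieldLimit_deriv (hh : IsMeanFieldLimit h hbar)
    (hd : ∀ n X, Differentiable ℝ fun s => h n s X)
    (heq : LocallyEquicontinuous fun n ξ X => deriv (fun s => h n s X) ξ) :
    IsMeanFieldLimit (fun n ξ X => deriv (fun s => h n s X) ξ)
      (fun x m => deriv (fun y => hbar y m) x) := by
  -- A single step `δ` serves all `h n` and `hbar`; continuity and convergence of the derivatives
  -- reduce to those of quotients with `δ` fixed.
  have hslope : ∀ R > 0, ∀ ε > 0, ∃ δ > 0, δ ≤ 1 ∧
      (∀ (n : ℕ) (ξ : ℝ) (X : Fin n → ℝ), |ξ| ≤ R → (∀ j, |X j| ≤ R) →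
        |δ⁻¹ * (h n (ξ + δ) X - h n ξ X) - deriv (fun s => h n s X) ξ| ≤ ε) ∧
      ∀ (x : ℝ) (m : ProbabilityMeasure ℝ), |x| ≤ R → SupportedIn R m →
        |δ⁻¹ * (hbar (x + δ) m - hbar x m) - deriv (fun y => hbar y m) x| ≤ ε := by
    intro R hR ε hε
    obtain ⟨δ, hδ, hδ1, H⟩ := heq.exists_abs_slope_sub_deriv_le hd hR hε
    have aux : ∀ a d : ℝ, |a - δ * d| ≤ ε * |δ| → |δ⁻¹ * a - d| ≤ ε := by
      intro a d had
      have : δ⁻¹ * a - d = δ⁻¹ * (a - δ * d) := by field_simp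
      rw [this, abs_mul, abs_inv, inv_mul_le_iff₀ (by positivity), mul_comm |δ| ε]
      exact had
    refine ⟨δ, hδ, hδ1, fun n ξ X hξ hX => aux _ _ (H n ξ δ X hξ hX (abs_of_pos hδ).le),
      fun x m hx hm => aux _ _ ?_⟩
    exact (hh.exists_abs_slope_sub_deriv_le hd heq hm hx).2 ε δ
      (fun n s X hX hs => H n x s X hx hX hs) δ (abs_of_pos hδ).le
  constructor
  · intro R hR
    refine continuousOn_of_locally_uniform_approx_of_continuousWithinAt ?_
    rintro ⟨x, m⟩ hm u hu
    obtain ⟨ε, hε, hεu⟩ := Metric.mem_uniformity_dist.1 hu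
    obtain ⟨δ, hδ, -, -, H⟩ := hslope (R + |x| + 1) (by positivity) (ε / 2) (by positivity)
    refine ⟨{q | SupportedIn R q.2 ∧ |q.1 - x| < 1}, inter_mem self_mem_nhdsWithin
      (mem_nhdsWithin_of_mem_nhds ?_),
      fun q => δ⁻¹ * (hbar (q.1 + δ) q.2 - hbar q.1 q.2), ?_, ?_⟩
    · have : ContinuousAt (fun q : ℝ × ProbabilityMeasure ℝ => |q.1 - x|) (x, m) := by fun_prop
      exact this.eventually (gt_mem_nhds (by simp))
    · have h1 : ContinuousOn (fun q : ℝ × ProbabilityMeasure ℝ => hbar (q.1 + δ) q.2)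
          {q | SupportedIn R q.2} :=
        (hh.continuousOn R hR).comp (f := fun q : ℝ × ProbabilityMeasure ℝ => (q.1 + δ, q.2))
          (by fun_prop) fun q hq => hq
      exact (continuousOn_const.mul (h1.sub (hh.continuousOn R hR))) (x, m) hm
    · rintro ⟨y, m'⟩ ⟨hm', hy⟩
      apply hεu
      have hy' : |y| ≤ R + |x| + 1 := by
        have := abs_add_le (y - x) x
        rw [sub_add_cancel] at this
        simp only at hy
        linarith
      rw [dist_comm, Real.dist_eq]
      linarith [H y m' hy' (hm'.mono (by linarith [abs_nonneg x]))]
  · intro R hR ε hε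
    obtain ⟨δ, hδ, hδ1, H1, H2⟩ := hslope R hR (ε / 8) (by positivity)
    have hR1 : 0 < R + 1 := by positivity
    -- The tolerance carries a factor `δ` because the errors are divided by `δ` in the quotient.
    obtain ⟨η, hη, Hη⟩ := uniform_continuousOn_d1 (hh.continuousOn (R + 1) hR1)
      (ε := ε / 8 * δ) (by positivity)
    have hev : ∀ᶠ n : ℕ in atTop, 2 * (R + 1) / ((n : ℝ) + 1) ≤ η / 2 := by
      have h0 := (tendsto_const_div_atTop_nhds_zero_nat (2 * (R + 1))).comp
        (tendsto_add_atTop_nat 1)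
      filter_upwards [h0.eventually (gt_mem_nhds (half_pos hη))] with n hn
      simpa using hn.le
    filter_upwards [hev, eventually_ne_atTop 0,
      hh.tendsto (R + 1) hR1 (ε / 8 * δ) (by positivity)] with n hn hn0 Hn ξ X hξ hX
    have hX1 : ∀ j, |X j| ≤ R + 1 := fun j => by linarith [hX j]
    have hξ1 : |ξ| ≤ R + 1 := by linarith
    have hξδ : |ξ + δ| ≤ R + 1 := (abs_add_le _ _).trans (by rw [abs_of_pos hδ]; linarith)
    set E := emp (Fin.cons ξ X : Fin (n + 1) → ℝ) with hE
    set E' := emp (Fin.cons (ξ + δ) X : Fin (n + 1) → ℝ) with hE'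
    -- Moving `ξ` to `ξ + δ` also moves the full empirical measure from `E` to `E'`, whereas `∂_x
    -- hbar` keeps the measure fixed. The discrepancy is `O(1 / n)`.
    have hdist : d1 E' E ≤ ENNReal.ofReal η := by
      refine (d1_triangle _ (empMeasure X) _).trans ?_
      have h1 := d1_emp_cons_le hn0 hξδ hX1
      have h2 := d1_emp_cons_le hn0 hξ1 hX1
      rw [d1_comm (empMeasure X)]
      refine (add_le_add h1 h2).trans ?_
      rw [← ENNReal.ofReal_add (by positivity) (by positivity)]
      exact ENNReal.ofReal_le_ofReal (by linarith)
    have a1 := abs_le.1 (H1 n ξ X hξ hX)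
    have a2 := abs_le.1 (H2 ξ E hξ (supportedIn_emp (abs_cons_le hξ hX)))
    have a3 := abs_le.1 (Hn ξ X hξ1 hX1)
    have a4 := abs_le.1 (Hn (ξ + δ) X hξδ hX1)
    have a5 := abs_le.1 (Hη (ξ + δ) E' E hξδ (supportedIn_emp (abs_cons_le hξδ hX1))
      (supportedIn_emp (abs_cons_le hξ1 hX1)) hdist)
    rw [← hE] at a3
    rw [← hE'] at a4
    have a6 : |δ⁻¹ * (h n (ξ + δ) X - h n ξ X) - δ⁻¹ * (hbar (ξ + δ) E - hbar ξ E)|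
        ≤ 3 * (ε / 8) := by
      rw [← mul_sub, abs_mul, abs_inv, abs_of_pos hδ, inv_mul_le_iff₀ hδ]
      refine abs_le.2 ⟨?_, ?_⟩ <;> linarith
    have a7 := abs_le.1 a6
    refine abs_le.2 ⟨?_, ?_⟩ <;> linarith

end Derivative

/-! ### Integrals against a varying measure. -/

/-- Composing `φ` with the projection onto `[-R, R]` makes it bounded without changing the
integrals. -/
theorem continuousOn_integral_of_supportedIn {R : ℝ} {φ : ℝ → ℝ} (hφ : Continuous φ) :
    ContinuousOn (fun m : ProbabilityMeasure ℝ => ∫ x, φ x ∂(m : Measure ℝ))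
      {m | SupportedIn R m} := by
  intro m₀ hm₀
  have hR : -R ≤ R := by linarith [SupportedIn.nonneg hm₀]
  set c : ℝ → ℝ := fun x => projIcc (-R) R hR x with hc
  have hcc : Continuous fun x => φ (c x) := hφ.comp (continuous_subtype_val.comp continuous_projIcc)
  have heq : ∀ m : ProbabilityMeasure ℝ, SupportedIn R m →
      ∫ x, φ x ∂(m : Measure ℝ) = ∫ x, φ (c x) ∂(m : Measure ℝ) := fun m hm =>
    integral_congr_ae (hm.ae_mem.mono fun x hx => by simp only [hc, projIcc_of_mem hR hx])
  obtain ⟨C, hC⟩ := isCompact_Icc.exists_bound_of_continuousOn (hφ.continuousOn (s := Icc (-R) R))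
  let G : BoundedContinuousFunction ℝ ℝ := BoundedContinuousFunction.ofNormedAddCommGroup
    (fun x => φ (c x)) hcc C (fun x => hC _ (projIcc (-R) R hR x).2)
  have h1 : Tendsto (fun m : ProbabilityMeasure ℝ => ∫ x, G x ∂(m : Measure ℝ))
      (𝓝[{m | SupportedIn R m}] m₀) (𝓝 (∫ x, G x ∂(m₀ : Measure ℝ))) :=
    (ProbabilityMeasure.tendsto_iff_forall_integral_tendsto.1 tendsto_id G).mono_left
      nhdsWithin_le_nhds
  show Tendsto _ _ (𝓝 (∫ x, φ x ∂(m₀ : Measure ℝ)))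
  rw [heq m₀ hm₀]
  refine h1.congr' ?_
  filter_upwards [self_mem_nhdsWithin] with m hm
  exact (heq m hm).symm

theorem continuous_of_continuousOn_supportedIn {R : ℝ} {g : ℝ → ProbabilityMeasure ℝ → ℝ}
    (hg : ContinuousOn (fun q : ℝ × ProbabilityMeasure ℝ => g q.1 q.2) {q | SupportedIn R q.2})
    {m : ProbabilityMeasure ℝ} (hm : SupportedIn R m) : Continuous fun x => g x m := by
  rw [← continuousOn_univ]
  exact hg.comp (f := fun x : ℝ => (x, m)) (by fun_prop) fun x _ => hm

/-- For `g` continuous, `m ↦ ∫ θ g(·, m) dm` is continuous on the measures with support in a fixed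
compact set. -/
theorem continuousOn_integral_mul {R : ℝ} {g : ℝ → ProbabilityMeasure ℝ → ℝ}
    (hg : ContinuousOn (fun q : ℝ × ProbabilityMeasure ℝ => g q.1 q.2) {q | SupportedIn R q.2})
    {θ : ℝ → ℝ} (hθ : Continuous θ) :
    ContinuousOn (fun m : ProbabilityMeasure ℝ => ∫ x, θ x * g x m ∂(m : Measure ℝ))
      {m | SupportedIn R m} := by
  intro m₀ hm₀
  have hint : ∀ m m' : ProbabilityMeasure ℝ, SupportedIn R m → SupportedIn R m' →
      Integrable (fun x => θ x * g x m') (m : Measure ℝ) := fun m m' hm hm' =>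
    hm.integrable (hθ.mul (continuous_of_continuousOn_supportedIn hg hm'))
  have h1 := continuousOn_integral_of_supportedIn (R := R) (φ := fun x => θ x * g x m₀)
    (hθ.mul (continuous_of_continuousOn_supportedIn hg hm₀)) m₀ hm₀
  have h2 : Tendsto (fun m : ProbabilityMeasure ℝ => ∫ x, θ x * g x m ∂(m : Measure ℝ)
      - ∫ x, θ x * g x m₀ ∂(m : Measure ℝ)) (𝓝[{m | SupportedIn R m}] m₀) (𝓝 0) := by
    rw [Metric.tendsto_nhds]
    intro ε hε
    -- By compactness of `[-R, R]`, the integrands for `m` near `m₀` are uniformly close to the one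
    -- for `m₀`, which may then be frozen.
    obtain ⟨v, hv, H⟩ := (isCompact_Icc (a := -R) (b := R)).mem_uniformity_of_prod
      (f := fun (m : ProbabilityMeasure ℝ) x => θ x * g x m) (s := {m | SupportedIn R m}) (q := m₀)
      (u := {p | dist p.1 p.2 < ε / 2}) (by
        refine (hθ.comp continuous_snd).continuousOn.mul ?_
        exact hg.comp (f := fun p : ProbabilityMeasure ℝ × ℝ => (p.2, p.1)) (by fun_prop)
          fun p hp => hp.1) hm₀ (Metric.dist_mem_uniformity (half_pos hε))
    filter_upwards [hv, self_mem_nhdsWithin] with m hmv hm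
    rw [Real.dist_eq, sub_zero, ← integral_sub (hint m m hm hm) (hint m m₀ hm hm₀)]
    refine lt_of_le_of_lt ?_ (half_lt_self hε)
    have := norm_integral_le_of_norm_le_const (μ := (m : Measure ℝ))
      (f := fun x => θ x * g x m - θ x * g x m₀) (C := ε / 2)
      (hm.ae_mem.mono fun x hx => (H m hmv x hx).le)
    simpa using this
  have h3 := h2.add h1.tendsto
  rw [zero_add] at h3
  refine h3.congr fun m => ?_
  ring

/-- All summands refer to the same measure: particle `i` put back among the others gives `emp (Z
k)`. Up to a uniformly small error the sum is an integral against this measure. -/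
theorem IsMeanFieldLimit.tendsto_sum {g : ∀ n : ℕ, ℝ → (Fin n → ℝ) → ℝ}
    {gbar : ℝ → ProbabilityMeasure ℝ → ℝ} (hg : IsMeanFieldLimit g gbar) {R : ℝ} (hR : 0 < R)
    {θ : ℝ → ℝ} (hθ : Continuous θ) {ν : ℕ → ℕ} (hν : Tendsto ν atTop atTop)
    {Z : ∀ k, Fin (ν k + 1) → ℝ} (hZ : ∀ k i, |Z k i| ≤ R) {m : ProbabilityMeasure ℝ}
    (hm : SupportedIn R m) (hlim : Tendsto (fun k => emp (Z k)) atTop (𝓝 m)) :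
    Tendsto (fun k => (((ν k + 1 : ℕ) : ℝ))⁻¹ * ∑ i, θ (Z k i) * g (ν k) (Z k i) (i.removeNth (Z k)))
      atTop (𝓝 (∫ x, θ x * gbar x m ∂(m : Measure ℝ))) := by
  have h1 := (continuousOn_integral_mul (hg.continuousOn R hR) hθ m hm).tendsto.comp
    (tendsto_nhdsWithin_iff.2 ⟨hlim, Eventually.of_forall fun k => supportedIn_emp (hZ k)⟩)
  obtain ⟨C, hC⟩ := isCompact_Icc.exists_bound_of_continuousOn (hθ.continuousOn (s := Icc (-R) R))
  have h2 : Tendsto (fun k => (((ν k + 1 : ℕ) : ℝ))⁻¹ *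
      ∑ i, θ (Z k i) * g (ν k) (Z k i) (i.removeNth (Z k))
      - ∫ x, θ x * gbar x (emp (Z k)) ∂(emp (Z k) : Measure ℝ)) atTop (𝓝 0) := by
    rw [Metric.tendsto_nhds]
    intro ε hε
    have hε' : 0 < ε / 2 / (|C| + 1) := by positivity
    filter_upwards [hν.eventually (hg.tendsto R hR _ hε')] with k hk
    rw [show ∫ x, θ x * gbar x (emp (Z k)) ∂(emp (Z k) : Measure ℝ) = _ from
      integral_empMeasure (Z k) _, Real.dist_eq, sub_zero, ← mul_sub, ← Finset.sum_sub_distrib,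
      abs_mul, abs_of_pos (by positivity)]
    refine lt_of_le_of_lt ?_ (half_lt_self hε)
    rw [inv_mul_le_iff₀ (by positivity)]
    refine (Finset.abs_sum_le_sum_abs _ _).trans ?_
    calc ∑ i, |θ (Z k i) * g (ν k) (Z k i) (i.removeNth (Z k)) - θ (Z k i) * gbar (Z k i) (emp (Z k))|
        ≤ ∑ _i : Fin (ν k + 1), ε / 2 := by
          refine Finset.sum_le_sum fun i _ => ?_
          have h3 := hk (Z k i) (i.removeNth (Z k)) (hZ k i) (fun j => hZ k _)
          rw [emp_cons_removeNth] at h3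
          rw [← mul_sub, abs_mul]
          have h4 : |θ (Z k i)| ≤ |C| + 1 := by
            have := hC (Z k i) (abs_le.1 (hZ k i))
            rw [Real.norm_eq_abs] at this
            linarith [le_abs_self C]
          calc _ ≤ (|C| + 1) * (ε / 2 / (|C| + 1)) := mul_le_mul h4 h3 (abs_nonneg _) (by positivity)
            _ = ε / 2 := by field_simp
      _ = ((ν k + 1 : ℕ) : ℝ) * (ε / 2) := by simp
  have h3 := h2.add h1
  rw [zero_add] at h3
  refine h3.congr fun k => ?_
  simp only [Function.comp_apply]
  ring

/-! ### Compactness of curves of measures. -/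

/-- Compactness of sequences of curves of measures that are uniformly Lipschitz for `d1` and carried
by a fixed compact set. -/
theorem exists_subseq_tendsto_iSup_d1 {R V T : ℝ} (hV : 0 ≤ V) (hT : 0 ≤ T)
    {μ : ℕ → ℝ → ProbabilityMeasure ℝ}
    (hsupp : ∀ n, ∀ t ∈ Icc 0 T, SupportedIn R (μ n t))
    (hlip : ∀ n, ∀ t ∈ Icc 0 T, ∀ s ∈ Icc 0 T,
      d1 (μ n t) (μ n s) ≤ ENNReal.ofReal (V * |t - s|)) :
    ∃ ψ : ℕ → ℕ, StrictMono ψ ∧ ∃ m : ℝ → ProbabilityMeasure ℝ,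
      (∀ t ∈ Icc 0 T, SupportedIn R (m t)) ∧
      (∀ t ∈ Icc 0 T, ∀ s ∈ Icc 0 T, d1 (m t) (m s) ≤ ENNReal.ofReal (V * |t - s|)) ∧
      Tendsto (fun k => ⨆ t ∈ Icc 0 T, d1 (μ (ψ k) t) (m t)) atTop (𝓝 0) := by
  -- Tychonoff gives a cluster point for pointwise convergence. Being approached only frequently,
  -- but at finitely many times simultaneously, it inherits the Lipschitz bound, and closeness on a
  -- finite net of times becomes uniform closeness.
  obtain ⟨m₀, hm₀, hclus⟩ := (isCompact_univ_pi fun _ : Icc (0 : ℝ) T =>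
    isCompact_supportedIn R).exists_mapClusterPt
    (u := fun n (t : Icc (0 : ℝ) T) => μ n t) (f := atTop)
    (tendsto_principal.2 (Eventually.of_forall fun n (t : Icc (0 : ℝ) T) _ => hsupp n t t.2))
  set m : ℝ → ProbabilityMeasure ℝ := fun t => m₀ (projIcc 0 T hT t) with hm
  have hmm : ∀ t (ht : t ∈ Icc 0 T), m t = m₀ ⟨t, ht⟩ := fun t ht => by
    simp only [hm, projIcc_of_mem hT ht]
  have hmsupp : ∀ t ∈ Icc 0 T, SupportedIn R (m t) := fun t _ => hm₀ _ (mem_univ _)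
  have hfreq : ∀ S : Set ℝ, S.Finite → S ⊆ Icc 0 T → ∀ ε > 0,
      ∃ᶠ n in atTop, ∀ t ∈ S, d1 (μ n t) (m t) ≤ ENNReal.ofReal ε := by
    intro S hS hST ε hε
    have hnhds : ∀ t ∈ S, {ν : Icc (0 : ℝ) T → ProbabilityMeasure ℝ | ∀ ht : t ∈ Icc 0 T,
        SupportedIn R (ν ⟨t, ht⟩) → d1 (ν ⟨t, ht⟩) (m t) ≤ ENNReal.ofReal ε} ∈ 𝓝 m₀ := by
      intro t ht
      have htT := hST ht
      have h1 : Tendsto (fun ν : ProbabilityMeasure ℝ => d1 ν (m t))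
          (𝓝[{ν | SupportedIn R ν}] (m t)) (𝓝 0) :=
        tendsto_d1_of_tendsto (μs := id) self_mem_nhdsWithin (hmsupp t htT)
          (tendsto_id.mono_left nhdsWithin_le_nhds)
      have h2 := eventually_nhdsWithin_iff.1 (ENNReal.tendsto_nhds_zero.1 h1 _
        (ENNReal.ofReal_pos.2 hε))
      have h3 : Tendsto (fun ν : Icc (0 : ℝ) T → ProbabilityMeasure ℝ => ν ⟨t, htT⟩) (𝓝 m₀)
          (𝓝 (m t)) := by
        rw [hmm t htT]
        exact (continuous_apply _).continuousAt
      filter_upwards [h3.eventually h2] with ν hν _ hs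
      exact hν hs
    refine (hclus.frequently ((biInter_mem hS).2 hnhds)).mono fun n hn t ht => ?_
    exact mem_iInter₂.1 hn t ht (hST ht) (hsupp n t (hST ht))
  have hmlip : ∀ t ∈ Icc 0 T, ∀ s ∈ Icc 0 T, d1 (m t) (m s) ≤ ENNReal.ofReal (V * |t - s|) := by
    intro t ht s hs
    refine ENNReal.le_of_forall_pos_le_add fun ε hε _ => ?_
    obtain ⟨n, hn⟩ := (hfreq {t, s} (by simp) (by
      rintro x (rfl | rfl) <;> assumption) (ε / 2) (by positivity)).exists
    have h1 := hn t (by simp)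
    have h2 := hn s (by simp)
    rw [d1_comm] at h1
    calc d1 (m t) (m s) ≤ d1 (m t) (μ n t) + (d1 (μ n t) (μ n s) + d1 (μ n s) (m s)) :=
          (d1_triangle _ (μ n t) _).trans (add_le_add_right (d1_triangle _ (μ n s) _) _)
      _ ≤ ENNReal.ofReal (ε / 2) + (ENNReal.ofReal (V * |t - s|) + ENNReal.ofReal (ε / 2)) :=
          add_le_add h1 (add_le_add (hlip n t ht s hs) h2)
      _ = ENNReal.ofReal (V * |t - s|) + ε := by
          rw [add_left_comm, ← ENNReal.ofReal_add (by positivity) (by positivity), add_halves,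
            ENNReal.ofReal_coe_nnreal]
  have hP : ∀ k : ℕ, ∃ᶠ n in atTop,
      ⨆ t ∈ Icc 0 T, d1 (μ n t) (m t) ≤ ENNReal.ofReal (1 / ((k : ℝ) + 1)) := by
    intro k
    set ε : ℝ := 1 / ((k : ℝ) + 1) with hε
    have hε0 : 0 < ε := by positivity
    -- The mesh makes each curve vary by at most `ε / 3` to the nearest net point; `V + 1` avoids
    -- division by zero.
    obtain ⟨S, hST, hS, hcov⟩ := (isCompact_Icc (a := (0 : ℝ)) (b := T)).finite_cover_balls
      (e := ε / (3 * (V + 1))) (by positivity)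
    refine (hfreq S hS hST (ε / 3) (by positivity)).mono fun n hn => iSup₂_le fun t ht => ?_
    obtain ⟨s, hs, hts⟩ := mem_iUnion₂.1 (hcov ht)
    rw [Metric.mem_ball, Real.dist_eq, lt_div_iff₀ (by positivity)] at hts
    have hVts : V * |t - s| ≤ ε / 3 := by nlinarith [abs_nonneg (t - s)]
    calc d1 (μ n t) (m t) ≤ d1 (μ n t) (μ n s) + (d1 (μ n s) (m s) + d1 (m s) (m t)) :=
          (d1_triangle _ (μ n s) _).trans (add_le_add_right (d1_triangle _ (m s) _) _)
      _ ≤ ENNReal.ofReal (ε / 3) + (ENNReal.ofReal (ε / 3) + ENNReal.ofReal (ε / 3)) := by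
          refine add_le_add ((hlip n t ht s (hST hs)).trans (ENNReal.ofReal_le_ofReal hVts))
            (add_le_add (hn s hs) ((hmlip s (hST hs) t ht).trans (ENNReal.ofReal_le_ofReal ?_)))
          rwa [abs_sub_comm]
      _ = ENNReal.ofReal ε := by
          rw [← ENNReal.ofReal_add (by positivity) (by positivity),
            ← ENNReal.ofReal_add (by positivity) (by positivity)]
          congr 1
          ring
  obtain ⟨ψ, hψ, hψP⟩ := extraction_forall_of_frequently hP
  refine ⟨ψ, hψ, m, hmsupp, hmlip, ?_⟩
  have h0 : Tendsto (fun k : ℕ => ENNReal.ofReal (1 / ((k : ℝ) + 1))) atTop (𝓝 0) := by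
    rw [← ENNReal.ofReal_zero]
    exact ENNReal.tendsto_ofReal tendsto_one_div_add_atTop_nhds_zero_nat
  exact tendsto_of_tendsto_of_tendsto_of_le_of_le tendsto_const_nhds h0 (fun _ => zero_le) hψP

/-! ### Particle flows and their limits. -/

/-- The velocity of a particle at `ξ`, the other ones being at `Y`, at a time where the weight of the
control is `a`. -/
noncomputable def drift (a : ℝ) (f g : ∀ n : ℕ, ℝ → (Fin n → ℝ) → ℝ) (n : ℕ) (ξ : ℝ)
    (Y : Fin n → ℝ) : ℝ :=
  f n ξ Y - 1 / a * g n ξ Y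

/-- `X` solves the particle systems `x_i' = f (x_i, X_{-i}) - (1 / a) g (x_i, X_{-i})` on
`[0, T]`. -/
def IsParticleFlow (T : ℝ) (a : ℝ → ℝ) (f g : ∀ n : ℕ, ℝ → (Fin n → ℝ) → ℝ)
    (X : ∀ n : ℕ, ℝ → Fin (n + 1) → ℝ) : Prop :=
  ∀ n i, ∀ t ∈ Icc 0 T, HasDerivWithinAt (fun s => X n s i)
    (drift (a t) f g n (X n t i) (i.removeNth (X n t))) (Icc 0 T) t

theorem norm_removeNth_le {n : ℕ} (Y : Fin (n + 1) → ℝ) (i : Fin (n + 1)) :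
    ‖i.removeNth Y‖ ≤ ‖Y‖ :=
  (pi_norm_le_iff_of_nonneg (norm_nonneg _)).2 fun _ => norm_le_pi_norm Y _

section

variable {T : ℝ} {a : ℝ → ℝ} {f g : ∀ n : ℕ, ℝ → (Fin n → ℝ) → ℝ}
  {X : ∀ n : ℕ, ℝ → Fin (n + 1) → ℝ}

theorem exists_drift_bound (ha : ContinuousOn a (Icc 0 T)) (ha_pos : ∀ t ∈ Icc 0 T, 0 < a t)
    (hf : LinearGrowth f) (hg : LinearGrowth g) :
    ∃ K ≥ 0, ∀ t ∈ Icc 0 T, ∀ n ξ (Y : Fin n → ℝ), |drift (a t) f g n ξ Y| ≤ K * (1 + |ξ| + ‖Y‖) := by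
  obtain ⟨C, hC⟩ := hf
  obtain ⟨D, hD⟩ := hg
  obtain ⟨A, hA⟩ := isCompact_Icc.exists_bound_of_continuousOn
    (ContinuousOn.div continuousOn_const ha fun t ht => (ha_pos t ht).ne' :
      ContinuousOn (fun t => 1 / a t) (Icc 0 T))
  refine ⟨|C| + |A| * |D|, by positivity, fun t ht n ξ Y => ?_⟩
  have hpos : 0 ≤ 1 + |ξ| + ‖Y‖ := by positivity
  have h1 : |f n ξ Y| ≤ |C| * (1 + |ξ| + ‖Y‖) :=
    (hC n ξ Y).trans (mul_le_mul_of_nonneg_right (le_abs_self C) hpos)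
  have h2 : |g n ξ Y| ≤ |D| * (1 + |ξ| + ‖Y‖) :=
    (hD n ξ Y).trans (mul_le_mul_of_nonneg_right (le_abs_self D) hpos)
  have h3 : |1 / a t| ≤ |A| := (hA t ht).trans (le_abs_self A)
  calc |drift (a t) f g n ξ Y| ≤ |f n ξ Y| + |1 / a t| * |g n ξ Y| := by
        rw [← abs_mul]; exact abs_sub _ _
    _ ≤ |C| * (1 + |ξ| + ‖Y‖) + |A| * (|D| * (1 + |ξ| + ‖Y‖)) :=
        add_le_add h1 (mul_le_mul h3 h2 (abs_nonneg _) (abs_nonneg _))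
    _ = _ := by ring

theorem IsParticleFlow.continuousOn (hX : IsParticleFlow T a f g X) (n : ℕ) :
    ContinuousOn (X n) (Icc 0 T) :=
  continuousOn_pi.2 fun i t ht => (hX n i t ht).continuousWithinAt

/-- Grönwall's inequality in the maximum norm, in which the growth constant does not depend on the
number of particles. -/
theorem IsParticleFlow.exists_bound (hX : IsParticleFlow T a f g X)
    (ha : ContinuousOn a (Icc 0 T)) (ha_pos : ∀ t ∈ Icc 0 T, 0 < a t)
    (hf : LinearGrowth f) (hg : LinearGrowth g) (hX0 : ∃ R, ∀ n i, |X n 0 i| ≤ R) :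
    ∃ R > 0, ∃ V ≥ 0, (∀ n, ∀ t ∈ Icc 0 T, ∀ i, |X n t i| ≤ R) ∧
      ∀ n, ∀ t ∈ Icc 0 T, ∀ i, |drift (a t) f g n (X n t i) (i.removeNth (X n t))| ≤ V := by
  obtain ⟨K, hK, hKb⟩ := exists_drift_bound ha ha_pos hf hg
  obtain ⟨R₀, hR₀⟩ := hX0
  have hdr : ∀ n, ∀ t ∈ Icc 0 T, ∀ i,
      |drift (a t) f g n (X n t i) (i.removeNth (X n t))| ≤ K * (1 + 2 * ‖X n t‖) := by
    intro n t ht i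
    refine (hKb t ht n _ _).trans (mul_le_mul_of_nonneg_left ?_ hK)
    have h1 : |X n t i| ≤ ‖X n t‖ := norm_le_pi_norm (X n t) i
    have h2 := norm_removeNth_le (X n t) i
    linarith
  have hbound : ∀ n, ∀ t ∈ Icc 0 T, ‖X n t‖ ≤ gronwallBound |R₀| (2 * K) K T := by
    intro n t ht
    refine (norm_le_gronwallBound_of_norm_deriv_right_le (hX.continuousOn n)
      (f' := fun t i => drift (a t) f g n (X n t i) (i.removeNth (X n t)))
      (fun s hs => ?_) ?_ (fun s hs => ?_) t ht).trans
      (gronwallBound_mono (abs_nonneg _) hK (by positivity) (by linarith [ht.2]))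
    · exact hasDerivWithinAt_pi.2 fun i => (hX n i s (Ico_subset_Icc_self hs)).mono_of_mem_nhdsWithin
        (Icc_mem_nhdsGE_of_mem hs)
    · exact (pi_norm_le_iff_of_nonneg (abs_nonneg _)).2 fun i =>
        (hR₀ n i).trans (le_abs_self _)
    · refine (pi_norm_le_iff_of_nonneg (by positivity)).2 fun i => ?_
      refine (hdr n s (Ico_subset_Icc_self hs) i).trans (le_of_eq ?_)
      ring
  set R := |gronwallBound |R₀| (2 * K) K T| + 1 with hR
  have hRb : ∀ n, ∀ t ∈ Icc 0 T, ‖X n t‖ ≤ R := fun n t ht =>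
    (hbound n t ht).trans ((le_abs_self _).trans (by linarith))
  refine ⟨R, by positivity, K * (1 + 2 * R), by positivity,
    fun n t ht i => (norm_le_pi_norm (X n t) i).trans (hRb n t ht), fun n t ht i => ?_⟩
  refine (hdr n t ht i).trans (mul_le_mul_of_nonneg_left ?_ hK)
  linarith [hRb n t ht]

theorem IsParticleFlow.d1_le (hX : IsParticleFlow T a f g X) {V : ℝ}
    (hV : ∀ n, ∀ t ∈ Icc 0 T, ∀ i, |drift (a t) f g n (X n t i) (i.removeNth (X n t))| ≤ V)
    (hV0 : 0 ≤ V) (n : ℕ) {t s : ℝ} (ht : t ∈ Icc 0 T) (hs : s ∈ Icc 0 T) :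
    d1 (emp (X n t)) (emp (X n s)) ≤ ENNReal.ofReal (V * |t - s|) :=
  d1_empMeasure_le (by positivity) fun i =>
    (convex_Icc 0 T).norm_image_sub_le_of_norm_hasDerivWithin_le (fun t ht => hX n i t ht)
      (fun t ht => hV n t ht i) hs ht

/-- A limit of empirical measures of particle flows satisfies the limit equation. -/
theorem IsParticleFlow.weak_of_tendsto (hT : 0 < T) (hX : IsParticleFlow T a f g X)
    (ha : ContinuousOn a (Icc 0 T)) (ha_pos : ∀ t ∈ Icc 0 T, 0 < a t)
    (hfc : ∀ n, Continuous fun q : ℝ × (Fin n → ℝ) => f n q.1 q.2)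
    (hgc : ∀ n, Continuous fun q : ℝ × (Fin n → ℝ) => g n q.1 q.2)
    {fbar gbar : ℝ → ProbabilityMeasure ℝ → ℝ}
    (hf : IsMeanFieldLimit f fbar) (hg : IsMeanFieldLimit g gbar)
    {R V : ℝ} (hR : 0 < R) (hXR : ∀ n, ∀ t ∈ Icc 0 T, ∀ i, |X n t i| ≤ R)
    (hV : ∀ n, ∀ t ∈ Icc 0 T, ∀ i, |drift (a t) f g n (X n t i) (i.removeNth (X n t))| ≤ V)
    {ν : ℕ → ℕ} (hν : Tendsto ν atTop atTop) {m : ℝ → ProbabilityMeasure ℝ}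
    (hm : ∀ t ∈ Icc 0 T, SupportedIn R (m t)) (hmc : ContinuousOn m (Icc 0 T))
    (hlim : ∀ t ∈ Icc 0 T, Tendsto (fun k => emp (X (ν k) t)) atTop (𝓝 (m t)))
    {ψ : ℝ → ℝ} (hψ : ContDiff ℝ ∞ ψ) {t : ℝ} (ht : t ∈ Icc 0 T) :
    HasDerivWithinAt (fun s => ∫ x, ψ x ∂(m s : Measure ℝ))
      (∫ x, deriv ψ x * (fbar x (m t) - 1 / a t * gbar x (m t)) ∂(m t : Measure ℝ)) (Icc 0 T) t := by
  set θ := deriv ψ with hθ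
  have hθc : Continuous θ := hψ.continuous_deriv (by simp)
  have hψd : Differentiable ℝ ψ := hψ.differentiable (by simp)
  have hinv : ContinuousOn (fun t => 1 / a t) (Icc 0 T) :=
    ContinuousOn.div continuousOn_const ha fun t ht => (ha_pos t ht).ne'
  set J : (ℝ → ProbabilityMeasure ℝ → ℝ) → ℝ → ℝ :=
    fun G s => ∫ x, θ x * G x (m s) ∂(m s : Measure ℝ) with hJ
  -- `B` is continuous in time, so it suffices to prove the integrated equation and differentiate
  -- the integral of `B`.
  set B : ℝ → ℝ := fun s => J fbar s - 1 / a s * J gbar s with hB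
  have hJc : ∀ {G}, (∀ R > 0, ContinuousOn (fun q : ℝ × ProbabilityMeasure ℝ => G q.1 q.2)
      {q | SupportedIn R q.2}) → ContinuousOn (J G) (Icc 0 T) := fun hG =>
    (continuousOn_integral_mul (hG R hR) hθc).comp hmc hm
  have hBc : ContinuousOn B (Icc 0 T) :=
    (hJc hf.continuousOn).sub (hinv.mul (hJc hg.continuousOn))
  have hBeq : ∀ s ∈ Icc 0 T,
      ∫ x, θ x * (fbar x (m s) - 1 / a s * gbar x (m s)) ∂(m s : Measure ℝ) = B s := by
    intro s hs
    have h1 : Integrable (fun x => θ x * fbar x (m s)) (m s : Measure ℝ) := (hm s hs).integrable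
      (hθc.mul (continuous_of_continuousOn_supportedIn (hf.continuousOn R hR) (hm s hs)))
    have h2 : Integrable (fun x => θ x * gbar x (m s)) (m s : Measure ℝ) := (hm s hs).integrable
      (hθc.mul (continuous_of_continuousOn_supportedIn (hg.continuousOn R hR) (hm s hs)))
    simp only [hB, hJ]
    rw [← integral_const_mul, ← integral_sub h1 (h2.const_mul _)]
    congr 1
    ext x
    ring
  -- By the chain rule this is the time derivative of `∫ ψ` for the empirical measure. It converges
  -- pointwise to `B` and is bounded uniformly, so dominated convergence applies.
  set b : ℕ → ℝ → ℝ := fun k s => (((ν k + 1 : ℕ) : ℝ))⁻¹ *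
    ∑ i, θ (X (ν k) s i) * drift (a s) f g (ν k) (X (ν k) s i) (i.removeNth (X (ν k) s)) with hb
  have hblim : ∀ s ∈ Icc 0 T, Tendsto (fun k => b k s) atTop (𝓝 (B s)) := by
    intro s hs
    have h1 := hf.tendsto_sum hR hθc hν (Z := fun k => X (ν k) s) (fun k i => hXR _ s hs i)
      (hm s hs) (hlim s hs)
    have h2 := hg.tendsto_sum hR hθc hν (Z := fun k => X (ν k) s) (fun k i => hXR _ s hs i)
      (hm s hs) (hlim s hs)
    refine (h1.sub (h2.const_mul (1 / a s))).congr fun k => ?_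
    simp only [hb, drift]
    rw [mul_left_comm, ← mul_sub, Finset.mul_sum, ← Finset.sum_sub_distrib]
    congr 1
    refine Finset.sum_congr rfl fun i _ => ?_
    ring
  have hbc : ∀ k, ContinuousOn (b k) (Icc 0 T) := by
    intro k
    refine continuousOn_const.mul (continuousOn_finsetSum _ fun i _ => ?_)
    have hXi : ContinuousOn (fun s => X (ν k) s i) (Icc 0 T) := fun s hs =>
      (hX _ i s hs).continuousWithinAt
    have hp : ContinuousOn (fun s => (X (ν k) s i, i.removeNth (X (ν k) s))) (Icc 0 T) :=
      hXi.prodMk (continuousOn_pi.2 fun j s hs => (hX _ _ s hs).continuousWithinAt)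
    exact (hθc.comp_continuousOn hXi).mul (((hfc _).comp_continuousOn hp).sub
      (hinv.mul ((hgc _).comp_continuousOn hp)))
  obtain ⟨C, hC⟩ := isCompact_Icc.exists_bound_of_continuousOn (hθc.continuousOn (s := Icc (-R) R))
  have hbb : ∀ k, ∀ s ∈ Icc 0 T, ‖b k s‖ ≤ |C| * V := by
    intro k s hs
    rw [Real.norm_eq_abs, abs_mul, abs_of_pos (by positivity), inv_mul_le_iff₀ (by positivity)]
    refine (Finset.abs_sum_le_sum_abs _ _).trans ?_
    calc _ ≤ ∑ _i : Fin (ν k + 1), |C| * V := by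
          refine Finset.sum_le_sum fun i _ => ?_
          rw [abs_mul]
          exact mul_le_mul ((hC _ (abs_le.1 (hXR _ s hs i))).trans (le_abs_self C)) (hV _ s hs i)
            (abs_nonneg _) (abs_nonneg _)
      _ = _ := by simp
  have hftc : ∀ k, ∀ r ∈ Icc 0 T, ∫ s in (0 : ℝ)..r, b k s
      = ∫ x, ψ x ∂(emp (X (ν k) r) : Measure ℝ) - ∫ x, ψ x ∂(emp (X (ν k) 0) : Measure ℝ) := by
    intro k r hr
    have hd : ∀ s ∈ Icc 0 T, HasDerivWithinAt
        (fun s => (((ν k + 1 : ℕ) : ℝ))⁻¹ * ∑ i, ψ (X (ν k) s i)) (b k s) (Icc 0 T) s := by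
      intro s hs
      refine HasDerivWithinAt.const_mul _ (HasDerivWithinAt.fun_sum fun i _ => ?_)
      exact (hψd _).hasDerivAt.comp_hasDerivWithinAt s (hX _ i s hs)
    have hsub : Icc 0 r ⊆ Icc 0 T := Icc_subset_Icc_right hr.2
    rw [intervalIntegral.integral_eq_sub_of_hasDeriv_right_of_le hr.1
      (f := fun s => (((ν k + 1 : ℕ) : ℝ))⁻¹ * ∑ i, ψ (X (ν k) s i))
      (fun s hs => ((hd s (hsub hs)).mono hsub).continuousWithinAt)
      (fun s hs => (hd s (hsub (Ioo_subset_Icc_self hs))).mono_of_mem_nhdsWithin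
        (mem_nhdsWithin_of_mem_nhds (Icc_mem_nhds hs.1 (hs.2.trans_le hr.2))))
      (((hbc k).mono (by rw [uIcc_of_le hr.1]; exact hsub)).intervalIntegrable)]
    exact congrArg₂ _ (integral_empMeasure _ _).symm (integral_empMeasure _ _).symm
  have hmain : ∀ r ∈ Icc 0 T, ∫ x, ψ x ∂(m r : Measure ℝ)
      = ∫ x, ψ x ∂(m 0 : Measure ℝ) + ∫ s in (0 : ℝ)..r, B s := by
    intro r hr
    have hsub : Icc 0 r ⊆ Icc 0 T := Icc_subset_Icc_right hr.2
    have h0 : (0 : ℝ) ∈ Icc 0 T := ⟨le_rfl, hT.le⟩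
    have h1 : ∀ s ∈ Icc 0 T, Tendsto (fun k => ∫ x, ψ x ∂(emp (X (ν k) s) : Measure ℝ)) atTop
        (𝓝 (∫ x, ψ x ∂(m s : Measure ℝ))) := fun s hs =>
      (continuousOn_integral_of_supportedIn hψ.continuous (m s) (hm s hs)).tendsto.comp
        (tendsto_nhdsWithin_iff.2 ⟨hlim s hs,
          Eventually.of_forall fun k => supportedIn_emp (hXR _ s hs)⟩)
    have h2 : Tendsto (fun k => ∫ s in (0 : ℝ)..r, b k s) atTop (𝓝 (∫ s in (0 : ℝ)..r, B s)) := by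
      refine intervalIntegral.tendsto_integral_filter_of_dominated_convergence (fun _ => |C| * V)
        (Eventually.of_forall fun k => ?_) (Eventually.of_forall fun k => ?_) (by simp) ?_
      · rw [uIoc_of_le hr.1]
        exact ((hbc k).mono (Ioc_subset_Icc_self.trans hsub)).aestronglyMeasurable measurableSet_Ioc
      · refine Eventually.of_forall fun s hs => hbb k s ?_
        rw [uIoc_of_le hr.1] at hs
        exact hsub (Ioc_subset_Icc_self hs)
      · refine Eventually.of_forall fun s hs => hblim s ?_
        rw [uIoc_of_le hr.1] at hs
        exact hsub (Ioc_subset_Icc_self hs)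
    have h3 := tendsto_nhds_unique (h2.congr fun k => hftc k r hr) ((h1 r hr).sub (h1 0 h0))
    rw [h3]
    ring
  rw [hBeq t ht]
  -- The fundamental theorem of calculus relative to `Icc 0 T`, one-sided at the endpoints, takes
  -- this membership as an instance.
  have : Fact (t ∈ Icc 0 T) := ⟨ht⟩
  have hder : HasDerivWithinAt (fun r => ∫ s in (0 : ℝ)..r, B s) (B t) (Icc 0 T) t := by
    refine intervalIntegral.integral_hasDerivWithinAt_right ?_ ?_ (hBc t ht)
    · exact (hBc.mono (by rw [uIcc_of_le ht.1]; exact Icc_subset_Icc_right ht.2)).intervalIntegrable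
    · exact hBc.stronglyMeasurableAtFilter_nhdsWithin measurableSet_Icc t
  exact (hder.const_add (∫ x, ψ x ∂(m 0 : Measure ℝ))).congr hmain (hmain t ht)

end

theorem hasDerivAt_fst_of_contDiff {n : ℕ} {h : ℝ → (Fin n → ℝ) → ℝ}
    (hh : ContDiff ℝ ∞ fun q : ℝ × (Fin n → ℝ) => h q.1 q.2) (ξ : ℝ) (Y : Fin n → ℝ) :
    HasDerivAt (fun s => h s Y)
      (fderiv ℝ (fun q : ℝ × (Fin n → ℝ) => h q.1 q.2) (ξ, Y) (1, 0)) ξ := by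
  have h1 : HasFDerivAt (fun q : ℝ × (Fin n → ℝ) => h q.1 q.2)
      (fderiv ℝ (fun q : ℝ × (Fin n → ℝ) => h q.1 q.2) (ξ, Y)) (ξ, Y) :=
    (hh.differentiable (by simp) (ξ, Y)).hasFDerivAt
  exact h1.comp_hasDerivAt ξ ((hasDerivAt_id ξ).prodMk (hasDerivAt_const ξ Y))

theorem contDiff_deriv_fst {n : ℕ} {h : ℝ → (Fin n → ℝ) → ℝ}
    (hh : ContDiff ℝ ∞ fun q : ℝ × (Fin n → ℝ) => h q.1 q.2) :
    ContDiff ℝ ∞ fun q : ℝ × (Fin n → ℝ) => deriv (fun s => h s q.2) q.1 := by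
  have : (fun q : ℝ × (Fin n → ℝ) => deriv (fun s => h s q.2) q.1)
      = fun q => fderiv ℝ (fun q : ℝ × (Fin n → ℝ) => h q.1 q.2) q (1, 0) :=
    funext fun q => (hasDerivAt_fst_of_contDiff hh q.1 q.2).deriv
  rw [this]
  exact (hh.fderiv_right (m := ∞) (by simp)).clm_apply contDiff_const

theorem continuousOn_of_d1_le {T V : ℝ} {m : ℝ → ProbabilityMeasure ℝ}
    (h : ∀ t ∈ Icc 0 T, ∀ s ∈ Icc 0 T, d1 (m t) (m s) ≤ ENNReal.ofReal (V * |t - s|)) :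
    ContinuousOn m (Icc 0 T) := by
  intro t ht
  refine tendsto_of_tendsto_d1 ?_
  have h1 : Tendsto (fun s => ENNReal.ofReal (V * |s - t|)) (𝓝[Icc 0 T] t) (𝓝 0) := by
    have : Continuous fun s => ENNReal.ofReal (V * |s - t|) :=
      ENNReal.continuous_ofReal.comp (by fun_prop)
    have h2 := (this.tendsto t).mono_left (nhdsWithin_le_nhds (s := Icc 0 T))
    simpa using h2
  refine tendsto_of_tendsto_of_tendsto_of_le_of_le' tendsto_const_nhds h1
    (Eventually.of_forall fun _ => zero_le) ?_
  filter_upwards [self_mem_nhdsWithin] with s hs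
  exact h s hs t ht

theorem IsParticleFlow.exists_subseq_tendsto {T : ℝ} (hT : 0 < T) {a : ℝ → ℝ}
    {f h : ∀ n : ℕ, ℝ → (Fin n → ℝ) → ℝ} {X : ∀ n : ℕ, ℝ → Fin (n + 1) → ℝ}
    (hX : IsParticleFlow T a f (fun n ξ Y => deriv (fun s => h n s Y) ξ) X)
    (ha : ContinuousOn a (Icc 0 T)) (ha_pos : ∀ t ∈ Icc 0 T, 0 < a t)
    (hfs : ∀ n, ContDiff ℝ ∞ fun q : ℝ × (Fin n → ℝ) => f n q.1 q.2)
    (hhs : ∀ n, ContDiff ℝ ∞ fun q : ℝ × (Fin n → ℝ) => h n q.1 q.2)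
    (hfg : LinearGrowth f) (hhg : LinearGrowth fun n ξ Y => deriv (fun s => h n s Y) ξ)
    (hhe : LocallyEquicontinuous fun n ξ Y => deriv (fun s => h n s Y) ξ)
    {fbar hbar : ℝ → ProbabilityMeasure ℝ → ℝ}
    (hf : IsMeanFieldLimit f fbar) (hh : IsMeanFieldLimit h hbar)
    (hX0 : ∃ R, ∀ n i, |X n 0 i| ≤ R) {mbar : ProbabilityMeasure ℝ}
    (hmbar : Tendsto (fun n => emp (X n 0)) atTop (𝓝 mbar)) {φ : ℕ → ℕ} (hφ : StrictMono φ) :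
    ∃ ψ : ℕ → ℕ, StrictMono ψ ∧
      ∃ m : ℝ → ProbabilityMeasure ℝ, IsWeakSolution T a fbar hbar mbar m ∧
        Tendsto (fun k => ⨆ t ∈ Icc 0 T, d1 (emp (X (φ (ψ k)) t)) (m t)) atTop (𝓝 0) := by
  have hd : ∀ n Y, Differentiable ℝ fun s => h n s Y := fun n Y ξ =>
    (hasDerivAt_fst_of_contDiff (hhs n) ξ Y).differentiableAt
  have hg := isMeanFieldLimit_deriv hh hd hhe
  obtain ⟨R, hR, V, hV0, hXR, hV⟩ := hX.exists_bound ha ha_pos hfg hhg hX0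
  obtain ⟨ψ, hψ, m, hmR, hmV, hlim⟩ := exists_subseq_tendsto_iSup_d1 hV0 hT.le
    (μ := fun k t => emp (X (φ k) t)) (fun k t ht => supportedIn_emp (hXR _ t ht))
    (fun k t ht s hs => hX.d1_le hV hV0 _ ht hs)
  have hlim' : ∀ t ∈ Icc 0 T, Tendsto (fun k => emp (X (φ (ψ k)) t)) atTop (𝓝 (m t)) := by
    intro t ht
    refine tendsto_of_tendsto_d1 (tendsto_of_tendsto_of_tendsto_of_le_of_le tendsto_const_nhds hlim
      (fun _ => zero_le) fun k => ?_)
    exact le_iSup₂ (f := fun t (_ : t ∈ Icc 0 T) =>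
      d1 (emp (X (φ (ψ k)) t) : Measure ℝ) (m t)) t ht
  have hν : Tendsto (fun k => φ (ψ k)) atTop atTop :=
    hφ.tendsto_atTop.comp hψ.tendsto_atTop
  have hmc := continuousOn_of_d1_le hmV
  refine ⟨ψ, hψ, m, ⟨?_, hmc, ⟨R, hmR⟩, fun t ht => hh.differentiable hd hhe (hmR t ht), ?_, ?_⟩,
    hlim⟩
  · exact tendsto_nhds_unique (hlim' 0 ⟨le_rfl, hT.le⟩) (hmbar.comp hν)
  · intro θ hθ _ t ht
    have h1 := continuous_of_continuousOn_supportedIn (hf.continuousOn R hR) (hmR t ht)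
    have h2 := continuous_of_continuousOn_supportedIn
      (g := fun x m => deriv (fun y => hbar y m) x) (hg.continuousOn R hR) (hmR t ht)
    exact (hmR t ht).integrable ((hθ.continuous_deriv (by simp)).mul
      (h1.sub (continuous_const.mul h2)))
  · intro θ hθ _ t ht
    exact hX.weak_of_tendsto hT ha ha_pos (fun n => (hfs n).continuous)
      (fun n => (contDiff_deriv_fst (hhs n)).continuous) hf hg hR hXR hV hν hmR hmc hlim' hθ ht

/-! ### Characteristics and uniqueness for the continuity equation. -/

section ContinuityEquation

open scoped NNReal

/-- With a global bound and a global Lipschitz constant, Picard-Lindelöf on a ball of radius `V T`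
covers all of `[0, T]`. The initial time is arbitrary since characteristics are also traced
backwards. -/
theorem exists_integralCurve {T : ℝ} {v : ℝ → ℝ → ℝ} {L : ℝ≥0} {V : ℝ}
    (hL : ∀ t ∈ Icc 0 T, LipschitzWith L (v t))
    (hc : ∀ x, ContinuousOn (fun t => v t x) (Icc 0 T))
    (hV : ∀ t ∈ Icc 0 T, ∀ x, |v t x| ≤ V) {t₀ : ℝ} (ht₀ : t₀ ∈ Icc 0 T) (z : ℝ) :
    ∃ γ : ℝ → ℝ, γ t₀ = z ∧ ∀ t ∈ Icc 0 T, HasDerivWithinAt γ (v t (γ t)) (Icc 0 T) t := by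
  have hT : 0 ≤ T := ht₀.1.trans ht₀.2
  have hV0 : 0 ≤ V := (abs_nonneg _).trans (hV t₀ ht₀ 0)
  have hpl : IsPicardLindelof v (⟨t₀, ht₀⟩ : Icc (0 : ℝ) T) z (V.toNNReal * T.toNNReal) 0
      V.toNNReal L :=
    { lipschitzOnWith := fun t ht => (hL t ht).lipschitzOnWith
      continuousOn := fun x _ => hc x
      norm_le := fun t ht x _ => by
        rw [Real.coe_toNNReal _ hV0]
        exact hV t ht x
      mul_max_le := by
        rw [NNReal.coe_mul, Real.coe_toNNReal _ hV0, Real.coe_toNNReal _ hT, NNReal.coe_zero]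
        simp only [sub_zero]
        refine mul_le_mul_of_nonneg_left (max_le ?_ ?_) hV0
        · linarith [ht₀.1]
        · exact ht₀.2 }
  exact hpl.exists_eq_forall_mem_Icc_hasDerivWithinAt₀

/-- The weak equation holds for smooth test functions that are not compactly supported. -/
theorem hasDerivWithinAt_integral_of_contDiff {T R : ℝ} {m : ℝ → ProbabilityMeasure ℝ}
    {v : ℝ → ℝ → ℝ} (hm : ∀ t ∈ Icc 0 T, SupportedIn R (m t))
    (hweak : ∀ ψ : ℝ → ℝ, ContDiff ℝ ∞ ψ → HasCompactSupport ψ → ∀ t ∈ Icc 0 T,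
      HasDerivWithinAt (fun s => ∫ x, ψ x ∂(m s : Measure ℝ))
        (∫ x, deriv ψ x * v t x ∂(m t : Measure ℝ)) (Icc 0 T) t)
    {ψ : ℝ → ℝ} (hψ : ContDiff ℝ ∞ ψ) {t : ℝ} (ht : t ∈ Icc 0 T) :
    HasDerivWithinAt (fun s => ∫ x, ψ x ∂(m s : Measure ℝ))
      (∫ x, deriv ψ x * v t x ∂(m t : Measure ℝ)) (Icc 0 T) t := by
  have hR := (hm t ht).nonneg
  -- The cutoff equals 1 on a neighbourhood of `[-R, R]`, so multiplying by it changes neither `ψ`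
  -- nor its derivative there.
  let χ : ContDiffBump (0 : ℝ) := ⟨R + 1, R + 2, by linarith, by linarith⟩
  have hχ1 : ∀ x ∈ Icc (-R) R, (fun y => ψ y * χ y) =ᶠ[𝓝 x] ψ := by
    intro x hx
    have : Metric.ball (0 : ℝ) (R + 1) ∈ 𝓝 x := Metric.isOpen_ball.mem_nhds (by
      rw [Metric.mem_ball, Real.dist_eq, sub_zero]
      exact lt_of_le_of_lt (abs_le.2 hx) (by linarith))
    filter_upwards [this] with y hy
    rw [χ.one_of_mem_closedBall (Metric.ball_subset_closedBall hy), mul_one]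
  have h := hweak (fun y => ψ y * χ y) (hψ.mul χ.contDiff) (χ.hasCompactSupport.mul_left) t ht
  have heq : ∀ s ∈ Icc 0 T, ∫ x, ψ x ∂(m s : Measure ℝ) = ∫ x, ψ x * χ x ∂(m s : Measure ℝ) :=
    fun s hs => integral_congr_ae ((hm s hs).ae_mem.mono fun x hx => ((hχ1 x hx).eq_of_nhds).symm)
  have hd : ∫ x, deriv (fun y => ψ y * χ y) x * v t x ∂(m t : Measure ℝ)
      = ∫ x, deriv ψ x * v t x ∂(m t : Measure ℝ) :=
    integral_congr_ae ((hm t ht).ae_mem.mono fun x hx => by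
      show deriv (fun y => ψ y * χ y) x * v t x = deriv ψ x * v t x
      rw [(hχ1 x hx).deriv_eq])
  rw [hd] at h
  exact h.congr heq (heq t ht)

/-- Differentiation of `∫ ψ (x - γ t) dm_t` for a moving test function. -/
theorem hasDerivWithinAt_integral_sub {T R : ℝ} {m : ℝ → ProbabilityMeasure ℝ}
    {v : ℝ → ℝ → ℝ} (hm : ∀ t ∈ Icc 0 T, SupportedIn R (m t))
    (hvc : ∀ t ∈ Icc 0 T, Continuous (v t))
    (hweak : ∀ ψ : ℝ → ℝ, ContDiff ℝ ∞ ψ → HasCompactSupport ψ → ∀ t ∈ Icc 0 T,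
      HasDerivWithinAt (fun s => ∫ x, ψ x ∂(m s : Measure ℝ))
        (∫ x, deriv ψ x * v t x ∂(m t : Measure ℝ)) (Icc 0 T) t)
    {γ : ℝ → ℝ} {t c : ℝ} (ht : t ∈ Icc 0 T) (hγ : HasDerivWithinAt γ c (Icc 0 T) t)
    {ψ : ℝ → ℝ} (hψ : ContDiff ℝ ∞ ψ) {C : ℝ} (hC : ∀ x y, |deriv ψ x - deriv ψ y| ≤ C * |x - y|) :
    HasDerivWithinAt (fun s => ∫ x, ψ (x - γ s) ∂(m s : Measure ℝ))
      (∫ x, deriv ψ (x - γ t) * (v t x - c) ∂(m t : Measure ℝ)) (Icc 0 T) t := by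
  have hψd : Differentiable ℝ ψ := hψ.differentiable (by simp)
  have hψ'c : Continuous (deriv ψ) := hψ.continuous_deriv (by simp)
  have hψ's : ContDiff ℝ ∞ (deriv ψ) := ((contDiff_infty_iff_deriv).1 hψ).2
  have hC0 : 0 ≤ C := by simpa using (abs_nonneg _).trans (hC 1 0)
  have hshift : ∀ {θ : ℝ → ℝ}, ContDiff ℝ ∞ θ → ContDiff ℝ ∞ fun x => θ (x - γ t) := fun hθ =>
    hθ.comp (contDiff_id.sub contDiff_const)
  have h1 := hasDerivWithinAt_integral_of_contDiff hm hweak (hshift hψ) ht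
  have h2 := hasDerivWithinAt_integral_of_contDiff hm hweak (hshift hψ's) ht
  have h3 := (hγ.sub_const (γ t)).mul h2
  have htaylor : ∀ x y : ℝ, |ψ (x - y) - ψ x + y * deriv ψ x| ≤ C * |y| * |y| := by
    intro x y
    have hder : ∀ z ∈ uIcc x (x - y), HasDerivWithinAt (fun z => ψ z - z * deriv ψ x)
        (deriv ψ z - 1 * deriv ψ x) (uIcc x (x - y)) z := fun z _ =>
      ((hψd z).hasDerivAt.sub ((hasDerivAt_id z).mul_const _)).hasDerivWithinAt
    have := (convex_uIcc x (x - y)).norm_image_sub_le_of_norm_hasDerivWithin_le hder (C := C * |y|)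
      (fun z hz => ?_) left_mem_uIcc right_mem_uIcc
    · rw [sub_sub_cancel_left, norm_neg] at this
      refine le_trans (le_of_eq ?_) this
      rw [Real.norm_eq_abs]
      congr 1
      ring
    · rw [one_mul]
      refine (hC z x).trans (mul_le_mul_of_nonneg_left ?_ hC0)
      have := abs_sub_left_of_mem_uIcc hz
      rwa [sub_sub_cancel_left, abs_neg] at this
  have hint : ∀ s ∈ Icc 0 T, ∀ {θ : ℝ → ℝ}, Continuous θ → Integrable θ (m s : Measure ℝ) :=
    fun s hs _ hθ => (hm s hs).integrable hθ
  -- The first-order Taylor remainder in the shift is `O(|γ s - γ t| ^ 2)`, uniformly in `x` and in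
  -- the measure `m s`. What remains involves only fixed test functions and the scalar factor `γ s -
  -- γ t`.
  have h4 : HasDerivWithinAt (fun s => ∫ x, ψ (x - γ s) ∂(m s : Measure ℝ)
      - ∫ x, ψ (x - γ t) ∂(m s : Measure ℝ)
      + (γ s - γ t) * ∫ x, deriv ψ (x - γ t) ∂(m s : Measure ℝ)) 0 (Icc 0 T) t := by
    rw [hasDerivWithinAt_iff_isLittleO]
    have hO : (fun s => γ s - γ t) =O[𝓝[Icc 0 T] t] fun s => s - t :=
      hγ.hasFDerivWithinAt.isBigO_sub
    have ho : (fun s => γ s - γ t) =o[𝓝[Icc 0 T] t] fun _ => (1 : ℝ) := by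
      rw [Asymptotics.isLittleO_one_iff]
      have := hγ.continuousWithinAt.tendsto.sub_const (γ t)
      rwa [sub_self] at this
    have hoO := hO.mul_isLittleO ho
    refine Asymptotics.IsBigO.trans_isLittleO (Asymptotics.IsBigO.of_bound C ?_)
      (by simpa using hoO)
    filter_upwards [self_mem_nhdsWithin] with s hs
    have hcs : ∀ r, Continuous fun x => ψ (x - r) := fun r => hψ.continuous.comp (by fun_prop)
    have hcd : Continuous fun x => deriv ψ (x - γ t) := hψ'c.comp (by fun_prop)
    simp only [sub_self, zero_mul, add_zero, smul_zero, sub_zero]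
    have hsub : Integrable (fun x => ψ (x - γ s) - ψ (x - γ t)) (m s : Measure ℝ) :=
      (hint s hs (hcs _)).sub (hint s hs (hcs _))
    rw [← integral_sub (hint s hs (hcs _)) (hint s hs (hcs _)), ← integral_const_mul,
      ← integral_add hsub ((hint s hs hcd).const_mul _)]
    have := norm_integral_le_of_norm_le_const (μ := (m s : Measure ℝ))
      (f := fun x => ψ (x - γ s) - ψ (x - γ t) + (γ s - γ t) * deriv ψ (x - γ t))
      (C := C * |γ s - γ t| * |γ s - γ t|) (Eventually.of_forall fun x => by
        have := htaylor (x - γ t) (γ s - γ t)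
        rwa [show x - γ t - (γ s - γ t) = x - γ s by ring] at this)
    simpa [mul_assoc] using this
  have h5 := (h4.add h1).sub h3
  have hval : 0 + ∫ x, deriv (fun x => ψ (x - γ t)) x * v t x ∂(m t : Measure ℝ)
      - (c * ∫ x, deriv ψ (x - γ t) ∂(m t : Measure ℝ) + (γ t - γ t) *
        ∫ x, deriv (fun x => deriv ψ (x - γ t)) x * v t x ∂(m t : Measure ℝ))
      = ∫ x, deriv ψ (x - γ t) * (v t x - c) ∂(m t : Measure ℝ) := by
    have hcd : Continuous fun x => deriv ψ (x - γ t) := hψ'c.comp (by fun_prop)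
    have hmul : Integrable (fun x => deriv ψ (x - γ t) * v t x) (m t : Measure ℝ) :=
      hint t ht (hcd.mul (hvc t ht))
    rw [sub_self, zero_mul, add_zero, zero_add, ← integral_const_mul,
      show (fun x => deriv (fun x => ψ (x - γ t)) x * v t x)
        = fun x => deriv ψ (x - γ t) * v t x from funext fun x => by rw [deriv_comp_sub_const],
      ← integral_sub hmul ((hint t ht hcd).const_mul _)]
    congr 1
    ext x
    ring
  rw [hval] at h5
  refine h5.congr_of_eventuallyEq (Eventually.of_forall fun s => ?_) ?_
  · simp only [Pi.add_apply, Pi.sub_apply, Pi.mul_apply]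
    ring
  · simp only [Pi.add_apply, Pi.sub_apply, Pi.mul_apply]
    ring

theorem deriv_smoothTransition_eq_zero {x : ℝ} (hx : x ≤ 0 ∨ 1 ≤ x) :
    deriv Real.smoothTransition x = 0 := by
  rcases hx with hx | hx
  · refine IsLocalMin.deriv_eq_zero (Eventually.of_forall fun y => ?_)
    rw [Real.smoothTransition.zero_of_nonpos hx]
    exact Real.smoothTransition.nonneg y
  · refine IsLocalMax.deriv_eq_zero (Eventually.of_forall fun y => ?_)
    rw [Real.smoothTransition.one_of_one_le hx]
    exact Real.smoothTransition.le_one y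

theorem contDiff_smoothTransition : ContDiff ℝ ∞ Real.smoothTransition :=
  Real.smoothTransition.contDiff

theorem exists_deriv_smoothTransition_bound :
    ∃ C : ℝ, 0 ≤ C ∧ (∀ x, |deriv Real.smoothTransition x| ≤ C) ∧
      ∀ x y, |deriv Real.smoothTransition x - deriv Real.smoothTransition y| ≤ C * |x - y| := by
  have h1 : ContDiff ℝ ∞ (deriv Real.smoothTransition) :=
    (contDiff_infty_iff_deriv.1 contDiff_smoothTransition).2
  have h2 : Continuous (deriv (deriv Real.smoothTransition)) := h1.continuous_deriv (by simp)
  have hzero : ∀ x, x ∉ Icc (0 : ℝ) 1 → deriv Real.smoothTransition x = 0 := by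
    intro x hx
    apply deriv_smoothTransition_eq_zero
    by_contra! hcon
    exact hx ⟨hcon.1.le, hcon.2.le⟩
  have hsupp : HasCompactSupport (deriv Real.smoothTransition) :=
    HasCompactSupport.intro isCompact_Icc hzero
  obtain ⟨C₁, hC₁⟩ := hsupp.exists_bound_of_continuous h1.continuous
  obtain ⟨C₂, hC₂⟩ := hsupp.deriv.exists_bound_of_continuous h2
  have h0 : 0 ≤ C₁ := (norm_nonneg _).trans (hC₁ 0)
  have h0' : 0 ≤ C₂ := (norm_nonneg _).trans (hC₂ 0)
  refine ⟨C₁ + C₂, by positivity, fun x => (hC₁ x).trans (by linarith), fun x y => ?_⟩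
  have := convex_univ.norm_image_sub_le_of_norm_deriv_le
    (fun z _ => h1.differentiable (by simp) z) (fun z _ => hC₂ z) (mem_univ y) (mem_univ x)
  refine this.trans (mul_le_mul_of_nonneg_right (by linarith) (norm_nonneg _))

/-- The mass to the right of a characteristic is constant in time. -/
theorem measureReal_Ioi_eq_of_integralCurve {T R : ℝ} {m : ℝ → ProbabilityMeasure ℝ}
    {v : ℝ → ℝ → ℝ} {L : ℝ≥0} (hm : ∀ t ∈ Icc 0 T, SupportedIn R (m t))
    (hv : ∀ t ∈ Icc 0 T, LipschitzWith L (v t))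
    (hweak : ∀ ψ : ℝ → ℝ, ContDiff ℝ ∞ ψ → HasCompactSupport ψ → ∀ t ∈ Icc 0 T,
      HasDerivWithinAt (fun s => ∫ x, ψ x ∂(m s : Measure ℝ))
        (∫ x, deriv ψ x * v t x ∂(m t : Measure ℝ)) (Icc 0 T) t)
    {γ : ℝ → ℝ} (hγ : ∀ t ∈ Icc 0 T, HasDerivWithinAt γ (v t (γ t)) (Icc 0 T) t)
    {t : ℝ} (ht : t ∈ Icc 0 T) :
    (m t : Measure ℝ).real (Ioi (γ t)) = (m 0 : Measure ℝ).real (Ioi (γ 0)) := by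
  obtain ⟨C, hC0, hC, hC'⟩ := exists_deriv_smoothTransition_bound
  -- `S k` rises from 0 to 1 on `[0, 1 / (k + 1)]` and tends to the indicator of `(0, ∞)`.
  set S : ℕ → ℝ → ℝ := fun k y => Real.smoothTransition (((k : ℝ) + 1) * y) with hS
  have hSs : ∀ k, ContDiff ℝ ∞ (S k) := fun k =>
    contDiff_smoothTransition.comp (contDiff_const.mul contDiff_id)
  have hSd : ∀ k y, deriv (S k) y = ((k : ℝ) + 1) * deriv Real.smoothTransition (((k : ℝ) + 1) * y) :=
    fun k y => by
      have := deriv_comp_mul_left ((k : ℝ) + 1) Real.smoothTransition y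
      simpa [hS] using this
  have hSlip : ∀ k x y, |deriv (S k) x - deriv (S k) y| ≤ ((k : ℝ) + 1) * C * ((k : ℝ) + 1) * |x - y| := by
    intro k x y
    rw [hSd, hSd, ← mul_sub, abs_mul, abs_of_pos (by positivity : (0 : ℝ) < (k : ℝ) + 1)]
    have := hC' (((k : ℝ) + 1) * x) (((k : ℝ) + 1) * y)
    rw [← mul_sub, abs_mul, abs_of_pos (by positivity : (0 : ℝ) < (k : ℝ) + 1)] at this
    calc _ ≤ ((k : ℝ) + 1) * (C * (((k : ℝ) + 1) * |x - y|)) :=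
          mul_le_mul_of_nonneg_left this (by positivity)
      _ = _ := by ring
  -- the derivative of the smoothed mass
  set A : ℕ → ℝ → ℝ := fun k s => ∫ x, S k (x - γ s) ∂(m s : Measure ℝ) with hA
  set B : ℕ → ℝ → ℝ := fun k s =>
    ∫ x, deriv (S k) (x - γ s) * (v s x - v s (γ s)) ∂(m s : Measure ℝ) with hB
  have hder : ∀ k, ∀ s ∈ Icc 0 T, HasDerivWithinAt (A k) (B k s) (Icc 0 T) s := fun k s hs =>
    hasDerivWithinAt_integral_sub hm (fun t ht => (hv t ht).continuous) hweak hs (hγ s hs) (hSs k)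
      (hSlip k)
  -- The slope of `S k` is `O(k + 1)`, but it is nonzero only within `1 / (k + 1)` of the
  -- characteristic, where the relative velocity is at most `L / (k + 1)`. The product stays
  -- bounded, and it vanishes pointwise in the limit because the intervals `(γ s, γ s + 1 / (k +
  -- 1))` shrink to the empty set.
  have hpt : ∀ k, ∀ s ∈ Icc 0 T, ∀ x,
      ‖deriv (S k) (x - γ s) * (v s x - v s (γ s))‖ ≤ C * L ∧
      (x ∉ Ioo (γ s) (γ s + 1 / ((k : ℝ) + 1)) →
        deriv (S k) (x - γ s) * (v s x - v s (γ s)) = 0) := by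
    intro k s hs x
    have hk : (0 : ℝ) < (k : ℝ) + 1 := by positivity
    have hzero : x ∉ Ioo (γ s) (γ s + 1 / ((k : ℝ) + 1)) → deriv (S k) (x - γ s) = 0 := by
      intro hx
      rw [hSd, deriv_smoothTransition_eq_zero, mul_zero]
      by_contra! hcon
      refine hx ⟨by linarith [(mul_pos_iff_of_pos_left hk).1 hcon.1], ?_⟩
      have : x - γ s < 1 / ((k : ℝ) + 1) := by
        rw [lt_div_iff₀ hk, mul_comm]
        exact hcon.2
      linarith
    refine ⟨?_, fun hx => by rw [hzero hx, zero_mul]⟩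
    by_cases hx : x ∈ Ioo (γ s) (γ s + 1 / ((k : ℝ) + 1))
    · rw [norm_mul, hSd, norm_mul, Real.norm_of_nonneg hk.le]
      have h1 := (hv s hs).dist_le_mul x (γ s)
      rw [dist_eq_norm, Real.dist_eq, abs_of_pos (by linarith [hx.1])] at h1
      have h2 : ((k : ℝ) + 1) * (x - γ s) ≤ 1 := by
        have : x - γ s < 1 / ((k : ℝ) + 1) := by linarith [hx.2]
        rw [lt_div_iff₀ hk, mul_comm] at this
        exact this.le
      calc _ ≤ ((k : ℝ) + 1) * C * (L * (x - γ s)) :=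
            mul_le_mul (mul_le_mul_of_nonneg_left (hC _) hk.le) h1 (norm_nonneg _) (by positivity)
        _ = C * L * (((k : ℝ) + 1) * (x - γ s)) := by ring
        _ ≤ C * L * 1 := mul_le_mul_of_nonneg_left h2 (by positivity)
        _ = C * L := mul_one _
    · rw [hzero hx, zero_mul, norm_zero]
      positivity
  have hBbound : ∀ k, ∀ s ∈ Icc 0 T, ‖B k s‖ ≤ C * L := by
    intro k s hs
    have := norm_integral_le_of_norm_le_const (μ := (m s : Measure ℝ))
      (Eventually.of_forall fun x => (hpt k s hs x).1)
    simpa using this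
  have hBlim : ∀ s ∈ Icc 0 T, Tendsto (fun k => B k s) atTop (𝓝 0) := by
    intro s hs
    have h0 : ∫ _x, (0 : ℝ) ∂(m s : Measure ℝ) = 0 := integral_zero _ _
    rw [← h0]
    refine tendsto_integral_of_dominated_convergence (fun _ => C * L) (fun k => ?_)
      (integrable_const _) (fun k => Eventually.of_forall fun x => (hpt k s hs x).1)
      (Eventually.of_forall fun x => ?_)
    · have h1 : Continuous (deriv (S k)) := (hSs k).continuous_deriv (by simp)
      have h2 := (hv s hs).continuous
      exact Continuous.aestronglyMeasurable (by fun_prop)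
    · refine tendsto_const_nhds.congr' ?_
      rcases le_or_gt x (γ s) with hx | hx
      · exact Eventually.of_forall fun k => ((hpt k s hs x).2 fun h => not_lt.2 hx h.1).symm
      · have h1 := tendsto_one_div_add_atTop_nhds_zero_nat (𝕜 := ℝ)
        filter_upwards [h1.eventually (gt_mem_nhds (sub_pos.2 hx))] with k hk
        exact ((hpt k s hs x).2 fun h => by linarith [h.2]).symm
  have hAlim : ∀ s, Tendsto (fun k => A k s) atTop (𝓝 ((m s : Measure ℝ).real (Ioi (γ s)))) := by
    intro s
    rw [← integral_indicator_one measurableSet_Ioi]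
    refine tendsto_integral_of_dominated_convergence (fun _ => 1) (fun k => ?_)
      (integrable_const _) (fun k => Eventually.of_forall fun x => ?_)
      (Eventually.of_forall fun x => ?_)
    · have h1 := (hSs k).continuous
      exact Continuous.aestronglyMeasurable (by fun_prop)
    · rw [Real.norm_of_nonneg (Real.smoothTransition.nonneg _)]
      exact Real.smoothTransition.le_one _
    · refine tendsto_const_nhds.congr' ?_
      rcases le_or_gt x (γ s) with hx | hx
      · refine Eventually.of_forall fun k => ?_
        have hx' : x ∉ Ioi (γ s) := not_lt.2 hx
        rw [indicator_of_notMem hx']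
        exact (Real.smoothTransition.zero_of_nonpos
          (mul_nonpos_of_nonneg_of_nonpos (by positivity) (by linarith))).symm
      · have h1 := tendsto_one_div_add_atTop_nhds_zero_nat (𝕜 := ℝ)
        filter_upwards [h1.eventually (gt_mem_nhds (sub_pos.2 hx))] with k hk
        rw [indicator_of_mem (mem_Ioi.2 hx)]
        refine (Real.smoothTransition.one_of_one_le ?_).symm
        rw [div_lt_iff₀ (by positivity), mul_comm] at hk
        exact hk.le
  have hsub : Icc 0 t ⊆ Icc 0 T := Icc_subset_Icc_right ht.2
  have hderiv : ∀ k, ∀ s ∈ Ioo 0 t, HasDerivAt (A k) (B k s) s := fun k s hs =>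
    (hder k s (hsub (Ioo_subset_Icc_self hs))).hasDerivAt
      (Icc_mem_nhds hs.1 (hs.2.trans_le ht.2))
  have hae : ∀ᵐ s : ℝ, s ∈ uIoc 0 t → s ∈ Ioo 0 t := by
    have : ∀ᵐ s : ℝ, s ≠ t := compl_mem_ae_iff.2 (measure_singleton t)
    filter_upwards [this] with s hs hs'
    rw [uIoc_of_le ht.1] at hs'
    exact ⟨hs'.1, lt_of_le_of_ne hs'.2 hs⟩
  -- Integrating `deriv (A k)` in place of `B k` gives measurability in time for free; the two agree
  -- inside the interval.
  have hint : ∀ k, IntervalIntegrable (deriv (A k)) volume 0 t := by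
    intro k
    refine (intervalIntegrable_const (c := C * L)).mono_fun (aestronglyMeasurable_deriv _ _) ?_
    refine (ae_restrict_iff' measurableSet_uIoc).2 ?_
    filter_upwards [hae] with s hs hs'
    rw [(hderiv k s (hs hs')).deriv]
    exact (hBbound k s (hsub (Ioo_subset_Icc_self (hs hs')))).trans (le_abs_self _)
  have hftc : ∀ k, ∫ s in (0 : ℝ)..t, deriv (A k) s = A k t - A k 0 := fun k =>
    intervalIntegral.integral_eq_sub_of_hasDeriv_right_of_le ht.1
      (fun s hs => ((hder k s (hsub hs)).mono hsub).continuousWithinAt)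
      (fun s hs => by
        rw [(hderiv k s hs).deriv]
        exact (hderiv k s hs).hasDerivWithinAt) (hint k)
  have hlim : Tendsto (fun k => ∫ s in (0 : ℝ)..t, deriv (A k) s) atTop
      (𝓝 (∫ _s in (0 : ℝ)..t, (0 : ℝ))) := by
    refine intervalIntegral.tendsto_integral_filter_of_dominated_convergence (fun _ => C * L)
      (Eventually.of_forall fun k => aestronglyMeasurable_deriv _ _)
      (Eventually.of_forall fun k => ?_) (by simp) ?_
    · filter_upwards [hae] with s hs hs'
      rw [(hderiv k s (hs hs')).deriv]
      exact hBbound k s (hsub (Ioo_subset_Icc_self (hs hs')))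
    · filter_upwards [hae] with s hs hs'
      refine (hBlim s (hsub (Ioo_subset_Icc_self (hs hs')))).congr fun k => ?_
      rw [(hderiv k s (hs hs')).deriv]
  have h1 := tendsto_nhds_unique (hlim.congr hftc) ((hAlim t).sub (hAlim 0))
  rw [intervalIntegral.integral_zero] at h1
  linarith

theorem measureReal_Iic_eq_of_integralCurve {T R : ℝ} {m : ℝ → ProbabilityMeasure ℝ}
    {v : ℝ → ℝ → ℝ} {L : ℝ≥0} (hm : ∀ t ∈ Icc 0 T, SupportedIn R (m t))
    (hv : ∀ t ∈ Icc 0 T, LipschitzWith L (v t))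
    (hweak : ∀ ψ : ℝ → ℝ, ContDiff ℝ ∞ ψ → HasCompactSupport ψ → ∀ t ∈ Icc 0 T,
      HasDerivWithinAt (fun s => ∫ x, ψ x ∂(m s : Measure ℝ))
        (∫ x, deriv ψ x * v t x ∂(m t : Measure ℝ)) (Icc 0 T) t)
    {γ : ℝ → ℝ} (hγ : ∀ t ∈ Icc 0 T, HasDerivWithinAt γ (v t (γ t)) (Icc 0 T) t)
    {t : ℝ} (ht : t ∈ Icc 0 T) :
    (m t : Measure ℝ).real (Iic (γ t)) = (m 0 : Measure ℝ).real (Iic (γ 0)) := by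
  have h1 := measureReal_Ioi_eq_of_integralCurve hm hv hweak hγ ht
  have h2 := probReal_add_probReal_compl (μ := (m t : Measure ℝ)) (measurableSet_Iic (a := γ t))
  have h3 := probReal_add_probReal_compl (μ := (m 0 : Measure ℝ)) (measurableSet_Iic (a := γ 0))
  rw [compl_Iic] at h2 h3
  linarith

/-- Stability of characteristics under a perturbation of the velocity. -/
theorem abs_sub_le_of_integralCurve {T : ℝ} {v v' : ℝ → ℝ → ℝ} {L : ℝ≥0} {E : ℝ} (hE : 0 < E)
    (hv : ∀ t ∈ Icc 0 T, LipschitzWith L (v t))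
    (hvv' : ∀ t ∈ Icc 0 T, ∀ x, |v t x - v' t x| ≤ L * (E * Real.exp ((4 * L + 1) * t)))
    {γ γ' : ℝ → ℝ} (hγ : ∀ t ∈ Icc 0 T, HasDerivWithinAt γ (v t (γ t)) (Icc 0 T) t)
    (hγ' : ∀ t ∈ Icc 0 T, HasDerivWithinAt γ' (v' t (γ' t)) (Icc 0 T) t) (h0 : γ 0 = γ' 0)
    {t : ℝ} (ht : t ∈ Icc 0 T) : |γ t - γ' t| ≤ E / 2 * Real.exp ((4 * L + 1) * t) := by
  have hB : ∀ s : ℝ, HasDerivAt (fun s => E / 2 * Real.exp ((4 * L + 1) * s))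
      (E / 2 * (Real.exp ((4 * L + 1) * s) * ((4 * L + 1) * 1))) s := fun s =>
    (((hasDerivAt_id s).const_mul (4 * (L : ℝ) + 1)).exp).const_mul _
  refine image_norm_le_of_norm_deriv_right_lt_deriv_boundary (f := fun s => γ s - γ' s)
    (fun s hs => ((hγ s hs).sub (hγ' s hs)).continuousWithinAt)
    (fun s hs => ((hγ s (Ico_subset_Icc_self hs)).sub
      (hγ' s (Ico_subset_Icc_self hs))).mono_of_mem_nhdsWithin (Icc_mem_nhdsGE_of_mem hs))
    ?_ hB (fun s hs hs' => ?_) ht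
  · rw [h0, sub_self, norm_zero]
    positivity
  · have hsT := Ico_subset_Icc_self hs
    have h1 := (hv s hsT).dist_le_mul (γ s) (γ' s)
    rw [Real.dist_eq, Real.dist_eq] at h1
    have h2 := hvv' s hsT (γ' s)
    have h3 := abs_add_le (v s (γ s) - v s (γ' s)) (v s (γ' s) - v' s (γ' s))
    rw [sub_add_sub_cancel] at h3
    rw [Real.norm_eq_abs] at hs' ⊢
    -- Where the curves are exactly `E / 2 * exp` apart, their distance grows at a rate of at most
    -- `L E / 2 + L E = 3 L E / 2` times the exponential, strictly less than the growth `(4 L + 1) E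
    -- / 2` of the barrier.
    rw [hs'] at h1
    have hexp := Real.exp_pos ((4 * L + 1) * s)
    have hL : (0 : ℝ) ≤ L := L.2
    have hEe := mul_pos hE hexp
    nlinarith [mul_nonneg hL hEe.le]

/-- Comparison of the distribution functions of the solutions of two continuity equations with the
same initial value. -/
theorem measureReal_Iic_le_of_velocity_le {T R : ℝ} {m m' : ℝ → ProbabilityMeasure ℝ}
    {v v' : ℝ → ℝ → ℝ} {L : ℝ≥0} {E V : ℝ} (hE : 0 < E)
    (hm : ∀ t ∈ Icc 0 T, SupportedIn R (m t)) (hm' : ∀ t ∈ Icc 0 T, SupportedIn R (m' t))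
    (hv : ∀ t ∈ Icc 0 T, LipschitzWith L (v t)) (hv' : ∀ t ∈ Icc 0 T, LipschitzWith L (v' t))
    (hvc : ∀ x, ContinuousOn (fun t => v t x) (Icc 0 T))
    (hvc' : ∀ x, ContinuousOn (fun t => v' t x) (Icc 0 T))
    (hV : ∀ t ∈ Icc 0 T, ∀ x, |v t x| ≤ V) (hV' : ∀ t ∈ Icc 0 T, ∀ x, |v' t x| ≤ V)
    (hweak : ∀ ψ : ℝ → ℝ, ContDiff ℝ ∞ ψ → HasCompactSupport ψ → ∀ t ∈ Icc 0 T,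
      HasDerivWithinAt (fun s => ∫ x, ψ x ∂(m s : Measure ℝ))
        (∫ x, deriv ψ x * v t x ∂(m t : Measure ℝ)) (Icc 0 T) t)
    (hweak' : ∀ ψ : ℝ → ℝ, ContDiff ℝ ∞ ψ → HasCompactSupport ψ → ∀ t ∈ Icc 0 T,
      HasDerivWithinAt (fun s => ∫ x, ψ x ∂(m' s : Measure ℝ))
        (∫ x, deriv ψ x * v' t x ∂(m' t : Measure ℝ)) (Icc 0 T) t)
    (h0 : m 0 = m' 0)
    (hvv' : ∀ t ∈ Icc 0 T, ∀ x, |v t x - v' t x| ≤ L * (E * Real.exp ((4 * L + 1) * t)))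
    {t : ℝ} (ht : t ∈ Icc 0 T) (z : ℝ) :
    (m t : Measure ℝ).real (Iic z)
      ≤ (m' t : Measure ℝ).real (Iic (z + E / 2 * Real.exp ((4 * L + 1) * t))) := by
  -- The `v`-characteristic through `(t, z)` is traced back to time 0, and the `v'`-characteristic
  -- is followed from the same starting point. Each conserves the mass to its left, and the initial
  -- measures agree.
  obtain ⟨γ, hγt, hγ⟩ := exists_integralCurve hv hvc hV ht z
  obtain ⟨γ', hγ0, hγ'⟩ := exists_integralCurve hv' hvc' hV'
    (⟨le_rfl, ht.1.trans ht.2⟩ : (0 : ℝ) ∈ Icc 0 T) (γ 0)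
  have h1 := abs_sub_le_of_integralCurve hE hv hvv' hγ hγ' hγ0.symm ht
  have h2 := measureReal_Iic_eq_of_integralCurve hm hv hweak hγ ht
  have h3 := measureReal_Iic_eq_of_integralCurve hm' hv' hweak' hγ' ht
  rw [← hγt, h2, h0, ← hγ0, ← h3]
  refine measureReal_mono (Iic_subset_Iic.2 ?_)
  linarith [(abs_le.1 h1).1]

theorem eq_of_d1_eq_zero {m m' : ProbabilityMeasure ℝ} (h : d1 m m' = 0) : m = m' := by
  have h1 : Tendsto (fun _ : ℕ => m) atTop (𝓝 m') :=
    tendsto_of_tendsto_d1 (by simp only [h]; exact tendsto_const_nhds)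
  exact tendsto_nhds_unique tendsto_const_nhds h1

/-- If `d1 (m t) (m' t)` is at most `E * exp ((4 L + 1) t)`, the velocities differ by at most `L`
times this, and comparison of characteristics improves the bound to `E / 2 * exp ((4 L + 1) t)`. The
iteration starts at `E = 2 R`. -/
theorem IsWeakSolution.unique {T : ℝ} {a : ℝ → ℝ} (ha : ContinuousOn a (Icc 0 T))
    (ha_pos : ∀ t ∈ Icc 0 T, 0 < a t) {f g : ∀ n : ℕ, ℝ → (Fin n → ℝ) → ℝ}
    {fbar hbar : ℝ → ProbabilityMeasure ℝ → ℝ} (hf : IsMeanFieldLimit f fbar)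
    (hg : IsMeanFieldLimit g fun x m => deriv (fun y => hbar y m) x)
    (hfL : LocallyEquiLipschitz f) (hgL : LocallyEquiLipschitz g)
    {mbar : ProbabilityMeasure ℝ} {m m' : ℝ → ProbabilityMeasure ℝ}
    (hm : IsWeakSolution T a fbar hbar mbar m) (hm' : IsWeakSolution T a fbar hbar mbar m')
    {t : ℝ} (ht : t ∈ Icc 0 T) : m t = m' t := by
  obtain ⟨R₁, hR₁⟩ := hm.support
  obtain ⟨R₂, hR₂⟩ := hm'.support
  set R := |R₁| + |R₂| + 1 with hR
  have hR0 : 0 < R := by positivity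
  have hsupp : ∀ t ∈ Icc 0 T, SupportedIn R (m t) := fun t ht =>
    (hR₁ t ht).mono (by linarith [le_abs_self R₁, abs_nonneg R₂])
  have hsupp' : ∀ t ∈ Icc 0 T, SupportedIn R (m' t) := fun t ht =>
    (hR₂ t ht).mono (by linarith [le_abs_self R₂, abs_nonneg R₁])
  have hRR : -R ≤ R := by linarith
  obtain ⟨Lf, hLf0, hLf⟩ := hf.exists_lipschitz hfL hR0
  obtain ⟨Lg, hLg0, hLg⟩ := hg.exists_lipschitz hgL hR0
  have hinv : ContinuousOn (fun t => 1 / a t) (Icc 0 T) :=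
    ContinuousOn.div continuousOn_const ha fun t ht => (ha_pos t ht).ne'
  obtain ⟨A, hA⟩ := isCompact_Icc.exists_bound_of_continuousOn hinv
  have hA0 : 0 ≤ A := (norm_nonneg _).trans (hA t ht)
  let L : ℝ≥0 := ⟨Lf + A * Lg, by positivity⟩
  have hLcoe : (L : ℝ) = Lf + A * Lg := rfl
  have hvel : ∀ t ∈ Icc 0 T, ∀ (x x' : ℝ) (μ μ' : ProbabilityMeasure ℝ), |x| ≤ R → |x'| ≤ R →
      SupportedIn R μ → SupportedIn R μ' →
      |velocity (a t) fbar hbar μ x - velocity (a t) fbar hbar μ' x'|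
        ≤ L * (|x - x'| + (d1 μ μ').toReal) := by
    intro t ht x x' μ μ' hx hx' hμ hμ'
    have h1 := hLf x x' μ μ' hx hx' hμ hμ'
    have h2 := hLg x x' μ μ' hx hx' hμ hμ'
    have h3 := hA t ht
    rw [Real.norm_eq_abs] at h3
    have h4 := mul_le_mul h3 h2 (abs_nonneg _) hA0
    rw [← abs_mul] at h4
    have h5 : velocity (a t) fbar hbar μ x - velocity (a t) fbar hbar μ' x'
        = (fbar x μ - fbar x' μ') - 1 / a t *
          (deriv (fun y => hbar y μ) x - deriv (fun y => hbar y μ') x') := by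
      simp only [velocity]
      ring
    rw [h5, hLcoe]
    refine (abs_sub _ _).trans ((add_le_add h1 h4).trans (le_of_eq ?_))
    ring
  -- Lipschitz bounds are available on `[-R, R]` only. Composing with the projection makes the
  -- velocity globally Lipschitz and bounded, and the weak equation does not notice it.
  set c : ℝ → ℝ := fun x => projIcc (-R) R hRR x with hc
  have hcR : ∀ x, |c x| ≤ R := fun x => abs_le.2 (projIcc (-R) R hRR x).2
  have hcL : ∀ x y, |c x - c y| ≤ |x - y| := fun x y => abs_projIcc_sub_projIcc hRR
  -- properties of the velocity field of a weak solution, frozen outside of `[-R, R]`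
  have hprop : ∀ μ : ℝ → ProbabilityMeasure ℝ, IsWeakSolution T a fbar hbar mbar μ →
      (∀ t ∈ Icc 0 T, SupportedIn R (μ t)) →
      (∀ t ∈ Icc 0 T, LipschitzWith L fun x => velocity (a t) fbar hbar (μ t) (c x)) ∧
      (∀ x, ContinuousOn (fun t => velocity (a t) fbar hbar (μ t) (c x)) (Icc 0 T)) ∧
      (∃ V, ∀ t ∈ Icc 0 T, ∀ x, |velocity (a t) fbar hbar (μ t) (c x)| ≤ V) ∧
      ∀ ψ : ℝ → ℝ, ContDiff ℝ ∞ ψ → HasCompactSupport ψ → ∀ t ∈ Icc 0 T,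
        HasDerivWithinAt (fun s => ∫ x, ψ x ∂(μ s : Measure ℝ))
          (∫ x, deriv ψ x * velocity (a t) fbar hbar (μ t) (c x) ∂(μ t : Measure ℝ)) (Icc 0 T) t := by
    intro μ hμ hμR
    have hlip : ∀ t ∈ Icc 0 T, ∀ x y, |velocity (a t) fbar hbar (μ t) (c x)
        - velocity (a t) fbar hbar (μ t) (c y)| ≤ L * |c x - c y| := by
      intro t ht x y
      have := hvel t ht (c x) (c y) (μ t) (μ t) (hcR x) (hcR y) (hμR t ht) (hμR t ht)
      rwa [d1_self, ENNReal.toReal_zero, add_zero] at this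
    have hcont : ∀ x, ContinuousOn (fun t => velocity (a t) fbar hbar (μ t) (c x)) (Icc 0 T) := by
      intro x
      have hp : ContinuousOn (fun t => (c x, μ t)) (Icc 0 T) :=
        continuousOn_const.prodMk hμ.continuousOn
      exact ((hf.continuousOn R hR0).comp hp hμR).sub
        (hinv.mul ((hg.continuousOn R hR0).comp hp hμR))
    refine ⟨fun t ht => LipschitzWith.of_dist_le_mul fun x y => ?_, hcont, ?_, ?_⟩
    · rw [Real.dist_eq, Real.dist_eq]
      exact (hlip t ht x y).trans (mul_le_mul_of_nonneg_left (hcL x y) L.2)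
    · obtain ⟨B, hB⟩ := isCompact_Icc.exists_bound_of_continuousOn (hcont 0)
      refine ⟨B + L * (R + R), fun t ht x => ?_⟩
      have h1 := hlip t ht x 0
      have h2 := hB t ht
      rw [Real.norm_eq_abs] at h2
      have h3 : |c x - c 0| ≤ R + R := (abs_sub _ _).trans (add_le_add (hcR x) (hcR 0))
      have h4 := mul_le_mul_of_nonneg_left h3 L.2
      have h5 := abs_add_le (velocity (a t) fbar hbar (μ t) (c x)
        - velocity (a t) fbar hbar (μ t) (c 0)) (velocity (a t) fbar hbar (μ t) (c 0))
      rw [sub_add_cancel] at h5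
      have h6 : (L : ℝ) * |c x - c 0| ≤ L * (R + R) := h4
      linarith
    · intro ψ hψ hψc t ht
      have h1 := hμ.weak ψ hψ hψc t ht
      rwa [integral_congr_ae ((hμR t ht).ae_mem.mono fun x hx => by
        show deriv ψ x * velocity (a t) fbar hbar (μ t) x
          = deriv ψ x * velocity (a t) fbar hbar (μ t) (c x)
        simp only [hc, projIcc_of_mem hRR hx])] at h1
  obtain ⟨hl, hct, ⟨V, hV⟩, hw⟩ := hprop m hm hsupp
  obtain ⟨hl', hct', ⟨V', hV'⟩, hw'⟩ := hprop m' hm' hsupp'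
  have h00 : m 0 = m' 0 := hm.init.trans hm'.init.symm
  have key : ∀ k : ℕ, ∀ t ∈ Icc 0 T,
      (d1 (m t) (m' t)).toReal ≤ 2 * R / 2 ^ k * Real.exp ((4 * L + 1) * t) := by
    intro k
    induction k with
    | zero =>
      intro t ht
      have h1 := ENNReal.toReal_mono ENNReal.ofReal_ne_top ((hsupp t ht).d1_le (hsupp' t ht))
      rw [ENNReal.toReal_ofReal (by positivity)] at h1
      have h2 : 1 ≤ Real.exp ((4 * L + 1) * t) :=
        Real.one_le_exp (mul_nonneg (by positivity) ht.1)
      rw [pow_zero, div_one]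
      nlinarith
    | succ k ih =>
      intro t ht
      have hE : 0 < 2 * R / 2 ^ k := by positivity
      have hvv : ∀ t ∈ Icc 0 T, ∀ x, |velocity (a t) fbar hbar (m t) (c x)
          - velocity (a t) fbar hbar (m' t) (c x)|
          ≤ L * (2 * R / 2 ^ k * Real.exp ((4 * L + 1) * t)) := by
        intro t ht x
        have h1 := hvel t ht (c x) (c x) (m t) (m' t) (hcR x) (hcR x) (hsupp t ht) (hsupp' t ht)
        rw [sub_self, abs_zero, zero_add] at h1
        exact h1.trans (mul_le_mul_of_nonneg_left (ih t ht) L.2)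
      have hmax : ∀ t ∈ Icc 0 T, ∀ x, |velocity (a t) fbar hbar (m t) (c x)| ≤ max V V' :=
        fun t ht x => (hV t ht x).trans (le_max_left _ _)
      have hmax' : ∀ t ∈ Icc 0 T, ∀ x, |velocity (a t) fbar hbar (m' t) (c x)| ≤ max V V' :=
        fun t ht x => (hV' t ht x).trans (le_max_right _ _)
      have h1 := (hsupp t ht).d1_le_of_Iic_le (hsupp' t ht)
        (measureReal_Iic_le_of_velocity_le hE hsupp hsupp' hl hl' hct hct' hmax hmax' hw hw'
          h00 hvv ht)
        (measureReal_Iic_le_of_velocity_le hE hsupp' hsupp hl' hl hct' hct hmax' hmax hw' hw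
          h00.symm (fun t ht x => by rw [abs_sub_comm]; exact hvv t ht x) ht)
      have h2 := ENNReal.toReal_mono ENNReal.ofReal_ne_top h1
      rw [ENNReal.toReal_ofReal (by positivity)] at h2
      refine h2.trans (le_of_eq ?_)
      rw [pow_succ, div_div]
  have hlim : Tendsto (fun k : ℕ => 2 * R / 2 ^ k * Real.exp ((4 * L + 1) * t)) atTop (𝓝 0) := by
    have h1 := (tendsto_pow_atTop_nhds_zero_of_lt_one (r := (1 / 2 : ℝ)) (by norm_num)
      (by norm_num)).const_mul (2 * R) |>.mul_const (Real.exp ((4 * L + 1) * t))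
    rw [mul_zero, zero_mul] at h1
    refine h1.congr fun k => ?_
    rw [one_div, inv_pow, div_eq_mul_inv]
  have h1 := ge_of_tendsto' hlim fun k => key k t ht
  refine eq_of_d1_eq_zero ?_
  have h2 := le_antisymm h1 ENNReal.toReal_nonneg
  rcases (ENNReal.toReal_eq_zero_iff _).1 h2 with h3 | h3
  · exact h3
  · exact absurd h3 (d1_ne_top (hsupp t ht) (hsupp' t ht))

end ContinuityEquation

/-! ### The one-step minimization problem. -/

/-- The sign conditions and monotonicity leave `p` a single zero, before which `J` strictly
decreases and after which it strictly increases. Monotonicity is asked on a compact interval only,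
where a Lipschitz constant of `∂_ξ h` will be at hand. -/
theorem exists_unique_isMinOn_of_deriv {J p : ℝ → ℝ} {κ U : ℝ} (hκ : 0 < κ) (hU : 0 < U)
    (hJ : ∀ u, HasDerivAt J (κ * p u) u) (hp : Continuous p) (hmono : StrictMonoOn p (Icc (-U) U))
    (hpos : ∀ u, U ≤ u → 0 < p u) (hneg : ∀ u, u ≤ -U → p u < 0) :
    ∃ v, |v| ≤ U ∧ p v = 0 ∧ IsMinOn J univ v ∧ ∀ v', IsMinOn J univ v' → v' = v := by
  obtain ⟨v, hv, hv0⟩ := intermediate_value_Icc (by linarith : -U ≤ U) hp.continuousOn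
    (show (0 : ℝ) ∈ Icc (p (-U)) (p U) from ⟨(hneg _ le_rfl).le, (hpos _ le_rfl).le⟩)
  have hJc : Continuous J := continuous_iff_continuousAt.2 fun u => (hJ u).continuousAt
  have hgt : ∀ u, v < u → 0 < p u := by
    intro u hu
    rcases le_total U u with h | h
    · exact hpos u h
    · rw [← hv0]
      exact hmono hv ⟨by linarith [hv.1], h⟩ hu
  have hlt : ∀ u, u < v → p u < 0 := by
    intro u hu
    rcases le_total u (-U) with h | h
    · exact hneg u h
    · rw [← hv0]
      exact hmono ⟨h, by linarith [hv.2]⟩ hv hu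
  have h1 : StrictMonoOn J (Ici v) := strictMonoOn_of_deriv_pos (convex_Ici v) hJc.continuousOn
    fun u hu => by
      rw [interior_Ici] at hu
      rw [(hJ u).deriv]
      exact mul_pos hκ (hgt u hu)
  have h2 : StrictAntiOn J (Iic v) := strictAntiOn_of_deriv_neg (convex_Iic v) hJc.continuousOn
    fun u hu => by
      rw [interior_Iic] at hu
      rw [(hJ u).deriv]
      exact mul_neg_of_pos_of_neg hκ (hlt u hu)
  have h3 : ∀ u, u ≠ v → J v < J u := by
    intro u hu
    rcases lt_or_gt_of_ne hu with h | h
    · exact h2 (mem_Iic.2 h.le) self_mem_Iic h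
    · exact h1 self_mem_Ici (mem_Ici.2 h.le) h
  refine ⟨v, abs_le.2 hv, hv0, fun u _ => ?_, fun v' hv' => ?_⟩
  · rcases eq_or_ne u v with rfl | h
    · exact le_refl (J u)
    · exact (h3 u h).le
  · by_contra h
    exact absurd (hv' (mem_univ v)) (not_le.2 (h3 v' h))

theorem exists_lipschitz_of_contDiff {n : ℕ} {g : ℝ → (Fin n → ℝ) → ℝ}
    (hg : ContDiff ℝ ∞ fun q : ℝ × (Fin n → ℝ) => g q.1 q.2) (R : ℝ) :
    ∃ Λ ≥ 0, ∀ (ξ ξ' : ℝ) (Y Y' : Fin n → ℝ), |ξ| ≤ R → |ξ'| ≤ R → ‖Y‖ ≤ R → ‖Y'‖ ≤ R →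
      |g ξ Y - g ξ' Y'| ≤ Λ * max |ξ - ξ'| ‖Y - Y'‖ := by
  obtain ⟨Λ, hΛ⟩ := (isCompact_closedBall (0 : ℝ × (Fin n → ℝ)) R).exists_bound_of_continuousOn
    (hg.continuous_fderiv (by simp)).continuousOn
  have hmem : ∀ (ξ : ℝ) (Y : Fin n → ℝ), |ξ| ≤ R → ‖Y‖ ≤ R →
      (ξ, Y) ∈ Metric.closedBall (0 : ℝ × (Fin n → ℝ)) R := by
    intro ξ Y hξ hY
    rw [mem_closedBall_zero_iff]
    exact max_le hξ hY
  refine ⟨|Λ|, abs_nonneg _, fun ξ ξ' Y Y' hξ hξ' hY hY' => ?_⟩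
  have := (convex_closedBall (0 : ℝ × (Fin n → ℝ)) R).norm_image_sub_le_of_norm_fderiv_le
    (fun q _ => hg.differentiable (by simp) q) (fun q hq => (hΛ q hq).trans (le_abs_self Λ))
    (hmem ξ' Y' hξ' hY') (hmem ξ Y hξ hY)
  exact this

/-- For small time steps, the one-step problem has exactly one minimizer, and it is close to the
instantaneous control. -/
theorem exists_oneStep_bound {n : ℕ} {h : ℝ → (Fin n → ℝ) → ℝ}
    (hh : ContDiff ℝ ∞ fun q : ℝ × (Fin n → ℝ) => h q.1 q.2) {D : ℝ} (hD : 0 ≤ D)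
    (hgrow : ∀ ξ Y, |deriv (fun s => h s Y) ξ| ≤ D * (1 + |ξ| + ‖Y‖))
    {α₀ B W : ℝ} (hα₀ : 0 < α₀) (hB : 0 ≤ B) (hW : 0 ≤ W) :
    ∃ C : ℝ, ∃ Δ₀ > 0, ∀ Δt, 0 < Δt → Δt ≤ Δ₀ → ∀ α, α₀ ≤ α → ∀ (y b : ℝ) (Y Z : Fin n → ℝ),
      |y| ≤ B → ‖Y‖ ≤ B → |b| ≤ W → ‖Z - Y‖ ≤ Δt * W →
      ∃ v, IsMinOn (fun u => h (y + Δt * (b + u)) Z + Δt * (α / 2 * u ^ 2)) univ v ∧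
        (∀ v', IsMinOn (fun u => h (y + Δt * (b + u)) Z + Δt * (α / 2 * u ^ 2)) univ v' → v' = v) ∧
        |-(1 / α) * deriv (fun s => h s Y) y - v| ≤ C * Δt := by
  set g : ℝ → (Fin n → ℝ) → ℝ := fun ξ Y => deriv (fun s => h s Y) ξ with hg
  have hgs : ContDiff ℝ ∞ fun q : ℝ × (Fin n → ℝ) => g q.1 q.2 := contDiff_deriv_fst hh
  -- Chosen so that `α u` outweighs the linearly growing `∂_ξ h` for `|u| ≥ U`.
  set U : ℝ := 2 * (D * (1 + 2 * B + 2 * W)) / α₀ + 1 with hU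
  have hU0 : 0 < U := by positivity
  obtain ⟨Λ, hΛ0, hΛ⟩ := exists_lipschitz_of_contDiff hgs (B + W + U)
  -- This threshold gives `D Δt ≤ α₀ / 2`, for the sign of `p` outside `[-U, U]`, and `Λ Δt < α₀`,
  -- for strict monotonicity inside.
  refine ⟨Λ * (W + U) / α₀, min 1 (α₀ / (2 * (D + Λ + 1))), by positivity, ?_⟩
  intro Δt hΔ hΔ' α hα y b Y Z hy hY hb hZ
  have hΔ1 : Δt ≤ 1 := hΔ'.trans (min_le_left _ _)
  have hΔ2 : Δt * (2 * (D + Λ + 1)) ≤ α₀ := by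
    have := hΔ'.trans (min_le_right _ _)
    rwa [le_div_iff₀ (by positivity)] at this
  have hΔD : D * Δt ≤ α₀ / 2 := by nlinarith
  have hΔΛ : Λ * Δt < α₀ := by nlinarith
  have hα0 : 0 < α := hα₀.trans_le hα
  have hZY : ‖Z - Y‖ ≤ W := hZ.trans (by nlinarith)
  have hZn : ‖Z‖ ≤ B + W := by
    have := norm_add_le (Z - Y) Y
    rw [sub_add_cancel] at this
    linarith
  have hb' : Δt * |b| ≤ W := by nlinarith [abs_nonneg b]
  have harg : ∀ u, |y + Δt * (b + u)| ≤ B + W + Δt * |u| := by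
    intro u
    calc |y + Δt * (b + u)| ≤ |y| + Δt * |b + u| := by
          refine (abs_add_le _ _).trans (le_of_eq ?_)
          rw [abs_mul, abs_of_pos hΔ]
      _ ≤ |y| + Δt * (|b| + |u|) := by gcongr; exact abs_add_le _ _
      _ ≤ B + W + Δt * |u| := by linarith
  have hgb : ∀ u, |g (y + Δt * (b + u)) Z| ≤ D * (1 + 2 * B + 2 * W) + α₀ / 2 * |u| := by
    intro u
    refine (hgrow _ _).trans ?_
    have h1 : 1 + |y + Δt * (b + u)| + ‖Z‖ ≤ (1 + 2 * B + 2 * W) + Δt * |u| := by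
      linarith [harg u]
    have h2 := mul_le_mul_of_nonneg_left h1 hD
    have h3 := mul_le_mul_of_nonneg_right hΔD (abs_nonneg u)
    linarith
  have hUα : D * (1 + 2 * B + 2 * W) < α₀ / 2 * U := by
    rw [hU]
    field_simp
    linarith
  set p : ℝ → ℝ := fun u => g (y + Δt * (b + u)) Z + α * u with hp
  have hpc : Continuous p := by
    have : Continuous fun u : ℝ => ((y + Δt * (b + u), Z) : ℝ × (Fin n → ℝ)) := by fun_prop
    exact (hgs.continuous.comp this).add (continuous_const.mul continuous_id)
  have hder : ∀ u, HasDerivAt (fun u => h (y + Δt * (b + u)) Z + Δt * (α / 2 * u ^ 2))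
      (Δt * p u) u := by
    intro u
    have h1 : HasDerivAt (fun u => y + Δt * (b + u)) (Δt * 1) u :=
      (((hasDerivAt_id u).const_add b).const_mul Δt).const_add y
    have h2 : HasDerivAt (fun s => h s Z) (g (y + Δt * (b + u)) Z) (y + Δt * (b + u)) :=
      (hasDerivAt_fst_of_contDiff hh _ Z).differentiableAt.hasDerivAt
    have h3 := (h2.comp u h1).add ((((hasDerivAt_id u).pow 2).const_mul (α / 2)).const_mul Δt)
    refine h3.congr_deriv ?_
    simp only [hp, id]
    push_cast
    ring
  have hin : ∀ u, |u| ≤ U → |y + Δt * (b + u)| ≤ B + W + U := by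
    intro u hu
    refine (harg u).trans ?_
    nlinarith [abs_nonneg u]
  obtain ⟨v, hvU, hv0, hvmin, hvuniq⟩ := exists_unique_isMinOn_of_deriv hΔ hU0 hder hpc
    (fun u hu u' hu' huu' => by
      have h1 := hΛ _ _ Z Z (hin u (abs_le.2 hu)) (hin u' (abs_le.2 hu')) (by linarith) (by linarith)
      rw [sub_self, norm_zero, max_eq_left (abs_nonneg _)] at h1
      have h2 : y + Δt * (b + u) - (y + Δt * (b + u')) = Δt * (u - u') := by ring
      rw [h2, abs_mul, abs_of_pos hΔ, abs_of_neg (sub_neg.2 huu')] at h1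
      have h3 := (abs_le.1 h1).2
      have h4 : 0 < u' - u := sub_pos.2 huu'
      simp only [hp]
      nlinarith [mul_pos h4 (sub_pos.2 hΔΛ)])
    (fun u hu => by
      have h1 := (abs_le.1 (hgb u)).1
      rw [abs_of_pos (hU0.trans_le hu)] at h1
      simp only [hp]
      nlinarith)
    (fun u hu => by
      have h1 := (abs_le.1 (hgb u)).2
      rw [abs_of_neg (by linarith)] at h1
      simp only [hp]
      nlinarith)
  refine ⟨v, hvmin, hvuniq, ?_⟩
  have h1 := hΛ (y + Δt * (b + v)) y Z Y (hin v hvU) (by linarith) (by linarith) (by linarith)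
  have h2 : max |y + Δt * (b + v) - y| ‖Z - Y‖ ≤ (W + U) * Δt := by
    refine max_le ?_ (by nlinarith)
    rw [add_sub_cancel_left, abs_mul, abs_of_pos hΔ, mul_comm]
    exact mul_le_mul_of_nonneg_right ((abs_add_le b v).trans (add_le_add hb hvU)) hΔ.le
  -- Since `p v = 0`, the minimizer is the instantaneous control evaluated at the state after the
  -- step, which is within `(W + U) Δt` of the old one.
  have h3 : -(1 / α) * g y Y - v = (1 / α) * (g (y + Δt * (b + v)) Z - g y Y) := by
    have : v = -(1 / α) * g (y + Δt * (b + v)) Z := by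
      have : g (y + Δt * (b + v)) Z = -(α * v) := by
        simp only [hp] at hv0
        linarith
      rw [this]
      field_simp
    linear_combination -this
  rw [h3, abs_mul, abs_of_pos (by positivity)]
  have h4 : 1 / α ≤ 1 / α₀ := one_div_le_one_div_of_le hα₀ hα
  calc 1 / α * |g (y + Δt * (b + v)) Z - g y Y|
      ≤ 1 / α₀ * (Λ * ((W + U) * Δt)) :=
        mul_le_mul h4 (h1.trans (mul_le_mul_of_nonneg_left h2 hΛ0)) (abs_nonneg _) (by positivity)
    _ = Λ * (W + U) / α₀ * Δt := by ring

/-! ### The Euler scheme. -/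

theorem removeNth_update_self {n : ℕ} (X : Fin (n + 1) → ℝ) (i : Fin (n + 1)) (s : ℝ) :
    i.removeNth (Function.update X i s) = i.removeNth X := by
  ext j
  simp [Fin.removeNth]

theorem IsSymmetricFamily.partialDeriv_eq {H : ∀ n : ℕ, Fin (n + 1) → (Fin (n + 1) → ℝ) → ℝ}
    {h : ∀ n : ℕ, ℝ → (Fin n → ℝ) → ℝ} (hH : IsSymmetricFamily H h) (n : ℕ) (i : Fin (n + 1))
    (X : Fin (n + 1) → ℝ) :
    partialDeriv (H n i) i X = deriv (fun s => h n s (i.removeNth X)) (X i) := by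
  unfold partialDeriv
  congr 1
  ext s
  rw [hH.eq, removeNth_update_self, Function.update_self]

/-- Discrete Grönwall: one step multiplies `1 + 2 ‖x‖` by at most `1 + 2 K Δt ≤ exp (2 K Δt)`. -/
theorem norm_le_of_eulerStep {N : ℕ} {F : Fin N → (Fin N → ℝ) → ℝ} {K Δt : ℝ} (hK : 0 ≤ K)
    (hΔ : 0 < Δt) {k : ℕ} {x c : ℕ → Fin N → ℝ}
    (hx : ∀ ℓ < k, x (ℓ + 1) = eulerStep F Δt (x ℓ) (c ℓ))
    (hb : ∀ ℓ < k, ∀ i, |F i (x ℓ) + c ℓ i| ≤ K * (1 + 2 * ‖x ℓ‖)) :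
    ∀ ℓ ≤ k, 1 + 2 * ‖x ℓ‖ ≤ Real.exp (2 * K * (ℓ * Δt)) * (1 + 2 * ‖x 0‖) := by
  intro ℓ
  induction ℓ with
  | zero => simp
  | succ ℓ ih =>
    intro hℓ
    have h1 := ih (by omega)
    have h2 : ‖x (ℓ + 1)‖ ≤ ‖x ℓ‖ + Δt * (K * (1 + 2 * ‖x ℓ‖)) := by
      refine (pi_norm_le_iff_of_nonneg (by positivity)).2 fun i => ?_
      rw [hx ℓ hℓ, eulerStep]
      refine (norm_add_le _ _).trans (add_le_add (norm_le_pi_norm _ i) ?_)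
      rw [norm_mul, Real.norm_of_nonneg hΔ.le]
      exact mul_le_mul_of_nonneg_left (hb ℓ hℓ i) hΔ.le
    have h3 : 2 * K * Δt + 1 ≤ Real.exp (2 * K * Δt) := Real.add_one_le_exp _
    have h4 : 0 ≤ 1 + 2 * ‖x ℓ‖ := by positivity
    calc 1 + 2 * ‖x (ℓ + 1)‖ ≤ (2 * K * Δt + 1) * (1 + 2 * ‖x ℓ‖) := by linarith
      _ ≤ Real.exp (2 * K * Δt) * (Real.exp (2 * K * (ℓ * Δt)) * (1 + 2 * ‖x 0‖)) :=
        mul_le_mul h3 h1 h4 (Real.exp_pos _).le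
      _ = _ := by
        rw [← mul_assoc, ← Real.exp_add]
        push_cast
        congr 2
        ring

theorem piecewiseConst_eq {K ℓ : ℕ} {Δt : ℝ} (hΔ : 0 < Δt) (hℓ : ℓ < K) (c : ℕ → ℝ) {t : ℝ}
    (ht : t ∈ Ico (ℓ * Δt) ((ℓ + 1) * Δt)) : piecewiseConst K Δt c t = c ℓ := by
  unfold piecewiseConst
  rw [Finset.sum_eq_single_of_mem ℓ (Finset.mem_range.2 hℓ)]
  · exact indicator_of_mem ht _
  · intro k _ hk
    refine indicator_of_notMem (fun hk' => ?_) _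
    have h1 : (k : ℝ) < ℓ + 1 := lt_of_mul_lt_mul_right (hk'.1.trans_lt ht.2) hΔ.le
    have h2 : (ℓ : ℝ) < k + 1 := lt_of_mul_lt_mul_right (ht.1.trans_lt hk'.2) hΔ.le
    have h3 : k < ℓ + 1 := by exact_mod_cast h1
    have h4 : ℓ < k + 1 := by exact_mod_cast h2
    omega

/-- The index `ℓ` starts at 0, so `x ℓ` is the state at time `ℓ Δt`, where step `ℓ` begins. The
constants depend only on a bound for all Euler iterates up to time `T`, not on `Δt` or `ℓ`. -/
theorem exists_discrete_control_bound {T : ℝ} (hT : 0 < T)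
    {F H : ∀ n : ℕ, Fin (n + 1) → (Fin (n + 1) → ℝ) → ℝ} {f h : ∀ n : ℕ, ℝ → (Fin n → ℝ) → ℝ}
    (hF : IsSymmetricFamily F f) (hH : IsSymmetricFamily H h)
    {α : ∀ n : ℕ, Fin (n + 1) → ℝ → ℝ} {a : ℝ → ℝ} (hα : ∀ n i, ∀ t ∈ Icc 0 T, α n i t = a t)
    (ha : ContinuousOn a (Icc 0 T)) (ha_pos : ∀ t ∈ Icc 0 T, 0 < a t)
    (hfg : LinearGrowth f) (hhg : LinearGrowth fun n ξ X => deriv (fun s => h n s X) ξ)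
    (n : ℕ) (x₀ : Fin (n + 1) → ℝ) (M : ℝ) :
    ∃ C : ℝ, ∃ Δ₀ > 0, ∀ (K : ℕ) (Δt : ℝ), 0 < Δt → Δt ≤ Δ₀ → K * Δt = T →
      ∀ (x c : ℕ → Fin (n + 1) → ℝ), x 0 = x₀ →
        (∀ ℓ < K, x (ℓ + 1) = eulerStep (F n) Δt (x ℓ) (c ℓ)) →
        (∀ ℓ < K, ∀ i, c ℓ i = -(1 / α n i (ℓ * Δt)) * partialDeriv (H n i) i (x ℓ)) →
        ∀ ℓ < K, ∀ (i : Fin (n + 1)) (w : Fin (n + 1) → ℝ), (∀ j, |w j - c ℓ j| ≤ M) →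
          ∃ v : ℝ, IsMinOn (oneStepCost (F n) (H n) (α n i (ℓ * Δt)) Δt (x ℓ) w i) univ v ∧
            (∀ v', IsMinOn (oneStepCost (F n) (H n) (α n i (ℓ * Δt)) Δt (x ℓ) w i) univ v' →
              v' = v) ∧
            ∀ t ∈ Ico (ℓ * Δt) ((ℓ + 1) * Δt),
              |piecewiseConst K Δt (fun k => c k i) t - v| ≤ C * Δt := by
  obtain ⟨κ, hκ, hdrift⟩ := exists_drift_bound ha ha_pos hfg hhg
  obtain ⟨Cf, hCf⟩ := hfg
  obtain ⟨D, hD⟩ := hhg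
  obtain ⟨t₀, ht₀, hmin⟩ := isCompact_Icc.exists_isMinOn (nonempty_Icc.2 hT.le) ha
  set B : ℝ := Real.exp (2 * κ * T) * (1 + 2 * ‖x₀‖) with hB
  have hB0 : 0 ≤ B := by positivity
  -- The terms bound, in this order, the uncontrolled velocity `F`, the control `c ℓ` (as the total
  -- velocity minus `F`), and the deviation of `w` from it.
  set W : ℝ := (|Cf| + (κ + |Cf|)) * (1 + 2 * B) + |M| with hW
  have hW0 : 0 ≤ W := by positivity
  obtain ⟨C, Δ₀, hΔ₀, hstep⟩ := exists_oneStep_bound (hH.smooth n) (abs_nonneg D)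
    (fun ξ Y => (hD n ξ Y).trans (mul_le_mul_of_nonneg_right (le_abs_self D) (by positivity)))
    (ha_pos t₀ ht₀) hB0 hW0
  refine ⟨C, Δ₀, hΔ₀, ?_⟩
  intro K Δt hΔ hΔ' hKT x c hx0 hx hc ℓ hℓ i w hw
  have htime : ∀ k < K, (k : ℝ) * Δt ∈ Icc 0 T := by
    intro k hk
    refine ⟨by positivity, ?_⟩
    rw [← hKT]
    have : (k : ℝ) ≤ K := by exact_mod_cast hk.le
    gcongr
  have hdr : ∀ k < K, ∀ i, F n i (x k) + c k i
      = drift (a (k * Δt)) f (fun n ξ X => deriv (fun s => h n s X) ξ) n (x k i)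
        (i.removeNth (x k)) := by
    intro k hk i
    rw [hc k hk i, hα n i _ (htime k hk), hH.partialDeriv_eq, hF.eq, drift]
    ring
  have hloc : ∀ k i, 1 + |x k i| + ‖i.removeNth (x k)‖ ≤ 1 + 2 * ‖x k‖ := by
    intro k i
    have h1 : |x k i| ≤ ‖x k‖ := norm_le_pi_norm (x k) i
    linarith [norm_removeNth_le (x k) i]
  have hFc : ∀ k < K, ∀ i, |F n i (x k) + c k i| ≤ κ * (1 + 2 * ‖x k‖) := fun k hk i => by
    rw [hdr k hk i]
    exact (hdrift _ (htime k hk) n _ _).trans (mul_le_mul_of_nonneg_left (hloc k i) hκ)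
  have hxB : ‖x ℓ‖ ≤ B := by
    have h1 := norm_le_of_eulerStep hκ hΔ hx hFc ℓ hℓ.le
    rw [hx0] at h1
    have h2 : Real.exp (2 * κ * (ℓ * Δt)) ≤ Real.exp (2 * κ * T) := by
      gcongr
      exact (htime ℓ hℓ).2
    have h3 := mul_le_mul_of_nonneg_right h2 (by positivity : 0 ≤ 1 + 2 * ‖x₀‖)
    linarith [norm_nonneg (x ℓ)]
  have hFb : ∀ i, |F n i (x ℓ)| ≤ |Cf| * (1 + 2 * B) := by
    intro i
    rw [hF.eq]
    refine (hCf n _ _).trans (mul_le_mul (le_abs_self _) ?_ (by positivity) (abs_nonneg _))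
    linarith [hloc ℓ i]
  have hcb : ∀ i, |c ℓ i| ≤ (κ + |Cf|) * (1 + 2 * B) := by
    intro i
    have h1 := abs_sub (F n i (x ℓ) + c ℓ i) (F n i (x ℓ))
    rw [add_sub_cancel_left] at h1
    have h2 := mul_le_mul_of_nonneg_left (by linarith : 1 + 2 * ‖x ℓ‖ ≤ 1 + 2 * B) hκ
    linarith [hFc ℓ hℓ i, hFb i]
  -- The other particles after the step: they do not depend on the control `u` of particle `i`, so
  -- the cost is a function of one real variable with `Z` as a parameter.
  set Z : Fin n → ℝ := i.removeNth (eulerStep (F n) Δt (x ℓ) w) with hZ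
  have hZb : ‖Z - i.removeNth (x ℓ)‖ ≤ Δt * W := by
    refine (pi_norm_le_iff_of_nonneg (by positivity)).2 fun j => ?_
    have h1 : (Z - i.removeNth (x ℓ)) j
        = Δt * (F n (i.succAbove j) (x ℓ) + w (i.succAbove j)) := by
      simp only [hZ, Pi.sub_apply, Fin.removeNth, eulerStep]
      ring
    rw [h1, norm_mul, Real.norm_of_nonneg hΔ.le, Real.norm_eq_abs]
    refine mul_le_mul_of_nonneg_left ?_ hΔ.le
    have h2 := abs_add_le (F n (i.succAbove j) (x ℓ)) (w (i.succAbove j))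
    have h3 := abs_add_le (w (i.succAbove j) - c ℓ (i.succAbove j)) (c ℓ (i.succAbove j))
    rw [sub_add_cancel] at h3
    have := hFb (i.succAbove j)
    have := hcb (i.succAbove j)
    have := hw (i.succAbove j)
    rw [hW, add_mul]
    linarith [le_abs_self M]
  have hcost : oneStepCost (F n) (H n) (α n i (ℓ * Δt)) Δt (x ℓ) w i
      = fun u => h n (x ℓ i + Δt * (F n i (x ℓ) + u)) Z + Δt * (a (ℓ * Δt) / 2 * u ^ 2) := by
    ext u
    have h1 : i.removeNth (eulerStep (F n) Δt (x ℓ) (Function.update w i u)) = Z := by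
      ext j
      simp [hZ, Fin.removeNth, eulerStep]
    rw [oneStepCost, hH.eq, h1, hα n i _ (htime ℓ hℓ)]
    simp [eulerStep]
  have hFW : |F n i (x ℓ)| ≤ W := by
    refine (hFb i).trans ?_
    rw [hW, add_mul]
    have : 0 ≤ (κ + |Cf|) * (1 + 2 * B) := by positivity
    linarith [abs_nonneg M]
  obtain ⟨v, hv1, hv2, hv3⟩ := hstep Δt hΔ hΔ' (a (ℓ * Δt)) (hmin (htime ℓ hℓ)) (x ℓ i)
    (F n i (x ℓ)) (i.removeNth (x ℓ)) Z ((norm_le_pi_norm (x ℓ) i).trans hxB)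
    ((norm_removeNth_le _ _).trans hxB) hFW hZb
  rw [hcost]
  refine ⟨v, hv1, hv2, fun t ht => ?_⟩
  rw [piecewiseConst_eq hΔ hℓ _ ht, hc ℓ hℓ i, hα n i _ (htime ℓ hℓ), hH.partialDeriv_eq]
  exact hv3

/-! ### The three assertions combined. -/

theorem lemma1
    (T : ℝ) (hT : 0 < T)
    -- the data of the system of `n + 1` particles, for every `n`
    (F H : ∀ n : ℕ, Fin (n + 1) → (Fin (n + 1) → ℝ) → ℝ)
    (f h : ∀ n : ℕ, ℝ → (Fin n → ℝ) → ℝ)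
    (hF : IsSymmetricFamily F f) (hH : IsSymmetricFamily H h)
    -- the weights of the control are common to all particles
    (α : ∀ n : ℕ, Fin (n + 1) → ℝ → ℝ) (a : ℝ → ℝ)
    (hα : ∀ n i, ∀ t ∈ Icc 0 T, α n i t = a t)
    (ha : ContinuousOn a (Icc 0 T)) (ha_pos : ∀ t ∈ Icc 0 T, 0 < a t)
    -- growth and equicontinuity, uniform in the number of particles
    (hf_growth : LinearGrowth f)
    (hh_growth : LinearGrowth (fun n ξ X => deriv (fun s => h n s X) ξ))
    (hf_equi : LocallyEquicontinuous f)
    (hh_equi : LocallyEquicontinuous (fun n ξ X => deriv (fun s => h n s X) ξ))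
    -- the mean-field limits of `f` and `h`
    (fbar hbar : ℝ → ProbabilityMeasure ℝ → ℝ)
    (hfbar : IsMeanFieldLimit f fbar) (hhbar : IsMeanFieldLimit h hbar)
    -- initial positions in a common compact set, with converging empirical measures
    (xbar : ∀ n : ℕ, Fin (n + 1) → ℝ) (hxbar : ∃ R : ℝ, ∀ n i, |xbar n i| ≤ R)
    (mbar : ProbabilityMeasure ℝ)
    (hmbar : Tendsto (fun n => emp (xbar n)) atTop (𝓝 mbar))
    -- the controlled particle dynamics
    (X : ∀ n : ℕ, ℝ → Fin (n + 1) → ℝ) (u : ∀ n : ℕ, Fin (n + 1) → ℝ → ℝ)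
    (hX0 : ∀ n, X n 0 = xbar n)
    (hX : ∀ n i, ∀ t ∈ Icc 0 T,
      HasDerivWithinAt (fun s => X n s i) (F n i (X n t) + u n i t) (Icc 0 T) t)
    (hu : ∀ n i, ∀ t ∈ Icc 0 T, u n i t = -(1 / α n i t) * partialDeriv (H n i) i (X n t)) :
    -- every subsequence has a further subsequence that converges to a weak solution
    (∀ φ : ℕ → ℕ, StrictMono φ → ∃ ψ : ℕ → ℕ, StrictMono ψ ∧
      ∃ m : ℝ → ProbabilityMeasure ℝ, IsWeakSolution T a fbar hbar mbar m ∧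
        Tendsto (fun k => ⨆ t ∈ Icc 0 T, d1 (emp (X (φ (ψ k)) t)) (m t)) atTop (𝓝 0)) ∧
    -- for linear moduli of continuity, the whole sequence converges to the unique weak solution
    (LocallyEquiLipschitz f →
      LocallyEquiLipschitz (fun n ξ X => deriv (fun s => h n s X) ξ) →
      ∃ m : ℝ → ProbabilityMeasure ℝ, IsWeakSolution T a fbar hbar mbar m ∧
        (∀ m' : ℝ → ProbabilityMeasure ℝ, IsWeakSolution T a fbar hbar mbar m' →
          ∀ t ∈ Icc 0 T, m' t = m t) ∧
        Tendsto (fun n => ⨆ t ∈ Icc 0 T, d1 (emp (X n t)) (m t)) atTop (𝓝 0)) ∧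
    -- the discretized control is `O(Δt)`-close to the minimizer of the one-step problem; the other
    -- particles use the discretized control (`M = 0`) or any control at distance at most `M` from it
    (∀ (n : ℕ) (M : ℝ), ∃ C : ℝ, ∃ Δ₀ > 0, ∀ (K : ℕ) (Δt : ℝ),
      0 < Δt → Δt ≤ Δ₀ → K * Δt = T →
      ∀ (x c : ℕ → Fin (n + 1) → ℝ), x 0 = xbar n →
        (∀ ℓ < K, x (ℓ + 1) = eulerStep (F n) Δt (x ℓ) (c ℓ)) →
        (∀ ℓ < K, ∀ i, c ℓ i = -(1 / α n i (ℓ * Δt)) * partialDeriv (H n i) i (x ℓ)) →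
        ∀ ℓ < K, ∀ (i : Fin (n + 1)) (w : Fin (n + 1) → ℝ), (∀ j, |w j - c ℓ j| ≤ M) →
          ∃ v : ℝ, IsMinOn (oneStepCost (F n) (H n) (α n i (ℓ * Δt)) Δt (x ℓ) w i) univ v ∧
            (∀ v', IsMinOn (oneStepCost (F n) (H n) (α n i (ℓ * Δt)) Δt (x ℓ) w i) univ v' →
              v' = v) ∧
            ∀ t ∈ Ico (ℓ * Δt) ((ℓ + 1) * Δt),
              |piecewiseConst K Δt (fun k => c k i) t - v| ≤ C * Δt) := by
  have hflow : IsParticleFlow T a f (fun n ξ X => deriv (fun s => h n s X) ξ) X := by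
    intro n i t ht
    refine (hX n i t ht).congr_deriv ?_
    rw [hu n i t ht, hα n i t ht, hH.partialDeriv_eq, hF.eq, drift]
    ring
  have hX0b : ∃ R, ∀ n i, |X n 0 i| ≤ R := by
    obtain ⟨R, hR⟩ := hxbar
    exact ⟨R, fun n i => by rw [hX0]; exact hR n i⟩
  have hmbar' : Tendsto (fun n => emp (X n 0)) atTop (𝓝 mbar) := by
    simp only [hX0]
    exact hmbar
  have hsub : ∀ φ : ℕ → ℕ, StrictMono φ → ∃ ψ : ℕ → ℕ, StrictMono ψ ∧
      ∃ m : ℝ → ProbabilityMeasure ℝ, IsWeakSolution T a fbar hbar mbar m ∧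
        Tendsto (fun k => ⨆ t ∈ Icc 0 T, d1 (emp (X (φ (ψ k)) t)) (m t)) atTop (𝓝 0) :=
    fun φ hφ => hflow.exists_subseq_tendsto hT ha ha_pos hF.smooth hH.smooth hf_growth hh_growth
      hh_equi hfbar hhbar hX0b hmbar' hφ
  refine ⟨hsub, fun hfL hhL => ?_, fun n M =>
    exists_discrete_control_bound hT hF hH hα ha ha_pos hf_growth hh_growth n (xbar n) M⟩
  have hdbar := isMeanFieldLimit_deriv hhbar (fun n Y ξ =>
    (hasDerivAt_fst_of_contDiff (hH.smooth n) ξ Y).differentiableAt) hh_equi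
  obtain ⟨-, -, m, hm, -⟩ := hsub id strictMono_id
  have huniq : ∀ m' : ℝ → ProbabilityMeasure ℝ, IsWeakSolution T a fbar hbar mbar m' →
      ∀ t ∈ Icc 0 T, m' t = m t := fun m' hm' t ht =>
    hm'.unique ha ha_pos hfbar hdbar hfL hhL hm ht
  refine ⟨m, hm, huniq, ?_⟩
  -- Every sequence of indices tending to infinity has a strictly increasing subsequence, to which
  -- the compactness statement applies; by uniqueness the limit it yields is always `m`.
  refine tendsto_of_subseq_tendsto fun ns hns => ?_
  obtain ⟨φ₀, hφ₀, hmono⟩ := strictMono_subseq_of_tendsto_atTop hns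
  obtain ⟨ψ, hψ, m', hm', hlim⟩ := hsub (ns ∘ φ₀) hmono
  refine ⟨φ₀ ∘ ψ, hlim.congr fun k => iSup_congr fun t => iSup_congr fun ht => ?_⟩
  rw [huniq m' hm' t ht]
  rfl
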